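/- Let $\mathbb K$ be a field of characteristic $\neq 2$, let $n\ge 0$, and let $\mathcal Q=\{\mathbf q_1,\dots,\mathbf q_n\}$, $\overline{\mathcal Q}=\{\bar{\mathbf q}_1,\dots,\bar{\mathbf q}_n\}$, $\mathcal E=\{\mathbf i,\mathbf j,\mathbf k\}$, $\mathcal A=\mathcal Q\cup\overline{\mathcal Q}\cup\mathcal E$, with the order $\mathbf q_1\prec\bar{\mathbf q}_1\prec\mathbf q_2\prec\bar{\mathbf q}_2\prec\cdots\prec\mathbf q_n\prec\bar{\mathbf q}_n\prec\mathbf i\prec\mathbf j\prec\mathbf k$. On the free associative algebra $\mathbb K\langle\mathcal A\rangle$ let conjugation $f\mapsto\bar f$ be the $\mathbb K$-linear anti-automorphism with $\mathbf q_l\leftrightarrow\bar{\mathbf q}_l$ and $\mathbf e\mapsto-\mathbf e$ for $\mathbf e\in\mathcal E$, and let $[f]=f+\bar f$. Monomials are ordered by the degree lexicographic order, and $p\preceq f$ for polynomials means that $p=0$, or $p,f\neq 0$ and the leading monomial of $p$ is $\preceq$ that of $f$. A polynomial $f$ is *reduced to* $h$ by a set $G$ if $h\preceq f$ and $f=h+\sum_i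 \mathbf A_i g_i\mathbf B_i$ (a finite sum) with $g_i\in G$, with $\mathbf A_i,\mathbf B_i$ scalar multiples of monomials, and with every $\mathbf A_i g_i\mathbf B_i\preceq f$. Let $\mathbf{BG}\subset\mathbb K\langle\mathcal A\rangle$ consist of the following elements, where in each element the letters $\mathbf 1\prec\mathbf 2\prec\mathbf 3\prec\mathbf 4$ and $\mathbf m$ are those of $\mathcal Q$ that occur in it, otherwise arbitrary, and $\mathbf e'\preceq\mathbf e$ are arbitrary in $\mathcal E$: * (BG2a) the multiplication table $\mathbf i^2+1$, $\mathbf j^2+1$, $\mathbf k^2+1$, $\mathbf{ij}-\mathbf k$, $\mathbf{ji}+\mathbf k$, $\mathbf{jk}-\mathbf i$, $\mathbf{kj}+\mathbf i$, $\mathbf{ki}-\mathbf j$, $\mathbf{ik}+\mathbf j$; * (BG2b) $\bar{\mathbf 1}\mathbf 1-\mathbf 1\bar{\mathbf 1}$, $[\mathbf 2]\bar{\mathbf 1}-\bar{\mathbf 1}[\mathbf 2]$, $[\mathbf 2]\mathbf 1-\mathbf 1[\mathbf 2]$; * (BG2c) $\mathbf 2[\mathbf 1]-[\mathbf 1]\mathbf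 2$, $\mathbf e[\mathbf 1]-[\mathbf 1]\mathbf e$; * (BG3a) $\mathbf{k1k}+\mathbf{j1j}+\mathbf{i1i}+2\bar{\mathbf 1}+\mathbf 1$; * (BG3b) $[\mathbf T]\mathbf a-\mathbf a[\mathbf T]$ for $(\mathbf T,\mathbf a)$ equal to $(\mathbf{32},\mathbf 1)$, $(\mathbf{31},\bar{\mathbf 2})$, $(\mathbf{31},\mathbf 2)$, $(\mathbf{21},\bar{\mathbf 1})$, $(\mathbf{21},\mathbf 1)$, $(\mathbf{e2},\mathbf 1)$, $(\mathbf{e1},\mathbf 2)$, $(\mathbf{e1},\bar{\mathbf 2})$, $(\mathbf{e1},\mathbf 1)$, $(\mathbf{e1},\bar{\mathbf 1})$, $(\mathbf{j1},\mathbf i)$, $(\mathbf{k1},\mathbf i)$, $(\mathbf{k1},\mathbf j)$; * (BG3c) $\mathbf 2[\mathbf{21}]-[\mathbf{21}]\mathbf 2$; * (BG4) $\mathbf a[\mathbf T]-[\mathbf T]\mathbf a$ for $(\mathbf a,\mathbf T)$ equal to $(\mathbf 3,\mathbf{231})$, $(\mathbf 3,\mathbf{241})$, $(\mathbf 3,\mathbf{2e1})$,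 and $(\mathbf e',\mathbf{2e1})$ with $(\mathbf e',\mathbf e)\ne(\mathbf k,\mathbf k)$; * (BGm, $m\ge5$) $\mathbf 3[\mathbf{2Am1}]-[\mathbf{2Am1}]\mathbf 3$ and $\mathbf 3[\mathbf{2Ae1}]-[\mathbf{2Ae1}]\mathbf 3$, where $\mathbf A=\mathbf x_4\cdots\mathbf x_{m-1}$ is a sequence of $m-4\geq 1$ letters of $\mathcal Q\cup\overline{\mathcal Q}$ with $\mathbf 3\preceq\mathbf x_4\preceq\cdots\preceq\mathbf x_{m-1}$, and, in the first element, $\mathbf x_{m-1}\prec\mathbf m\in\mathcal Q$. Let $\overline{\mathbf{BG}}$ be the union of $\mathbf{BG}$ with all polynomials obtained from elements of $\mathbf{BG}$ outside the multiplication table (BG2a) by replacing any number of letters by their conjugates. Here a letter may be replaced throughout the element (barred occurrences included); moreover, in the elements $\pm(\mathbf a[\mathbf T]-[\mathbf T]\mathbf a)$ of (BG2b)–(BGm) displayed with a bracket, the letter $\mathbf a$ (in both of its displayed places) and the individual entries of the sequence $\mathbf T$ may be replaced by their conjugates independently of each other. Then every element of $\overline{\mathbf{BG}}$ is reduced to $0$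 by $\mathbf{BG}$. -/

import Mathlib

noncomputable section

namespace QuatPoly

/-- The three basis letters. -/
inductive Basis where
  | i
  | j
  | k
  deriving DecidableEq

/-- The alphabet `𝒜` with `n` quaternionic variables: `q l` is the variable `q_l`,
`qb l` is the letter for its conjugate, `e b` is a basis letter. -/
inductive Letter (n : ℕ) where
  | q (l : Fin n)
  | qb (l : Fin n)
  | e (b : Basis)
  deriving DecidableEq

namespace Letter

/-- Position of a letter in the conjugate-alternating order
`q_1 ≺ q̄_1 ≺ q_2 ≺ q̄_2 ≺ ⋯ ≺ q_n ≺ q̄_n ≺ i ≺ j ≺ k`. -/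
def rank {n : ℕ} : Letter n → ℕ
  | q l => 2 * (l : ℕ)
  | qb l => 2 * (l : ℕ) + 1
  | e Basis.i => 2 * n
  | e Basis.j => 2 * n + 1
  | e Basis.k => 2 * n + 2

theorem rank_injective {n : ℕ} : Function.Injective (rank (n := n)) := by
  intro a b h
  rcases a with ⟨l, hl⟩ | ⟨l, hl⟩ | (_ | _ | _) <;>
    rcases b with ⟨m, hm⟩ | ⟨m, hm⟩ | (_ | _ | _) <;>
    simp only [rank, Letter.q.injEq, Letter.qb.injEq, Fin.mk.injEq, reduceCtorEq] at h ⊢ <;> omega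

/-- The conjugate-alternating order. -/
instance {n : ℕ} : LinearOrder (Letter n) := LinearOrder.lift' rank rank_injective

/-- The letter is a quaternionic variable or the conjugate of one (an element of `𝒬 ∪ 𝒬̄`). -/
def IsVar {n : ℕ} : Letter n → Prop
  | q _ => True
  | qb _ => True
  | e _ => False

/-- The underlying letter of `𝒬 ∪ ℰ`, forgetting the bar. -/
def base {n : ℕ} : Letter n → Letter n
  | q l => q l
  | qb l => q l
  | e b => e b

end Letter

/-- Monic monomials: sequences of letters. -/
abbrev Mon (n : ℕ) := FreeMonoid (Letter n)

/-- The free associative `K`-algebra on the alphabet. -/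
abbrev Poly (K : Type*) [Field K] (n : ℕ) := MonoidAlgebra K (Mon n)

section

variable {K : Type*} [Field K] {n : ℕ}

/-- A letter as a polynomial. -/
def X (a : Letter n) : Poly K n := MonoidAlgebra.single (FreeMonoid.of a) 1

/-- The conjugate of a letter: `q ↦ q̄`, `q̄ ↦ q`, and `e ↦ -e` for basis letters. -/
def conjLetter : Letter n → Poly K n
  | Letter.q l => X (Letter.qb l)
  | Letter.qb l => X (Letter.q l)
  | Letter.e b => -X (Letter.e b)

/-- Conjugation as an algebra homomorphism to the opposite algebra. -/
def conjHom : Poly K n →ₐ[K] (Poly K n)ᵐᵒᵖ :=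
  MonoidAlgebra.lift K (Poly K n)ᵐᵒᵖ (Mon n)
    (FreeMonoid.lift fun a => MulOpposite.op (conjLetter a))

/-- Quaternionic conjugation: the `K`-linear anti-automorphism with
`a_1 ⋯ a_m ↦ conj a_m ⋯ conj a_1`. -/
def conj (f : Poly K n) : Poly K n := (conjHom f).unop

/-- The bracket `[f] = f + f̄` (twice the scalar part). -/
def bracket (f : Poly K n) : Poly K n := f + conj f

/-- The product of a sequence of letters. -/
def word (T : List (Letter n)) : Poly K n := (T.map X).prod

/-! ### Order and reduction -/

/-- The degree lexicographic order on monomials (non-strict). -/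
def MonLE (v w : Mon n) : Prop :=
  v = w ∨ List.Shortlex (· < ·) (FreeMonoid.toList v) (FreeMonoid.toList w)

/-- `f ⪯ g`: the leading monomial of `f` is at most the leading monomial of `g`
(`f = 0` is below everything). -/
def PolyLE (f g : Poly K n) : Prop :=
  ∀ v ∈ f.coeff.support, ∃ w ∈ g.coeff.support, MonLE v w

/-- `f` is reduced to `h` with respect to `G`: `h ⪯ f` and `f = h + ∑ A_i g_i B_i` with finitely
many `g_i ∈ G` and (scaled) monomials `A_i`, `B_i` such that each `A_i g_i B_i ⪯ f`. -/
def ReducesTo (G : Set (Poly K n)) (f h : Poly K n) : Prop :=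
  PolyLE h f ∧
  ∃ (r : ℕ) (c : Fin r → K) (A B : Fin r → Mon n) (g : Fin r → Poly K n),
    (∀ t, g t ∈ G) ∧
    (∀ t, PolyLE (MonoidAlgebra.single (A t) (c t) * g t * MonoidAlgebra.single (B t) 1) f) ∧
    f = h + ∑ t, MonoidAlgebra.single (A t) (c t) * g t * MonoidAlgebra.single (B t) 1

end

/-! ### The set `BG` -/

open QuatPoly.Letter QuatPoly.Basis

/-- The elements of `BG` written `a[T] - [T]a`, given by the letter `a` and the sequence `T`. -/
inductive LetterFirst {n : ℕ} : Letter n → List (Letter n) → Prop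
  -- degree 2, group (c)
  | c2_var {x1 x2 : Fin n} : x1 < x2 → LetterFirst (q x2) [q x1]
  | c2_basis (b : Basis) (x1 : Fin n) : LetterFirst (e b) [q x1]
  -- degree 3, group (c)
  | c3 {x1 x2 : Fin n} : x1 < x2 → LetterFirst (q x2) [q x2, q x1]
  -- degree 4
  | d4_323 {x1 x2 x3 : Fin n} : x1 < x2 → x2 < x3 → LetterFirst (q x3) [q x2, q x3, q x1]
  | d4_324 {x1 x2 x3 x4 : Fin n} : x1 < x2 → x2 < x3 → x3 < x4 →
      LetterFirst (q x3) [q x2, q x4, q x1]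
  | d4_32e {x1 x2 x3 : Fin n} (b : Basis) : x1 < x2 → x2 < x3 →
      LetterFirst (q x3) [q x2, e b, q x1]
  | d4_e2e {x1 x2 : Fin n} (b' b : Basis) : x1 < x2 → (e b' : Letter n) ≤ e b →
      (b', b) ≠ (k, k) → LetterFirst (e b') [q x2, e b, q x1]
  -- degree `m ≥ 5`; `A` is the sequence `x_4 ⋯ x_{m-1}`
  | dm_var {x1 x2 x3 m : Fin n} (A : List (Letter n)) : x1 < x2 → x2 < x3 → A ≠ [] →
      (∀ x ∈ A, x.IsVar ∧ q x3 ≤ x ∧ x < q m) → A.Pairwise (· ≤ ·) →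
      LetterFirst (q x3) (q x2 :: (A ++ [q m, q x1]))
  | dm_basis {x1 x2 x3 : Fin n} (b : Basis) (A : List (Letter n)) : x1 < x2 → x2 < x3 → A ≠ [] →
      (∀ x ∈ A, x.IsVar ∧ q x3 ≤ x) → A.Pairwise (· ≤ ·) →
      LetterFirst (q x3) (q x2 :: (A ++ [e b, q x1]))

/-- The elements of `BG` written `[T]a - a[T]`, given by the letter `a` and the sequence `T`. -/
inductive BracketFirst {n : ℕ} : Letter n → List (Letter n) → Prop
  -- degree 2, group (b)
  | b2_1 {x1 x2 : Fin n} : x1 < x2 → BracketFirst (qb x1) [q x2]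
  | b2_2 {x1 x2 : Fin n} : x1 < x2 → BracketFirst (q x1) [q x2]
  -- degree 3, group (b)
  | b3_1 {x1 x2 x3 : Fin n} : x1 < x2 → x2 < x3 → BracketFirst (q x1) [q x3, q x2]
  | b3_2 {x1 x2 x3 : Fin n} : x1 < x2 → x2 < x3 → BracketFirst (qb x2) [q x3, q x1]
  | b3_3 {x1 x2 x3 : Fin n} : x1 < x2 → x2 < x3 → BracketFirst (q x2) [q x3, q x1]
  | b3_4 {x1 x2 : Fin n} : x1 < x2 → BracketFirst (qb x1) [q x2, q x1]
  | b3_5 {x1 x2 : Fin n} : x1 < x2 → BracketFirst (q x1) [q x2, q x1]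
  | b3_6 {x1 x2 : Fin n} (b : Basis) : x1 < x2 → BracketFirst (q x1) [e b, q x2]
  | b3_7 {x1 x2 : Fin n} (b : Basis) : x1 < x2 → BracketFirst (q x2) [e b, q x1]
  | b3_8 {x1 x2 : Fin n} (b : Basis) : x1 < x2 → BracketFirst (qb x2) [e b, q x1]
  | b3_9 (x1 : Fin n) (b : Basis) : BracketFirst (q x1) [e b, q x1]
  | b3_10 (x1 : Fin n) (b : Basis) : BracketFirst (qb x1) [e b, q x1]
  | b3_11 (x1 : Fin n) : BracketFirst (e i) [e j, q x1]
  | b3_12 (x1 : Fin n) : BracketFirst (e i) [e k, q x1]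
  | b3_13 (x1 : Fin n) : BracketFirst (e j) [e k, q x1]

/-- The multiplication table of the basis letters (degree 2, group (a)). -/
def multTable (K : Type*) [Field K] (n : ℕ) : Set (Poly K n) :=
  {X (e i) * X (e i) + 1, X (e j) * X (e j) + 1, X (e k) * X (e k) + 1,
   X (e i) * X (e j) - X (e k), X (e j) * X (e i) + X (e k),
   X (e j) * X (e k) - X (e i), X (e k) * X (e j) + X (e i),
   X (e k) * X (e i) - X (e j), X (e i) * X (e k) + X (e j)}

/-- The set `BG`. -/
inductive BG (K : Type*) [Field K] (n : ℕ) : Set (Poly K n)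
  | table (f : Poly K n) : f ∈ multTable K n → BG K n f
  -- degree 2, group (b), first element
  | conj_comm (l : Fin n) : BG K n (X (qb l) * X (q l) - X (q l) * X (qb l))
  -- degree 3, group (a)
  | conj_def (l : Fin n) : BG K n
      (X (e k) * X (q l) * X (e k) + X (e j) * X (q l) * X (e j) + X (e i) * X (q l) * X (e i)
        + 2 * X (qb l) + X (q l))
  | letter_first (a : Letter n) (T : List (Letter n)) : LetterFirst a T →
      BG K n (X a * bracket (word T) - bracket (word T) * X a)
  | bracket_first (a : Letter n) (T : List (Letter n)) : BracketFirst a T →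
      BG K n (bracket (word T) * X a - X a * bracket (word T))

/-! ### Replacing letters by their conjugates -/

/-- Replace every letter of `S` by its conjugate, wherever it occurs (barred or not). -/
def replace {K : Type*} [Field K] {n : ℕ} (S : Finset (Letter n)) : Poly K n →ₐ[K] Poly K n :=
  MonoidAlgebra.lift K (Poly K n) (Mon n)
    (FreeMonoid.lift fun a => if a.base ∈ S then conjLetter a else X a)

/-- `p` is the letter `a` or its conjugate. -/
def IsVariant {K : Type*} [Field K] {n : ℕ} (a : Letter n) (p : Poly K n) : Prop :=
  p = X a ∨ p = conjLetter a

/-- `BG` together with the polynomials obtained from it by replacing letters by their conjugates.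
The multiplication table, in which no quaternionic variable occurs, is left as it is. Elsewhere
a letter may be replaced throughout the element (`everywhere`), and in a commutator of a letter
and a bracket the letter and the individual places of the bracketed sequence may also be
conjugated independently of each other (`letter_first`, `bracket_first`). -/
inductive BGbar (K : Type*) [Field K] (n : ℕ) : Set (Poly K n)
  | of_BG (f : Poly K n) : f ∈ BG K n → BGbar K n f
  | everywhere (f : Poly K n) (S : Finset (Letter n)) : f ∈ BG K n → f ∉ multTable K n →
      BGbar K n (replace S f)
  | letter_first (a : Letter n) (T : List (Letter n)) (a' : Poly K n) (T' : List (Poly K n)) :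
      LetterFirst a T → IsVariant a a' → List.Forall₂ IsVariant T T' →
      BGbar K n (a' * bracket T'.prod - bracket T'.prod * a')
  | bracket_first (a : Letter n) (T : List (Letter n)) (a' : Poly K n) (T' : List (Poly K n)) :
      BracketFirst a T → IsVariant a a' → List.Forall₂ IsVariant T T' →
      BGbar K n (bracket T'.prod * a' - a' * bracket T'.prod)

end QuatPoly

end

/-!
A variant `f` of an element of `BG` reduces to `0` once it is written as a combination of products
`A g B`, with `g ∈ BG`, whose monomials do not exceed one word `w` that really occurs in `f`
(`reducesTo_zero_of_mem_relSpan`). Up to sign `f` is, apart from a few elements treated by hand, a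
commutator `a[T] - [T]a` with bars placed arbitrarily on the letter `a` and on the entries of `T`
(`boundedBySelf_variant`). The work is to write these commutators with control of the words.

*Degree only.* Most terms that appear when a bar is moved begin with a letter smaller than the
first letter of `w`, and for them it suffices to bound the degree. This is dealt with once and for
all in a graded quotient of the free algebra, in which a homogeneous element of degree `d` vanishes
exactly when it is a combination of products `A g B` of degree at most `d`. There every bracket is
central (`proj_bracket_mem_center`). Indeed, `2` being invertible, words are spanned over the sums
`x + x̄` by products of the imaginary parts `x - x̄`. The elements of `BG` of degree at most four
make `x + x̄`, the anticommutators of imaginary parts and their scalar triple products central: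
the commutator of a letter with an anticommutator satisfies a Jacobi identity, and that with a
triple product is alternating in its four letters. As in a Clifford algebra, products of three
imaginary parts are then central combinations of `1` and of single imaginary parts, so that by
induction on the length of `T` all brackets `[T]` are central (`bracket_mem_center`).

*Leading words.* Replacing `x` by `x̄ = [x] - x` changes the sign of a commutator and adds terms
containing commutators with `[x]`. For the letter `a` and for the outer entries of
`T = y U x` these terms are small enough, by the previous step and by the relations of degree two
(`Rel.bar_letter`, `Rel.bar_first`, `Rel.bar_last`). For sorted inner letters `U` that are
variables, `BG` contains the commutators in which the last inner letter is unbarred and exceeds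
the others; the remaining ones follow by induction on the length of `U`, because the last two inner
letters can be removed, when they are equal, by `w² = [w]w - w̄w`, and, when they are `q q̄`, because
`q q̄` is central (`rel_of_sorted`). If the last inner letter is a basis letter, `BG` contains all
the sorted cases. Finally, an unsorted placement of bars is sorted by interchanging neighbours
`q̄ q`, which does not increase the leading word (`Rel.swap`, `of_sorted_of_swap`).

The word `w` occurs in the commutator because the other three words of the commutator differ from it
in the first or second letter (`BoundedBySelf.comm_of_ne`, `BoundedBySelf.comm_of_ne_append`). The
element `q̄ q - q q̄` is its own variant up to sign, and so is the relation defining `q̄`, modulo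
commutators with `[q]` and the squares of the basis letters.
-/

namespace QuatPoly

open Letter

variable {K : Type*} [Field K] {n : ℕ}

/-! ### Words in the degree lexicographic order -/

/-- The degree lexicographic order `MonLE`, on words written as lists of letters. -/
def WordLE (v w : List (Letter n)) : Prop :=
  MonLE (FreeMonoid.ofList v) (FreeMonoid.ofList w)

theorem wordLE_def {v w : List (Letter n)} :
    WordLE v w ↔ v = w ∨ v.length < w.length ∨ v.length = w.length ∧ List.Lex (· < ·) v w := by
  unfold WordLE MonLE
  rw [← List.shortlex_def]
  simp

theorem WordLE.refl (v : List (Letter n)) : WordLE v v := Or.inl rfl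

theorem WordLE.of_length_lt {v w : List (Letter n)} (h : v.length < w.length) : WordLE v w :=
  wordLE_def.2 (Or.inr (Or.inl h))

theorem WordLE.length_le {v w : List (Letter n)} (h : WordLE v w) : v.length ≤ w.length := by
  rcases wordLE_def.1 h with rfl | h | h
  · exact le_rfl
  · exact h.le
  · exact h.1.le

theorem wordLE_cons_cons {x y : Letter n} {v w : List (Letter n)} :
    WordLE (x :: v) (y :: w) ↔
      v.length < w.length ∨ v.length ≤ w.length ∧ x < y ∨ x = y ∧ WordLE v w := by
  simp only [wordLE_def, List.cons.injEq, List.length_cons, List.cons_lex_cons_iff,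
    Nat.add_lt_add_iff_right, Nat.add_right_cancel_iff]
  constructor
  · rintro (h | h | ⟨h, h' | h'⟩)
    · tauto
    · tauto
    · exact Or.inr (Or.inl ⟨h.le, h'⟩)
    · tauto
  · rintro (h | ⟨h, h'⟩ | ⟨h, h' | h' | h'⟩)
    · tauto
    · rcases h.lt_or_eq with h | h <;> tauto
    · tauto
    · tauto
    · tauto

theorem WordLE.append_left {v w : List (Letter n)} (A : List (Letter n)) (h : WordLE v w) :
    WordLE (A ++ v) (A ++ w) := by
  induction A with
  | nil => exact h
  | cons a A ih => exact wordLE_cons_cons.2 (Or.inr (Or.inr ⟨rfl, ih⟩))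

theorem WordLE.append_right {v w : List (Letter n)} (B : List (Letter n)) (h : WordLE v w) :
    WordLE (v ++ B) (w ++ B) := by
  induction v generalizing w with
  | nil =>
    cases w with
    | nil => exact WordLE.refl _
    | cons y w => exact .of_length_lt (by simp)
  | cons x v ih =>
    cases w with
    | nil => have := h.length_le; simp at this
    | cons y w =>
      rcases wordLE_cons_cons.1 h with h | ⟨h, h'⟩ | ⟨h, h'⟩
      · exact .of_length_lt (by simpa using h)
      · exact wordLE_cons_cons.2 (Or.inr (Or.inl ⟨by simpa using h, h'⟩))
      · exact wordLE_cons_cons.2 (Or.inr (Or.inr ⟨h, ih h'⟩))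

/-! ### Words and conjugation in the free algebra -/

theorem word_nil : word ([] : List (Letter n)) = (1 : Poly K n) := rfl

theorem word_cons (a : Letter n) (T : List (Letter n)) :
    word (a :: T) = (X a * word T : Poly K n) := rfl

theorem word_append (S T : List (Letter n)) : word (S ++ T) = (word S * word T : Poly K n) := by
  simp [word]

theorem word_eq_single (T : List (Letter n)) :
    (word T : Poly K n) = MonoidAlgebra.single (FreeMonoid.ofList T) 1 := by
  induction T with
  | nil => rfl
  | cons a T ih =>
    rw [word_cons, ih, X, MonoidAlgebra.single_mul_single, one_mul]
    rfl

theorem conj_neg (f : Poly K n) : conj (-f) = -conj f := by simp [conj]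

theorem conj_mul (f g : Poly K n) : conj (f * g) = conj g * conj f := by simp [conj]

theorem conj_one : conj (1 : Poly K n) = 1 := by simp [conj]

theorem conj_X (a : Letter n) : conj (X a : Poly K n) = conjLetter a := by
  simp [conj, conjHom, X, MonoidAlgebra.lift_single]

theorem conj_conjLetter (a : Letter n) : conj (conjLetter a : Poly K n) = X a := by
  cases a <;> simp [conjLetter, conj_neg, conj_X]

namespace Letter

/-- The letter carrying the conjugate of `a`, up to sign: the bar is toggled on the
quaternionic variables, and the basis letters are fixed. -/
def bar : Letter n → Letter n
  | q l => qb l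
  | qb l => q l
  | e b => e b

@[simp] theorem bar_q (l : Fin n) : bar (q l) = qb l := rfl
@[simp] theorem bar_qb (l : Fin n) : bar (qb l) = q l := rfl

@[simp] theorem bar_bar (a : Letter n) : a.bar.bar = a := by cases a <;> rfl

/-- The letter `x` is a variable and, whatever bars are put on `x` and `y`, it precedes `y`. -/
def Below (x y : Letter n) : Prop :=
  x.IsVar ∧ x < y ∧ x.bar < y ∧ x < y.bar ∧ x.bar < y.bar

theorem lt_iff_rank {a b : Letter n} : a < b ↔ a.rank < b.rank := Iff.rfl

theorem le_iff_rank {a b : Letter n} : a ≤ b ↔ a.rank ≤ b.rank := Iff.rfl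

theorem Below.q_q {x y : Fin n} (h : x < y) : Below (q x) (q y) := by
  have : (x : ℕ) < y := h
  refine ⟨trivial, ?_, ?_, ?_, ?_⟩ <;> simp only [bar, lt_iff_rank, rank] <;> omega

theorem Below.q_e (x : Fin n) (b : Basis) : Below (q x) (e b) := by
  have := x.2
  refine ⟨trivial, ?_, ?_, ?_, ?_⟩ <;> cases b <;> simp only [bar, lt_iff_rank, rank] <;> omega

theorem Below.bar_left {x y : Letter n} (h : Below x y) : Below x.bar y := by
  obtain ⟨h0, h1, h2, h3, h4⟩ := h
  refine ⟨by cases x <;> trivial, h2, by simpa, h4, by simpa⟩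

theorem Below.bar_right {x y : Letter n} (h : Below x y) : Below x y.bar := by
  obtain ⟨h0, h1, h2, h3, h4⟩ := h
  exact ⟨h0, h3, h4, by simpa, by simpa⟩

theorem Below.trans {x y z : Letter n} (h : Below x y) (h' : Below y z) : Below x z :=
  ⟨h.1, h.2.1.trans h'.2.1, h.2.2.1.trans h'.2.1, h.2.1.trans h'.2.2.2.1,
    h.2.2.1.trans h'.2.2.2.1⟩

end Letter

theorem conjLetter_of_isVar {a : Letter n} (h : a.IsVar) : (conjLetter a : Poly K n) = X a.bar := by
  cases a
  · rfl
  · rfl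
  · exact h.elim

theorem bracket_X_of_isVar {a : Letter n} (h : a.IsVar) :
    (bracket (X a) : Poly K n) = X a + X a.bar := by
  rw [bracket, conj_X, conjLetter_of_isVar h]

theorem bracket_X_e (b : Basis) : (bracket (X (e b : Letter n)) : Poly K n) = 0 := by
  simp [bracket, conj_X, conjLetter]

theorem bracket_conj (a : Letter n) : (bracket (conjLetter a) : Poly K n) = bracket (X a) := by
  rw [bracket, bracket, conj_conjLetter, conj_X, add_comm]

/-! ### Polynomials supported on a set of words -/

/-- The polynomials all of whose monomials lie in the set `D` of words. -/
noncomputable def wordSpan (K : Type*) [Field K] {n : ℕ} (D : Set (List (Letter n))) :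
    Submodule K (Poly K n) :=
  Submodule.span K (word '' D)

theorem word_mem_wordSpan {D : Set (List (Letter n))} {T : List (Letter n)} (h : T ∈ D) :
    word T ∈ wordSpan K D :=
  Submodule.subset_span ⟨T, h, rfl⟩

theorem wordSpan_mono {D D' : Set (List (Letter n))} (h : D ⊆ D') :
    wordSpan K D ≤ wordSpan K D' :=
  Submodule.span_mono (Set.image_mono h)

theorem mem_of_mem_support {D : Set (List (Letter n))} {f : Poly K n} (hf : f ∈ wordSpan K D)
    {v : Mon n} (hv : v ∈ f.coeff.support) : FreeMonoid.toList v ∈ D := by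
  induction hf using Submodule.span_induction with
  | mem x h =>
    obtain ⟨T, hT, rfl⟩ := h
    rw [word_eq_single] at hv
    have : v = FreeMonoid.ofList T := by
      by_contra hne
      exact hne (by simpa [MonoidAlgebra.coeff_single] using hv)
    subst this
    exact hT
  | zero => simp at hv
  | add x y _ _ hx hy =>
    classical
    rw [MonoidAlgebra.coeff_add] at hv
    rcases Finset.mem_union.1 (Finsupp.support_add hv) with h | h
    · exact hx h
    · exact hy h
  | smul c x _ hx =>
    rw [MonoidAlgebra.coeff_smul] at hv
    exact hx (Finsupp.support_smul hv)

theorem mul_mem_wordSpan {D D' D'' : Set (List (Letter n))} {f g : Poly K n}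
    (hf : f ∈ wordSpan K D) (hg : g ∈ wordSpan K D')
    (h : ∀ u ∈ D, ∀ v ∈ D', u ++ v ∈ D'') : f * g ∈ wordSpan K D'' := by
  induction hf using Submodule.span_induction with
  | mem x hx =>
    obtain ⟨T, hT, rfl⟩ := hx
    induction hg using Submodule.span_induction with
    | mem y hy =>
      obtain ⟨S, hS, rfl⟩ := hy
      rw [← word_append]
      exact word_mem_wordSpan (h T hT S hS)
    | zero => simp
    | add y z _ _ hy hz => rw [mul_add]; exact add_mem hy hz
    | smul c y _ hy => rw [mul_smul_comm]; exact Submodule.smul_mem _ _ hy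
  | zero => simp
  | add y z _ _ hy hz => rw [add_mul]; exact add_mem hy hz
  | smul c y _ hy => rw [smul_mul_assoc]; exact Submodule.smul_mem _ _ hy

theorem X_eq_word (a : Letter n) : (X a : Poly K n) = word [a] := by
  rw [word_cons, word_nil, mul_one]

theorem X_mem_wordSpan (a : Letter n) : (X a : Poly K n) ∈ wordSpan K {[a]} := by
  rw [X_eq_word]
  exact word_mem_wordSpan rfl

theorem conjLetter_mem_wordSpan (a : Letter n) :
    (conjLetter a : Poly K n) ∈ wordSpan K {[a.bar]} := by
  cases a
  · exact X_mem_wordSpan _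
  · exact X_mem_wordSpan _
  · exact neg_mem (X_mem_wordSpan _)

theorem conj_word_mem_wordSpan (T : List (Letter n)) :
    conj (word T : Poly K n) ∈ wordSpan K {(T.map bar).reverse} := by
  induction T with
  | nil =>
    rw [word_nil, conj_one]
    exact word_mem_wordSpan (T := []) rfl
  | cons a T ih =>
    rw [word_cons, conj_mul, conj_X]
    refine mul_mem_wordSpan ih (conjLetter_mem_wordSpan a) ?_
    rintro u rfl v rfl
    simp

/-! ### Combinations of multiples of elements of `BG` with bounded monomials -/

/-- The span of the products `A g B` with `g` in `BG`, with `A` and `B` monomials, and with all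
monomials in the set `D`. -/
noncomputable def relSpan (K : Type*) [Field K] {n : ℕ} (D : Set (List (Letter n))) :
    Submodule K (Poly K n) :=
  Submodule.span K {p | ∃ A B g, g ∈ BG K n ∧ p = word A * g * word B ∧ p ∈ wordSpan K D}

theorem mem_relSpan_of_BG {D : Set (List (Letter n))} {g : Poly K n} (hg : g ∈ BG K n)
    (h : g ∈ wordSpan K D) : g ∈ relSpan K D :=
  Submodule.subset_span ⟨[], [], g, hg, by simp [word_nil], h⟩

theorem relSpan_mono {D D' : Set (List (Letter n))} (h : D ⊆ D') : relSpan K D ≤ relSpan K D' := by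
  refine Submodule.span_mono ?_
  rintro p ⟨A, B, g, hg, hp, hD⟩
  exact ⟨A, B, g, hg, hp, wordSpan_mono h hD⟩

theorem mul_mem_relSpan {P D R D' : Set (List (Letter n))} {p f r : Poly K n}
    (hp : p ∈ wordSpan K P) (hf : f ∈ relSpan K D) (hr : r ∈ wordSpan K R)
    (h : ∀ a ∈ P, ∀ v ∈ D, ∀ b ∈ R, a ++ v ++ b ∈ D') : p * f * r ∈ relSpan K D' := by
  induction hp using Submodule.span_induction with
  | mem x hx =>
    obtain ⟨S, hS, rfl⟩ := hx
    induction hr using Submodule.span_induction with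
    | mem y hy =>
      obtain ⟨T, hT, rfl⟩ := hy
      induction hf using Submodule.span_induction with
      | mem f hf =>
        obtain ⟨A, B, g, hg, rfl, hD⟩ := hf
        refine Submodule.subset_span ⟨S ++ A, B ++ T, g, hg, ?_, ?_⟩
        · simp only [word_append, mul_assoc]
        · refine mul_mem_wordSpan (D' := {T}) (D := {u | ∃ v ∈ D, u = S ++ v})
            (mul_mem_wordSpan (word_mem_wordSpan (Set.mem_singleton S)) hD ?_)
            (word_mem_wordSpan (Set.mem_singleton T)) ?_
          · rintro u rfl v hv
            exact ⟨v, hv, rfl⟩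
          · rintro u ⟨v, hv, rfl⟩ w rfl
            exact h S hS v hv w hT
      | zero => simp
      | add y z _ _ hy hz => rw [mul_add, add_mul]; exact add_mem hy hz
      | smul c y _ hy => rw [mul_smul_comm, smul_mul_assoc]; exact Submodule.smul_mem _ _ hy
    | zero => simp
    | add y z _ _ hy hz => rw [mul_add]; exact add_mem hy hz
    | smul c y _ hy => rw [mul_smul_comm]; exact Submodule.smul_mem _ _ hy
  | zero => simp
  | add y z _ _ hy hz => rw [add_mul, add_mul]; exact add_mem hy hz
  | smul c y _ hy => rw [smul_mul_assoc, smul_mul_assoc]; exact Submodule.smul_mem _ _ hy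

theorem mul_left_mem_relSpan {P D D' : Set (List (Letter n))} {p f : Poly K n}
    (hp : p ∈ wordSpan K P) (hf : f ∈ relSpan K D)
    (h : ∀ a ∈ P, ∀ v ∈ D, a ++ v ∈ D') : p * f ∈ relSpan K D' := by
  have := mul_mem_relSpan (D' := D') hp hf (word_mem_wordSpan (K := K) (Set.mem_singleton []))
    (by rintro a ha v hv b rfl; simpa using h a ha v hv)
  rwa [word_nil, mul_one] at this

theorem mul_right_mem_relSpan {D R D' : Set (List (Letter n))} {f r : Poly K n}
    (hf : f ∈ relSpan K D) (hr : r ∈ wordSpan K R)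
    (h : ∀ v ∈ D, ∀ b ∈ R, v ++ b ∈ D') : f * r ∈ relSpan K D' := by
  have := mul_mem_relSpan (D' := D') (word_mem_wordSpan (K := K) (Set.mem_singleton [])) hf hr
    (by rintro a rfl v hv b hb; simpa using h v hv b hb)
  rwa [word_nil, one_mul] at this

/-- The words of length at most `d`. -/
def degLE (n d : ℕ) : Set (List (Letter n)) := {v | v.length ≤ d}

/-- The words up to `w` in the degree lexicographic order. -/
def upto (w : List (Letter n)) : Set (List (Letter n)) := {v | WordLE v w}

/-- A polynomial reduces to `0` as soon as it is a combination of multiples of elements of `BG`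
with monomials bounded by one of its own monomials `w`. -/
theorem reducesTo_zero_of_mem_relSpan {f : Poly K n} {w : List (Letter n)}
    (hf : f ∈ relSpan K (upto w)) (hw : f.coeff (FreeMonoid.ofList w) ≠ 0) :
    ReducesTo (BG K n) f 0 := by
  refine ⟨fun v hv => by simp at hv, ?_⟩
  obtain ⟨r, c, g, hg⟩ := (Submodule.mem_span_set' (s := _)).1 hf
  choose A B p hp hpg hD using fun t => (g t).2
  refine ⟨r, c, fun t => FreeMonoid.ofList (A t), fun t => FreeMonoid.ofList (B t), p, hp, ?_, ?_⟩
  all_goals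
    have key : ∀ t, MonoidAlgebra.single (FreeMonoid.ofList (A t)) (c t) * p t *
        MonoidAlgebra.single (FreeMonoid.ofList (B t)) 1 = c t • (g t : Poly K n) := by
      intro t
      rw [hpg t, word_eq_single, word_eq_single, ← smul_mul_assoc, ← smul_mul_assoc,
        MonoidAlgebra.smul_single, smul_eq_mul, mul_one]
  · intro t v hv
    rw [key] at hv
    exact ⟨FreeMonoid.ofList w, Finsupp.mem_support_iff.2 hw,
      mem_of_mem_support (Submodule.smul_mem _ (c t) (hD t)) hv⟩
  · simp only [key, zero_add, hg]

/-! ### Commutators with brackets, and the relations of degree two -/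

/-- The commutator of the letter `a` with the bracket of the word `T`. -/
noncomputable def comm (K : Type*) [Field K] {n : ℕ} (a : Letter n) (T : List (Letter n)) :
    Poly K n :=
  X a * bracket (word T) - bracket (word T) * X a

theorem comm_mem_wordSpan {D : Set (List (Letter n))} {a : Letter n} {T : List (Letter n)}
    (h1 : a :: T ∈ D) (h2 : a :: (T.map bar).reverse ∈ D) (h3 : T ++ [a] ∈ D)
    (h4 : (T.map bar).reverse ++ [a] ∈ D) : comm K a T ∈ wordSpan K D := by
  have hT : (bracket (word T) : Poly K n) ∈ wordSpan K {T, (T.map bar).reverse} :=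
    add_mem (word_mem_wordSpan (by simp))
      (wordSpan_mono (by simp) (conj_word_mem_wordSpan T))
  refine sub_mem (mul_mem_wordSpan (X_mem_wordSpan a) hT ?_)
    (mul_mem_wordSpan hT (X_mem_wordSpan a) ?_)
  · rintro u rfl v (rfl | rfl)
    · exact h1
    · exact h2
  · rintro v (rfl | rfl) u rfl
    · exact h3
    · exact h4

theorem comm_mem_relSpan_of_letterFirst {D : Set (List (Letter n))} {a : Letter n}
    {T : List (Letter n)} (h : LetterFirst a T)
    (h1 : a :: T ∈ D) (h2 : a :: (T.map bar).reverse ∈ D) (h3 : T ++ [a] ∈ D)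
    (h4 : (T.map bar).reverse ++ [a] ∈ D) : comm K a T ∈ relSpan K D :=
  mem_relSpan_of_BG (BG.letter_first a T h) (comm_mem_wordSpan h1 h2 h3 h4)

theorem comm_mem_relSpan_of_bracketFirst {D : Set (List (Letter n))} {a : Letter n}
    {T : List (Letter n)} (h : BracketFirst a T)
    (h1 : a :: T ∈ D) (h2 : a :: (T.map bar).reverse ∈ D) (h3 : T ++ [a] ∈ D)
    (h4 : (T.map bar).reverse ++ [a] ∈ D) : comm K a T ∈ relSpan K D := by
  have := comm_mem_wordSpan (K := K) h1 h2 h3 h4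
  rw [← neg_mem_iff] at this ⊢
  have e : -comm K a T = bracket (word T) * X a - X a * bracket (word T) := neg_sub _ _
  rw [e] at this ⊢
  exact mem_relSpan_of_BG (BG.bracket_first a T h) this

/-- The bracket `[x] = x + x̄` of a letter. -/
noncomputable def tr (K : Type*) [Field K] {n : ℕ} (x : Letter n) : Poly K n := bracket (X x)

theorem tr_mem_wordSpan (x : Letter n) : tr K x ∈ wordSpan K {[x], [x.bar]} :=
  add_mem (wordSpan_mono (D := {[x]}) (by simp) (X_mem_wordSpan x))
    (wordSpan_mono (D := {[x.bar]}) (by simp) (by rw [conj_X]; exact conjLetter_mem_wordSpan x))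

theorem tr_of_isVar {x : Letter n} (h : x.IsVar) : tr K x = X x + X x.bar :=
  bracket_X_of_isVar h

theorem tr_e (b : Basis) : tr K (e b : Letter n) = 0 := bracket_X_e b

theorem tr_bar (x : Letter n) : tr K x.bar = tr K x := by
  cases x
  · exact bracket_conj (q _)
  · exact bracket_conj (qb _)
  · rfl

theorem comm_singleton (a x : Letter n) : comm K a [x] = X a * tr K x - tr K x * X a := by
  rw [comm, ← X_eq_word, tr]

namespace Letter

theorem IsVar.bar {x : Letter n} (h : x.IsVar) : x.bar.IsVar := by cases x <;> trivial

/-- Two letters are comparable for `Below`, or equal up to a bar. -/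
theorem below_trichotomy {x y : Letter n} (hx : x.IsVar) (hy : y.IsVar) :
    Below x y ∨ y = x ∨ y = x.bar ∨ Below y x := by
  have key : ∀ l m : Fin n, Below (q l) (q m) ∨ l = m ∨ Below (q m) (q l) := fun l m => by
    rcases lt_trichotomy l m with h | h | h
    · exact Or.inl (.q_q h)
    · exact Or.inr (Or.inl h)
    · exact Or.inr (Or.inr (.q_q h))
  rcases x with l | l | b <;> rcases y with m | m | b' <;>
    first
    | exact hx.elim
    | exact hy.elim
    | rcases key l m with h | rfl | h
      · exact Or.inl (by
          first | exact h | exact h.bar_left | exact h.bar_right | exact h.bar_left.bar_right)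
      · simp
      · exact Or.inr (Or.inr (Or.inr (by
          first | exact h | exact h.bar_left | exact h.bar_right | exact h.bar_left.bar_right)))

theorem exists_e_of_not_isVar {x : Letter n} (hx : ¬ x.IsVar) : ∃ b, x = e b := by
  cases x
  · exact (hx trivial).elim
  · exact (hx trivial).elim
  · exact ⟨_, rfl⟩

theorem below_e {x : Letter n} (hx : x.IsVar) (b : Basis) : Below x (e b) := by
  rcases x with l | l | b'
  · exact .q_e l b
  · exact (Below.q_e l b).bar_left
  · exact hx.elim

/-- If `x` and `y` satisfy `Below x y`, then so do the underlying unbarred letters. -/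
theorem Below.base_lt {l m : Fin n} (h : Below (q l) (q m)) : l < m := by
  have := lt_iff_rank.1 h.2.1
  simp only [rank] at this
  exact Fin.lt_def.2 (by omega)

end Letter

theorem WordLE.of_head_lt {x y : Letter n} {v v' w : List (Letter n)} (h : WordLE (y :: v) w)
    (hxy : x < y) (hl : v'.length ≤ v.length) : WordLE (x :: v') w := by
  have hw := h.length_le
  rcases w with _ | ⟨c, w⟩
  · simp at hw
  · rw [wordLE_cons_cons] at h ⊢
    simp only [List.length_cons] at hw
    rcases h with h | h | h
    · exact Or.inl (by omega)
    · exact Or.inr (Or.inl ⟨by omega, hxy.trans h.2⟩)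
    · exact Or.inr (Or.inl ⟨by omega, h.1 ▸ hxy⟩)

/-- The commutator `[y]x - x[y]` of a variable `y` with a smaller variable. -/
theorem tr_mul_sub_mem {x y : Letter n} (h : Below x y) (hy : y.IsVar) {w : List (Letter n)}
    (h1 : WordLE [y, x] w) (h2 : WordLE [y.bar, x] w) :
    tr K y * X x - X x * tr K y ∈ relSpan K (upto w) := by
  have aux : ∀ (a : Letter n) (m : Fin n), BracketFirst a [q m] → Below a (q m) →
      WordLE [q m, a] w → WordLE [qb m, a] w →
      tr K (q m) * X a - X a * tr K (q m) ∈ relSpan K (upto w) := by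
    intro a m hb hlt h1 h2
    rw [← neg_mem_iff, neg_sub, ← comm_singleton]
    refine comm_mem_relSpan_of_bracketFirst hb ?_ ?_ h1 h2
    · exact h1.of_head_lt hlt.2.1 le_rfl
    · exact h1.of_head_lt hlt.2.1 le_rfl
  have aux2 : ∀ m : Fin n, Below x (q m) → WordLE [q m, x] w → WordLE [qb m, x] w →
      tr K (q m) * X x - X x * tr K (q m) ∈ relSpan K (upto w) := by
    intro m hm h1 h2
    refine aux x m ?_ hm h1 h2
    rcases x with l | l | b
    · exact .b2_2 hm.base_lt
    · exact .b2_1 hm.bar_left.base_lt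
    · exact h.1.elim
  rcases y with m | m | b
  · exact aux2 m h h1 h2
  · rw [← tr_bar]
    exact aux2 m h.bar_right h2 h1
  · exact hy.elim

/-- The commutator `y[x] - [x]y` of a letter with a smaller variable. -/
theorem mul_tr_sub_mem {x y : Letter n} (h : Below x y) {w : List (Letter n)}
    (h1 : WordLE [y, x] w) (h2 : WordLE [y, x.bar] w) :
    X y * tr K x - tr K x * X y ∈ relSpan K (upto w) := by
  have aux : ∀ (l : Fin n), LetterFirst y [q l] → Below (q l) y →
      WordLE [y, q l] w → WordLE [y, qb l] w →
      X y * tr K (q l) - tr K (q l) * X y ∈ relSpan K (upto w) := by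
    intro l hb hlt h1 h2
    rw [← comm_singleton]
    exact comm_mem_relSpan_of_letterFirst hb h1 h2 (h1.of_head_lt hlt.2.1 le_rfl)
      (h1.of_head_lt hlt.2.2.1 le_rfl)
  have aux2 : ∀ (l : Fin n), (∀ m, y ≠ qb m) → Below (q l) y →
      WordLE [y, q l] w → WordLE [y, qb l] w →
      X y * tr K (q l) - tr K (q l) * X y ∈ relSpan K (upto w) := by
    intro l hy hl h1 h2
    refine aux l ?_ hl h1 h2
    rcases y with m | m | b
    · exact .c2_var hl.base_lt
    · exact (hy m rfl).elim
    · exact .c2_basis b l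
  have aux3 : ∀ l, Below (q l) y → WordLE [y, q l] w → WordLE [y, qb l] w →
      X y * tr K (q l) - tr K (q l) * X y ∈ relSpan K (upto w) := by
    intro l hl h1 h2
    rcases y with m | m | b
    · exact aux2 l (by simp) hl h1 h2
    · -- `q̄ = [q] - q`, and the commutator of two brackets is a sum of two known commutators
      have hlt : (q m : Letter n) < qb m := by simp [lt_iff_rank, rank]
      have e : X (qb m) * tr K (q l) - tr K (q l) * X (qb m) =
          (tr K (q m) * X (q l) - X (q l) * tr K (q m)) +
          (tr K (q m) * X (qb l) - X (qb l) * tr K (q m)) -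
          (X (q m) * tr K (q l) - tr K (q l) * X (q m)) := by
        rw [tr_of_isVar (x := q m) trivial, tr_of_isVar (x := q l) trivial, bar_q, bar_q]
        noncomm_ring
      have h1' := h1.of_head_lt (v' := [q l]) hlt le_rfl
      have h2' := h1.of_head_lt (v' := [qb l]) hlt le_rfl
      rw [e]
      refine sub_mem (add_mem (tr_mul_sub_mem hl.bar_right trivial h1' h1)
        (tr_mul_sub_mem hl.bar_right.bar_left trivial h2' h2)) ?_
      have := hl.bar_right
      rw [← comm_singleton]
      exact comm_mem_relSpan_of_letterFirst (.c2_var this.base_lt) h1' h2'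
        (h1'.of_head_lt this.2.1 le_rfl) (h1'.of_head_lt this.2.2.1 le_rfl)
    · exact aux2 l (by simp) hl h1 h2
  rcases x with l | l | b
  · exact aux3 l h h1 h2
  · rw [← tr_bar]
    exact aux3 l h.bar_left h2 h1
  · exact h.1.elim

theorem mul_bar_sub_mem {x : Letter n} (h : x.IsVar) {w : List (Letter n)}
    (h1 : WordLE [x, x.bar] w) (h2 : WordLE [x.bar, x] w) :
    X x * X x.bar - X x.bar * X x ∈ relSpan K (upto w) := by
  have aux : ∀ l : Fin n, WordLE [q l, qb l] w → WordLE [qb l, q l] w →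
      (X (qb l) * X (q l) - X (q l) * X (qb l) : Poly K n) ∈ relSpan K (upto w) := by
    intro l h1 h2
    refine mem_relSpan_of_BG (BG.conj_comm l) (sub_mem ?_ ?_)
    · exact mul_mem_wordSpan (X_mem_wordSpan _) (X_mem_wordSpan _) (by rintro _ rfl _ rfl; exact h2)
    · exact mul_mem_wordSpan (X_mem_wordSpan _) (X_mem_wordSpan _) (by rintro _ rfl _ rfl; exact h1)
  rcases x with l | l | b
  · rw [← neg_mem_iff, neg_sub]
    exact aux l h1 h2
  · exact aux l h2 h1
  · exact h.elim

/-- Commutators of letters with brackets of letters, with control on the first letter of the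
words that are needed. -/
theorem exists_mul_tr_sub_mem (a x : Letter n) :
    ∃ z z', (z = a ∨ z = a.bar ∨ z = x ∨ z = x.bar) ∧
      X a * tr K x - tr K x * X a ∈ relSpan K (upto [z, z']) := by
  have hw : ∀ a' b' c d : Letter n, ∃ z z', (z = a' ∨ z = c) ∧ WordLE [a', b'] [z, z'] ∧
      WordLE [c, d] [z, z'] := by
    intro a' b' c d
    have : WordLE [a', b'] [c, d] ∨ WordLE [c, d] [a', b'] := by
      simp only [wordLE_cons_cons, List.length_cons, List.length_nil, lt_irrefl, le_refl, true_and,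
        false_or]
      rcases lt_trichotomy a' c with h | h | h
      · exact Or.inl (Or.inl h)
      · rcases lt_trichotomy b' d with h' | h' | h'
        · exact Or.inl (Or.inr ⟨h, Or.inl h'⟩)
        · exact Or.inl (Or.inr ⟨h, Or.inr ⟨h', .refl _⟩⟩)
        · exact Or.inr (Or.inr ⟨h.symm, Or.inl h'⟩)
      · exact Or.inr (Or.inl h)
    rcases this with h | h
    · exact ⟨c, d, Or.inr rfl, h, .refl _⟩
    · exact ⟨a', b', Or.inl rfl, .refl _, h⟩
  by_cases hx : x.IsVar
  · by_cases ha : a.IsVar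
    · rcases below_trichotomy hx ha with h | rfl | rfl | h
      · obtain ⟨z, z', hz, h1, h2⟩ := hw a x a x.bar
        exact ⟨z, z', by rcases hz with rfl | rfl <;> simp, mul_tr_sub_mem h h1 h2⟩
      · obtain ⟨z, z', hz, h1, h2⟩ := hw a a.bar a.bar a
        refine ⟨z, z', by rcases hz with rfl | rfl <;> simp, ?_⟩
        convert mul_bar_sub_mem (K := K) ha h1 h2 using 1
        rw [tr_of_isVar hx]
        noncomm_ring
      · obtain ⟨z, z', hz, h1, h2⟩ := hw x x.bar x.bar x
        refine ⟨z, z', by rcases hz with rfl | rfl <;> simp, ?_⟩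
        rw [← neg_mem_iff]
        convert mul_bar_sub_mem (K := K) hx h1 h2 using 1
        rw [tr_of_isVar hx]
        noncomm_ring
      · obtain ⟨z, z', hz, h1, h2⟩ := hw x a x.bar a
        refine ⟨z, z', by rcases hz with rfl | rfl <;> simp, ?_⟩
        rw [← neg_mem_iff, neg_sub]
        exact tr_mul_sub_mem h hx h1 h2
    · obtain ⟨b, rfl⟩ := exists_e_of_not_isVar ha
      obtain ⟨z, z', hz, h1, h2⟩ := hw (e b) x (e b) x.bar
      exact ⟨z, z', by rcases hz with rfl | rfl <;> simp, mul_tr_sub_mem (below_e hx b) h1 h2⟩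
  · obtain ⟨b, rfl⟩ := exists_e_of_not_isVar hx
    refine ⟨a, a, Or.inl rfl, ?_⟩
    rw [tr_e]
    simp

theorem mul_tr_sub_mem_degLE (a x : Letter n) :
    X a * tr K x - tr K x * X a ∈ relSpan K (degLE n 2) := by
  obtain ⟨z, z', -, h⟩ := exists_mul_tr_sub_mem (K := K) a x
  exact relSpan_mono (D := (upto [z, z']))
    (fun v (hv : WordLE v [z, z']) => show v.length ≤ 2 from hv.length_le) h

/-! ### Symmetric relations on a linear order -/

theorem forall_of_symmetric₃ {α : Type*} [LinearOrder α] {P : α → α → α → Prop}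
    (h12 : ∀ a b c, P a b c → P b a c) (h23 : ∀ a b c, P a b c → P a c b)
    (hdiag : ∀ a c, P a a c) (hlt : ∀ a b c, a < b → b < c → P a b c) (a b c : α) :
    P a b c := by
  have two : ∀ a b c, a < b → P a b c := by
    intro a b c hab
    rcases lt_trichotomy b c with h | rfl | h
    · exact hlt _ _ _ hab h
    · exact h12 _ _ _ (h23 _ _ _ (hdiag _ _))
    · rcases lt_trichotomy a c with h' | rfl | h'
      · exact h23 _ _ _ (hlt _ _ _ h' h)
      · exact h23 _ _ _ (hdiag _ _)
      · exact h23 _ _ _ (h12 _ _ _ (hlt _ _ _ h' hab))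
  rcases lt_trichotomy a b with h | rfl | h
  · exact two _ _ _ h
  · exact hdiag _ _
  · exact h12 _ _ _ (two _ _ _ h)

theorem forall_of_symmetric₄ {α : Type*} [LinearOrder α] {P : α → α → α → α → Prop}
    (h12 : ∀ a b c d, P a b c d → P b a c d) (h23 : ∀ a b c d, P a b c d → P a c b d)
    (h34 : ∀ a b c d, P a b c d → P a b d c)
    (hdiag : ∀ a c d, P a a c d) (hlt : ∀ a b c d, a < b → b < c → c < d → P a b c d)
    (a b c d : α) : P a b c d := by
  have three : ∀ a b c d, a < b → b < c → P a b c d := by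
    intro a b c d hab hbc
    rcases lt_trichotomy c d with h | rfl | h
    · exact hlt _ _ _ _ hab hbc h
    · exact h23 _ _ _ _ (h12 _ _ _ _ (h34 _ _ _ _ (h23 _ _ _ _ (hdiag _ _ _))))
    · refine h34 _ _ _ _ ?_
      rcases lt_trichotomy b d with h' | rfl | h'
      · exact hlt _ _ _ _ hab h' h
      · exact h12 _ _ _ _ (h23 _ _ _ _ (hdiag _ _ _))
      · refine h23 _ _ _ _ ?_
        rcases lt_trichotomy a d with h'' | rfl | h''
        · exact hlt _ _ _ _ h'' h' hbc
        · exact hdiag _ _ _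
        · exact h12 _ _ _ _ (hlt _ _ _ _ h'' hab hbc)
  refine forall_of_symmetric₃ (P := fun a b c => ∀ d, P a b c d)
    (fun a b c h d => h12 _ _ _ _ (h d)) (fun a b c h d => h23 _ _ _ _ (h d))
    (fun a c d => hdiag _ _ _) (fun a b c hab hbc d => three _ _ _ _ hab hbc) a b c d

/-! ### Central brackets in a ring -/

section Ring

variable {R : Type*} [Ring R]

/-- The anticommutator. -/
def anti (u v : R) : R := u * v + v * u

/-- The difference of a triple product and its reversal; for purely imaginary quaternions this is
twice the scalar triple product, up to sign. -/
def tri (u v w : R) : R := u * v * w - w * v * u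

theorem anti_comm (u v : R) : anti u v = anti v u := add_comm _ _

/-- Each of the three anticommutators of pairs commutes with the third element. -/
def AntiCentral (a b c : R) : Prop :=
  Commute (anti a b) c ∧ Commute (anti b c) a ∧ Commute (anti a c) b

/-- By the Jacobi identity two of the conditions in `AntiCentral` imply the third. -/
theorem AntiCentral.of_two {a b c : R} (h1 : Commute (anti a b) c) (h2 : Commute (anti b c) a) :
    AntiCentral a b c := by
  refine ⟨h1, h2, ?_⟩
  have e1 := h1.eq
  have e2 := h2.eq
  have : anti a c * b - b * anti a c =
      -(anti a b * c - c * anti a b) - (anti b c * a - a * anti b c) := by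
    unfold anti; noncomm_ring
  rw [e1, e2, sub_self, sub_self, neg_zero, sub_zero] at this
  exact sub_eq_zero.1 this

theorem AntiCentral.of_diag {a c : R} (h : Commute (anti a c) a) : AntiCentral a a c := by
  refine ⟨?_, h, h⟩
  have e := h.eq
  have : anti a a * c - c * anti a a =
      2 * (a * anti a c - anti a c * a) := by
    unfold anti; noncomm_ring
  rw [e, sub_self, mul_zero] at this
  exact sub_eq_zero.1 this

theorem AntiCentral.swap12 {a b c : R} (h : AntiCentral a b c) : AntiCentral b a c :=
  ⟨anti_comm a b ▸ h.1, h.2.2, h.2.1⟩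

theorem AntiCentral.swap23 {a b c : R} (h : AntiCentral a b c) : AntiCentral a c b :=
  ⟨h.2.2, anti_comm b c ▸ h.2.1, h.1⟩

/-- The commutator of `a` with `tri i j k` changes sign when `a` and `i` are interchanged. -/
theorem commute_tri_swap12 {a i j k : R} (hc : anti a i ∈ Subring.center R)
    (hc' : anti j k ∈ Subring.center R) (h : Commute a (tri i j k)) : Commute i (tri a j k) := by
  have e := Subring.mem_center_iff.1 hc (k * j)
  have e1 := Subring.mem_center_iff.1 hc' a
  have e2 := Subring.mem_center_iff.1 hc' i
  have e3 := Subring.mem_center_iff.1 hc' (anti a i)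
  have : i * tri a j k - tri a j k * i = anti a i * (j * k) + k * j * anti a i -
      a * anti j k * i - i * anti j k * a - (a * tri i j k - tri i j k * a) := by
    unfold anti tri; noncomm_ring
  have e4 : anti a i * (j * k) + anti a i * (k * j) - anti j k * a * i - anti j k * i * a =
      anti a i * anti j k - anti j k * anti a i := by
    unfold anti; noncomm_ring
  rw [h.eq, e, e1, e2, e4, e3, sub_self, sub_self, sub_self] at this
  exact sub_eq_zero.1 this

theorem commute_tri_swap23 {a i j k : R} (hc : anti i j ∈ Subring.center R)
    (h : Commute a (tri i j k)) : Commute a (tri j i k) := by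
  have : tri j i k = -tri i j k + (anti i j * k - k * anti i j) := by
    unfold anti tri; noncomm_ring
  rw [this, (Subring.mem_center_iff.1 hc _), sub_self, add_zero]
  exact h.neg_right

theorem commute_tri_swap34 {a i j k : R} (hc : anti j k ∈ Subring.center R)
    (h : Commute a (tri i j k)) : Commute a (tri i k j) := by
  have : tri i k j = -tri i j k + (i * anti j k - anti j k * i) := by
    unfold anti tri; noncomm_ring
  rw [this, (Subring.mem_center_iff.1 hc _), sub_self, add_zero]
  exact h.neg_right

theorem eq_zero_of_two_mul {half : R} (h2 : 2 * half = 1) (hh : half ∈ Subring.center R) {x : R}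
    (h : 2 * x = 0) : x = 0 := by
  have h3 := congrArg (half * ·) h
  simp only [mul_zero, ← mul_assoc] at h3
  rwa [← Subring.mem_center_iff.1 hh 2, h2, one_mul] at h3

theorem commute_anti_of_commute_sq {a c half : R} (h2 : 2 * half = 1)
    (hh : half ∈ Subring.center R) (h : Commute c (anti a a)) : Commute (anti a c) a := by
  refine sub_eq_zero.1 (eq_zero_of_two_mul h2 hh ?_)
  have : 2 * (anti a c * a - a * anti a c) = c * anti a a - anti a a * c := by
    unfold anti; noncomm_ring
  rw [this, h.eq, sub_self]

theorem commute_tri_diag {a j k half : R} (h2 : 2 * half = 1)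
    (hh : half ∈ Subring.center R) (hc : anti j k ∈ Subring.center R)
    (hca : anti a a ∈ Subring.center R) : Commute a (tri a j k) := by
  have e := Subring.mem_center_iff.1 hca (k * j)
  have e1 := Subring.mem_center_iff.1 hc a
  have e3 := Subring.mem_center_iff.1 hc (anti a a)
  have : 2 * (a * tri a j k - tri a j k * a) =
      anti a a * (j * k) + k * j * anti a a - 2 * (a * anti j k * a) := by
    unfold anti tri; noncomm_ring
  have e4 : anti a a * (j * k) + anti a a * (k * j) - 2 * (anti j k * a * a) =
      anti a a * anti j k - anti j k * anti a a := by
    unfold anti; noncomm_ring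
  rw [e, e1, e4, e3, sub_self] at this
  exact sub_eq_zero.1 (eq_zero_of_two_mul h2 hh this)

theorem commute_anti_of_commute_bracket {a x x' y y' : R} (hx : x + x' ∈ Subring.center R)
    (hy : y + y' ∈ Subring.center R) (h : Commute a (x * y + y' * x')) :
    Commute a (anti (x - x') (y - y')) := by
  have e1 := Subring.mem_center_iff.1 hy x
  have e2 := Subring.mem_center_iff.1 hx y
  have e3 := Subring.mem_center_iff.1 hy x'
  have key : anti (x - x') (y - y') = 4 * (x * y + y' * x') - 2 * ((x + x') * (y + y')) := by
    unfold anti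
    linear_combination (norm := noncomm_ring) e1 + 2 * e2 + 3 * e3
  rw [key]
  refine Commute.sub_right ((Nat.cast_commute 4 a).symm.mul_right h)
    ((Nat.cast_commute 2 a).symm.mul_right ?_)
  exact Subring.mem_center_iff.1 (mul_mem hx hy) a

theorem commute_tri_of_commute_bracket {a x x' y y' z z' : R} (hx : x + x' ∈ Subring.center R)
    (hy : y + y' ∈ Subring.center R) (hz : z + z' ∈ Subring.center R)
    (hxy : anti (x - x') (y - y') ∈ Subring.center R)
    (hyz : anti (y - y') (z - z') ∈ Subring.center R)
    (hxz : anti (x - x') (z - z') ∈ Subring.center R)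
    (h : Commute a (x * y * z + z' * y' * x')) :
    Commute a (tri (x - x') (y - y') (z - z')) := by
  -- the expansion of `8 xyz = (s + v)(t + u)(r + w)`, where `s` and `v` are the sum and the
  -- difference of `x` and `x'`, and similarly for the other two factors
  have expand : ∀ s v t u r w : R, (∀ g, g * s = s * g) → (∀ g, g * t = t * g) →
      (∀ g, g * r = r * g) →
      (s + v) * (t + u) * (r + w) + (r - w) * (t - u) * (s - v) =
        tri v u w + (s * anti u w + t * anti v w + r * anti v u + 2 * (s * t * r)) := by
    intro s v t u r w hs ht hr
    unfold tri anti
    linear_combination (norm := noncomm_ring) hs (r * t) - s * hr t - hs (w * t) - s * ht w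
      + hr (s * u) - r * hs u + hr (v * t) + r * ht v + ht v * w + hr (v * u) + ht w * v
      + hs (w * u)
  rw [Subring.mem_center_iff] at hx hy hz
  have e := expand (x + x') (x - x') (y + y') (y - y') (z + z') (z - z') hx hy hz
  have e' : (x + x' + (x - x')) * (y + y' + (y - y')) * (z + z' + (z - z')) +
      (z + z' - (z - z')) * (y + y' - (y - y')) * (x + x' - (x - x')) =
      8 * (x * y * z + z' * y' * x') := by
    noncomm_ring
  rw [e'] at e
  rw [← sub_eq_iff_eq_add] at e
  rw [← e]
  refine ((Nat.cast_commute 8 a).symm.mul_right h).sub_right ?_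
  rw [← Subring.mem_center_iff] at hx hy hz
  refine Subring.mem_center_iff.1 (add_mem (add_mem (add_mem (mul_mem hx hyz) (mul_mem hy hxz))
    (mul_mem hz hxy)) (mul_mem ?_ (mul_mem (mul_mem hx hy) hz))) a
  exact natCast_mem _ 2

/-- The pairs `(f, f')` spanned over the centre by `(1, 1)`, by the `(v, -v)` and by the
`(v u, u v)`, where `v` and `u` run through the given family. For a family of purely imaginary
elements, `f'` plays the role of the conjugate of `f`. -/
def conjPairs {ι : Type*} (v : ι → R) : AddSubgroup (R × R) :=
  AddSubgroup.closure {p | ∃ c ∈ Subring.center R, p = (c, c) ∨ (∃ i, p = (c * v i, -(c * v i))) ∨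
    ∃ i j, p = (c * (v i * v j), c * (v j * v i))}

section

variable {ι : Type*} {v : ι → R}

theorem const_mem_conjPairs {c : R} (hc : c ∈ Subring.center R) : (c, c) ∈ conjPairs v :=
  AddSubgroup.subset_closure ⟨c, hc, Or.inl rfl⟩

theorem linear_mem_conjPairs {c : R} (hc : c ∈ Subring.center R) (i : ι) :
    (c * v i, -(c * v i)) ∈ conjPairs v :=
  AddSubgroup.subset_closure ⟨c, hc, Or.inr (Or.inl ⟨i, rfl⟩)⟩

theorem quadratic_mem_conjPairs {c : R} (hc : c ∈ Subring.center R) (i j : ι) :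
    (c * (v i * v j), c * (v j * v i)) ∈ conjPairs v :=
  AddSubgroup.subset_closure ⟨c, hc, Or.inr (Or.inr ⟨i, j, rfl⟩)⟩

theorem conjPairs_mul_center {p : R × R} (hp : p ∈ conjPairs v) {z : R}
    (hz : z ∈ Subring.center R) : (p.1 * z, z * p.2) ∈ conjPairs v := by
  have hz' := Subring.mem_center_iff.1 hz
  induction hp using AddSubgroup.closure_induction with
  | mem p hp =>
    obtain ⟨c, hc, rfl | ⟨i, rfl⟩ | ⟨i, j, rfl⟩⟩ := hp
    · simp only [hz' c]
      exact const_mem_conjPairs (mul_mem hz hc)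
    · simp only [hz' (c * v i), ← mul_assoc, mul_neg]
      exact linear_mem_conjPairs (mul_mem hz hc) i
    · have := quadratic_mem_conjPairs (v := v) (mul_mem hz hc) i j
      simpa only [hz' (c * (v i * v j)), mul_assoc] using this
  | zero => simp only [Prod.fst_zero, Prod.snd_zero, zero_mul, mul_zero]; exact zero_mem _
  | add p q _ _ hp hq =>
    simpa only [Prod.fst_add, Prod.snd_add, add_mul, mul_add] using! add_mem hp hq
  | neg p _ hp => simpa only [Prod.fst_neg, Prod.snd_neg, neg_mul, mul_neg] using! neg_mem hp

/-- If anticommutators and triple products are central, a product of three elements of the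
family is a central combination of `1` and of the elements of the family; hence `conjPairs` is
stable under multiplication by `(u, -u)`. -/
theorem conjPairs_mul {half : R} (h2 : 2 * half = 1) (hh : half ∈ Subring.center R)
    (ha : ∀ i j, anti (v i) (v j) ∈ Subring.center R)
    (ht : ∀ i j k, tri (v i) (v j) (v k) ∈ Subring.center R)
    {p : R × R} (hp : p ∈ conjPairs v) (k : ι) : (p.1 * v k, -(v k * p.2)) ∈ conjPairs v := by
  induction hp using AddSubgroup.closure_induction with
  | mem p hp =>
    obtain ⟨c, hc, rfl | ⟨i, rfl⟩ | ⟨i, j, rfl⟩⟩ := hp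
    · have := linear_mem_conjPairs (v := v) hc k
      simpa only [Subring.mem_center_iff.1 hc (v k)] using this
    · have := quadratic_mem_conjPairs (v := v) hc i k
      have e : -(v k * -(c * v i)) = c * (v k * v i) := by
        rw [mul_neg, neg_neg, ← mul_assoc, Subring.mem_center_iff.1 hc (v k), mul_assoc]
      simpa only [e, mul_assoc] using this
    · have hch := mul_mem hc hh
      have m1 := const_mem_conjPairs (v := v) (mul_mem hch (ht i j k))
      have m2 := linear_mem_conjPairs (v := v) (mul_mem hch (ha i j)) k
      have m3 := linear_mem_conjPairs (v := v) (mul_mem hch (ha i k)) j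
      have m4 := linear_mem_conjPairs (v := v) (mul_mem hch (ha j k)) i
      have e1 : v i * v j * v k + v k * v j * v i =
          anti (v i) (v j) * v k - anti (v i) (v k) * v j + anti (v j) (v k) * v i := by
        rw [← Subring.mem_center_iff.1 (ha i j), ← Subring.mem_center_iff.1 (ha j k)]
        unfold anti; noncomm_ring
      have e2 : v i * v j * v k - v k * v j * v i = tri (v i) (v j) (v k) := rfl
      have hc2 : c * half * 2 = c := by
        rw [mul_assoc, ← Subring.mem_center_iff.1 hh 2, h2, mul_one]
      have e3 : c * (v i * v j) * v k = c * half * (v i * v j * v k + v k * v j * v i) +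
          c * half * (v i * v j * v k - v k * v j * v i) := by
        nth_rw 1 [← hc2]; noncomm_ring
      have e4 : v k * (c * (v j * v i)) = c * half * (v i * v j * v k + v k * v j * v i) -
          c * half * (v i * v j * v k - v k * v j * v i) := by
        rw [← mul_assoc (v k), Subring.mem_center_iff.1 hc (v k)]
        nth_rw 1 [← hc2]; noncomm_ring
      convert add_mem m1 (add_mem (sub_mem m2 m3) m4) using 1
      refine Prod.ext ?_ ?_
      · simp only [e3, e1, e2, Prod.fst_add, Prod.fst_sub]
        noncomm_ring
      · simp only [e4, e1, e2, Prod.snd_add, Prod.snd_sub]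
        noncomm_ring
  | zero => simp only [Prod.fst_zero, Prod.snd_zero, zero_mul, mul_zero, neg_zero]; exact zero_mem _
  | add p q _ _ hp hq =>
    convert add_mem hp hq using 1
    refine Prod.ext ?_ ?_
    · simp only [Prod.fst_add, add_mul]
    · simp only [Prod.snd_add, mul_add, neg_add]
  | neg p _ hp =>
    convert neg_mem hp using 1
    refine Prod.ext ?_ ?_
    · simp only [Prod.fst_neg, neg_mul]
    · simp only [Prod.snd_neg, mul_neg]

theorem fst_add_snd_mem_center (ha : ∀ i j, anti (v i) (v j) ∈ Subring.center R)
    {p : R × R} (hp : p ∈ conjPairs v) : p.1 + p.2 ∈ Subring.center R := by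
  induction hp using AddSubgroup.closure_induction with
  | mem p hp =>
    obtain ⟨c, hc, rfl | ⟨i, rfl⟩ | ⟨i, j, rfl⟩⟩ := hp
    · exact add_mem hc hc
    · simp
    · simp only [← mul_add]
      exact mul_mem hc (ha i j)
  | zero => simp
  | add p q _ _ hp hq =>
    simpa only [Prod.fst_add, Prod.snd_add, add_add_add_comm] using add_mem hp hq
  | neg p _ hp =>
    rw [Prod.fst_neg, Prod.snd_neg, ← neg_add]
    exact neg_mem hp

end

/-- Brackets of all words are central as soon as those of words of length at most three are,
the latter in the form of anticommutators and triple products of differences `x - x̄`. -/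
theorem bracket_mem_center {ι : Type*} {x x' : ι → R} {half : R} (h2 : 2 * half = 1)
    (hh : half ∈ Subring.center R) (hs : ∀ i, x i + x' i ∈ Subring.center R)
    (ha : ∀ i j, anti (x i - x' i) (x j - x' j) ∈ Subring.center R)
    (ht : ∀ i j k, tri (x i - x' i) (x j - x' j) (x k - x' k) ∈ Subring.center R) (T : List ι) :
    (T.map x).prod + (T.reverse.map x').prod ∈ Subring.center R := by
  suffices h : ((T.map x).prod, (T.reverse.map x').prod) ∈ conjPairs fun i => x i - x' i from
    fst_add_snd_mem_center ha h
  induction T using List.reverseRecOn with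
  | nil => simpa using const_mem_conjPairs (one_mem _)
  | append_singleton T a ih =>
    have m1 := conjPairs_mul_center (conjPairs_mul_center ih (hs a)) hh
    have m2 := conjPairs_mul_center (conjPairs_mul h2 hh ha ht ih a) hh
    have h2' : half * 2 = 1 := by rw [← Subring.mem_center_iff.1 hh 2, h2]
    convert add_mem m1 m2 using 1
    refine Prod.ext ?_ ?_
    · simp only [List.map_append, List.prod_append, Prod.fst_add, List.map_cons, List.map_nil,
        List.prod_cons, List.prod_nil, mul_one]
      calc _ = (T.map x).prod * x a * (2 * half) := by rw [h2, mul_one]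
        _ = _ := by noncomm_ring
    · simp only [List.reverse_append, List.reverse_cons, List.reverse_nil, List.nil_append,
        List.map_append, List.map_cons, List.map_nil, List.prod_cons, List.prod_append,
        List.prod_nil, mul_one, Prod.snd_add]
      calc _ = half * 2 * (x' a * (T.reverse.map x').prod) := by rw [h2', one_mul]
        _ = _ := by noncomm_ring

end Ring

/-! ### The graded quotient -/

/-- The words of length `d`. -/
def degEq (n d : ℕ) : Set (List (Letter n)) := {v | v.length = d}

/-- The decomposition into homogeneous components, collected as the coefficients of a
polynomial in one more variable. -/
noncomputable def components (K : Type*) [Field K] (n : ℕ) :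
    Poly K n →ₐ[K] Polynomial (Poly K n) :=
  MonoidAlgebra.lift K (Polynomial (Poly K n)) (Mon n)
    (FreeMonoid.lift fun a => Polynomial.monomial 1 (X a))

theorem components_word (T : List (Letter n)) :
    components K n (word T) = Polynomial.monomial T.length (word T) := by
  induction T with
  | nil => rw [word_nil, map_one]; rfl
  | cons a T ih =>
    have : components K n (X a) = Polynomial.monomial 1 (X a) := by
      simp [components, X, MonoidAlgebra.lift_single]
    rw [word_cons, map_mul, ih, this, Polynomial.monomial_mul_monomial, List.length_cons,
      add_comm]

theorem components_of_homogeneous {d : ℕ} {f : Poly K n} (hf : f ∈ wordSpan K (degEq n d)) :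
    components K n f = Polynomial.monomial d f := by
  induction hf using Submodule.span_induction with
  | mem x h =>
    obtain ⟨T, hT, rfl⟩ := h
    rw [components_word, show T.length = d from hT]
  | zero => simp
  | add x y _ _ hx hy => rw [map_add, hx, hy, map_add]
  | smul c x _ hx => rw [map_smul, hx, Polynomial.smul_monomial]

theorem mem_wordSpan_univ (f : Poly K n) : f ∈ wordSpan K Set.univ := by
  induction f using MonoidAlgebra.induction_linear with
  | zero => exact zero_mem _
  | add f g hf hg => exact add_mem hf hg
  | single m r =>
    have : MonoidAlgebra.single m r = r • (word (FreeMonoid.toList m) : Poly K n) := by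
      rw [word_eq_single, MonoidAlgebra.smul_single, smul_eq_mul, mul_one]
      rfl
    rw [this]
    exact Submodule.smul_mem _ _ (word_mem_wordSpan trivial)

theorem coeff_components_mem (f : Poly K n) (d : ℕ) :
    (components K n f).coeff d ∈ wordSpan K (degEq n d) := by
  induction mem_wordSpan_univ f using Submodule.span_induction with
  | mem x h =>
    obtain ⟨T, -, rfl⟩ := h
    rw [components_word, Polynomial.coeff_monomial]
    split_ifs with h
    · exact word_mem_wordSpan h
    · exact zero_mem _
  | zero => simp
  | add x y _ _ hx hy => rw [map_add, Polynomial.coeff_add]; exact add_mem hx hy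
  | smul c x _ hx =>
    rw [map_smul, Polynomial.coeff_smul]
    exact Submodule.smul_mem _ _ hx

/-- The ideal of the polynomials each of whose homogeneous components is, in terms of `BG`, a
combination of multiples of at most the degree of that component. -/
noncomputable def gradedRel (K : Type*) [Field K] (n : ℕ) : TwoSidedIdeal (Poly K n) :=
  TwoSidedIdeal.mk' {f | ∀ d, (components K n f).coeff d ∈ relSpan K (degLE n d)}
    (fun d => by simp)
    (fun hf hg d => by rw [map_add, Polynomial.coeff_add]; exact add_mem (hf d) (hg d))
    (fun hf d => by rw [map_neg, Polynomial.coeff_neg]; exact neg_mem (hf d))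
    (fun {x f} hf d => by
      rw [map_mul, Polynomial.coeff_mul]
      refine sum_mem fun ij hij => ?_
      have hij := Finset.HasAntidiagonal.mem_antidiagonal.1 hij
      refine mul_left_mem_relSpan (coeff_components_mem x _) (hf _) ?_
      intro u hu v hv
      simp only [degEq, degLE, Set.mem_ofPred_eq, List.length_append] at *
      omega)
    (fun {f x} hf d => by
      rw [map_mul, Polynomial.coeff_mul]
      refine sum_mem fun ij hij => ?_
      have hij := Finset.HasAntidiagonal.mem_antidiagonal.1 hij
      refine mul_right_mem_relSpan (hf _) (coeff_components_mem x _) ?_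
      intro u hu v hv
      simp only [degEq, degLE, Set.mem_ofPred_eq, List.length_append] at *
      omega)

theorem mem_gradedRel {f : Poly K n} :
    f ∈ gradedRel K n ↔ ∀ d, (components K n f).coeff d ∈ relSpan K (degLE n d) := by
  rw [gradedRel, TwoSidedIdeal.mem_mk']
  rfl

theorem mem_gradedRel_of_homogeneous {d : ℕ} {f : Poly K n} (hf : f ∈ wordSpan K (degEq n d)) :
    f ∈ gradedRel K n ↔ f ∈ relSpan K (degLE n d) := by
  rw [mem_gradedRel, components_of_homogeneous hf]
  constructor
  · intro h
    simpa using h d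
  · intro h d'
    rw [Polynomial.coeff_monomial]
    split_ifs with e
    · exact e ▸ h
    · exact zero_mem _

/-- The quotient of the free algebra by `gradedRel`. -/
def GradedQuot (K : Type*) [Field K] (n : ℕ) : Type _ := (gradedRel K n).ringCon.Quotient

noncomputable instance : Ring (GradedQuot K n) :=
  inferInstanceAs (Ring (gradedRel K n).ringCon.Quotient)

/-- The projection to `GradedQuot`. -/
noncomputable def proj (K : Type*) [Field K] (n : ℕ) : Poly K n →+* GradedQuot K n :=
  (gradedRel K n).ringCon.mk'

theorem proj_eq_zero_iff {f : Poly K n} : proj K n f = 0 ↔ f ∈ gradedRel K n := by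
  have := TwoSidedIdeal.ker_ringCon_mk' (gradedRel K n)
  rw [← this, TwoSidedIdeal.mem_ker]
  rfl

theorem proj_eq_zero {d : ℕ} {f : Poly K n} (hf : f ∈ wordSpan K (degEq n d))
    (h : f ∈ relSpan K (degLE n d)) : proj K n f = 0 :=
  proj_eq_zero_iff.2 ((mem_gradedRel_of_homogeneous hf).2 h)

theorem mem_relSpan_of_proj_eq_zero {d : ℕ} {f : Poly K n} (hf : f ∈ wordSpan K (degEq n d))
    (h : proj K n f = 0) : f ∈ relSpan K (degLE n d) :=
  (mem_gradedRel_of_homogeneous hf).1 (proj_eq_zero_iff.1 h)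

theorem proj_mem_center {z : GradedQuot K n} (h : ∀ a, Commute (proj K n (X a)) z) :
    z ∈ Subring.center (GradedQuot K n) := by
  rw [Subring.mem_center_iff]
  intro g
  obtain ⟨f, rfl⟩ : ∃ f, proj K n f = g := RingCon.mk'_surjective _ g
  obtain ⟨z, rfl⟩ : ∃ f, proj K n f = z := RingCon.mk'_surjective _ z
  have hword : ∀ T, Commute (proj K n (word T)) (proj K n z) := by
    intro T
    induction T with
    | nil => rw [word_nil, map_one]; exact Commute.one_left _
    | cons a T ih => rw [word_cons, map_mul]; exact (h a).mul_left ih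
  induction mem_wordSpan_univ f using Submodule.span_induction with
  | mem x h =>
    obtain ⟨T, -, rfl⟩ := h
    exact hword T
  | zero => simp
  | add x y _ _ hx hy => rw [map_add, add_mul, mul_add, hx, hy]
  | smul c x _ hx =>
    rw [← map_mul, ← map_mul, smul_mul_assoc, mul_smul_comm, Algebra.smul_def, Algebra.smul_def,
      map_mul, map_mul, map_mul, map_mul, hx]

theorem X_mul_mem_degLE (a : Letter n) {d : ℕ} {f : Poly K n} (hf : f ∈ relSpan K (degLE n d)) :
    X a * f ∈ relSpan K (degLE n (d + 1)) :=
  mul_left_mem_relSpan (X_mem_wordSpan a) hf (by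
    rintro _ rfl v hv
    exact Nat.succ_le_succ hv)

theorem mul_X_mem_degLE (a : Letter n) {d : ℕ} {f : Poly K n} (hf : f ∈ relSpan K (degLE n d)) :
    f * X a ∈ relSpan K (degLE n (d + 1)) :=
  mul_right_mem_relSpan hf (X_mem_wordSpan a) (by
    rintro v hv _ rfl
    simpa [degLE] using! hv)

/-! ### Brackets are central in the graded quotient -/

theorem proj_X_add_conj_mem_center (x : Letter n) :
    proj K n (X x) + proj K n (conjLetter x) ∈ Subring.center (GradedQuot K n) := by
  have e : proj K n (X x) + proj K n (conjLetter x) = proj K n (tr K x) := by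
    rw [tr, bracket, conj_X, map_add]
  rw [e]
  refine proj_mem_center fun a => ?_
  refine sub_eq_zero.1 ?_
  rw [← map_mul, ← map_mul, ← map_sub]
  refine proj_eq_zero (d := 2) ?_ (mul_tr_sub_mem_degLE a x)
  rw [← comm_singleton]
  apply comm_mem_wordSpan <;> rfl

/-- A commutator in the span of the relations of its degree vanishes in the graded quotient. -/
theorem commute_proj_bracket {a : Letter n} {T : List (Letter n)}
    (h : comm K a T ∈ relSpan K (degLE n (T.length + 1))) :
    Commute (proj K n (X a)) (proj K n (bracket (word T))) := by
  refine sub_eq_zero.1 ?_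
  rw [← map_mul, ← map_mul, ← map_sub]
  refine proj_eq_zero (d := T.length + 1) ?_ h
  apply comm_mem_wordSpan <;> simp [degEq]

theorem commute_of_letterFirst {a : Letter n} {T : List (Letter n)} (h : LetterFirst a T) :
    Commute (proj K n (X a)) (proj K n (bracket (word T))) :=
  commute_proj_bracket (comm_mem_relSpan_of_letterFirst h (by simp [degLE]) (by simp [degLE])
    (by simp [degLE]) (by simp [degLE]))

theorem commute_of_bracketFirst {a : Letter n} {T : List (Letter n)} (h : BracketFirst a T) :
    Commute (proj K n (X a)) (proj K n (bracket (word T))) :=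
  commute_proj_bracket (comm_mem_relSpan_of_bracketFirst h (by simp [degLE]) (by simp [degLE])
    (by simp [degLE]) (by simp [degLE]))

/-- The difference `x - x̄`, twice the imaginary part, in the graded quotient. -/
noncomputable def im (K : Type*) [Field K] {n : ℕ} (x : Letter n) : GradedQuot K n :=
  proj K n (X x) - proj K n (conjLetter x)

theorem commute_im {a : Letter n} {z : GradedQuot K n} (h : Commute (proj K n (X a)) z) :
    Commute (im K a) z := by
  have : im K a = 2 * proj K n (X a) - (proj K n (X a) + proj K n (conjLetter a)) := by
    unfold im; noncomm_ring
  rw [this]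
  exact ((Nat.cast_commute 2 z).mul_left h).sub_left
    (Subring.mem_center_iff.1 (proj_X_add_conj_mem_center a) z).symm

theorem commute_im_iff {half : GradedQuot K n} (h2 : 2 * half = 1)
    (hh : half ∈ Subring.center (GradedQuot K n)) {a : Letter n} {z : GradedQuot K n} :
    Commute (im K a) z ↔ Commute (proj K n (X a)) z := by
  refine ⟨fun h => ?_, commute_im⟩
  have : proj K n (X a) =
      half * (im K a + (proj K n (X a) + proj K n (conjLetter a))) := by
    calc _ = 2 * half * proj K n (X a) := by rw [h2, one_mul]
      _ = half * (2 * proj K n (X a)) := by rw [Subring.mem_center_iff.1 hh 2, mul_assoc]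
      _ = _ := by unfold im; noncomm_ring
  rw [this]
  exact Commute.mul_left (Subring.mem_center_iff.1 hh z).symm (h.add_left
    (Subring.mem_center_iff.1 (proj_X_add_conj_mem_center a) z).symm)

theorem commute_anti_im {a x y : Letter n}
    (h : Commute (proj K n (X a)) (proj K n (bracket (word [x, y])))) :
    Commute (proj K n (X a)) (anti (im K x) (im K y)) := by
  refine commute_anti_of_commute_bracket (proj_X_add_conj_mem_center x)
    (proj_X_add_conj_mem_center y) ?_
  simpa [bracket, word_cons, word_nil, conj_mul, conj_X, map_mul, map_add, conj_one] using h

theorem commute_tri_im {a x y z : Letter n}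
    (hc : ∀ x y : Letter n, anti (im K x) (im K y) ∈ Subring.center (GradedQuot K n))
    (h : Commute (proj K n (X a)) (proj K n (bracket (word [x, y, z])))) :
    Commute (proj K n (X a)) (tri (im K x) (im K y) (im K z)) := by
  refine commute_tri_of_commute_bracket (proj_X_add_conj_mem_center x)
    (proj_X_add_conj_mem_center y) (proj_X_add_conj_mem_center z) (hc x y) (hc y z) (hc x z) ?_
  simpa [bracket, word_cons, word_nil, conj_mul, conj_X, map_mul, map_add, conj_one,
    mul_assoc] using h

theorem table_mem {f : Poly K n} (h : f ∈ multTable K n) : f ∈ relSpan K (degLE n 2) := by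
  refine mem_relSpan_of_BG (BG.table f h) ?_
  have h2 : ∀ b b' : Basis, X (e b) * X (e b') ∈ wordSpan K (degLE n 2) := fun b b' => by
    refine mul_mem_wordSpan (X_mem_wordSpan _) (X_mem_wordSpan _) ?_
    rintro _ rfl _ rfl
    simp [degLE]
  have h1 : ∀ b : Basis, X (e b) ∈ wordSpan K (degLE n 2) := fun b =>
    wordSpan_mono (by rintro _ rfl; simp [degLE]) (X_mem_wordSpan (K := K) (n := n) (e b))
  have h0 : 1 ∈ wordSpan K (degLE n 2) := word_mem_wordSpan (T := []) (by simp [degLE])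
  rcases h with rfl | rfl | rfl | rfl | rfl | rfl | rfl | rfl | rfl
  · exact add_mem (h2 _ _) h0
  · exact add_mem (h2 _ _) h0
  · exact add_mem (h2 _ _) h0
  · exact sub_mem (h2 _ _) (h1 _)
  · exact add_mem (h2 _ _) (h1 _)
  · exact sub_mem (h2 _ _) (h1 _)
  · exact add_mem (h2 _ _) (h1 _)
  · exact sub_mem (h2 _ _) (h1 _)
  · exact add_mem (h2 _ _) (h1 _)

theorem e_sq_add_one_mem (b : Basis) :
    X (e b) * X (e b) + 1 ∈ relSpan K (degLE n 2) := by
  cases b <;> exact table_mem (by simp [multTable])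

theorem anti_im_e_e {b b' : Basis} (h : b ≠ b') :
    anti (im K (e b : Letter n)) (im K (e b')) = 0 := by
  have key : X (e b) * X (e b') + X (e b') * X (e b) ∈ relSpan K (degLE n 2) := by
    have hij := add_mem (table_mem (K := K) (n := n) (f := X (e .i) * X (e .j) - X (e .k))
      (by simp [multTable])) (table_mem (f := X (e .j) * X (e .i) + X (e .k)) (by simp [multTable]))
    have hjk := add_mem (table_mem (K := K) (n := n) (f := X (e .j) * X (e .k) - X (e .i))
      (by simp [multTable])) (table_mem (f := X (e .k) * X (e .j) + X (e .i)) (by simp [multTable]))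
    have hki := add_mem (table_mem (K := K) (n := n) (f := X (e .k) * X (e .i) - X (e .j))
      (by simp [multTable])) (table_mem (f := X (e .i) * X (e .k) + X (e .j)) (by simp [multTable]))
    rw [sub_add_add_cancel] at hij hjk hki
    cases b <;> cases b' <;> first | exact (h rfl).elim | assumption | (rw [add_comm]; assumption)
  have h0 : proj K n (X (e b) * X (e b') + X (e b') * X (e b)) = 0 := by
    refine proj_eq_zero (d := 2) (add_mem ?_ ?_) key <;>
    · refine mul_mem_wordSpan (X_mem_wordSpan _) (X_mem_wordSpan _) ?_
      rintro _ rfl _ rfl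
      rfl
  have e1 : anti (im K (e b : Letter n)) (im K (e b')) =
      4 * proj K n (X (e b) * X (e b') + X (e b') * X (e b)) := by
    simp only [anti, im, conjLetter, map_neg, map_mul, map_add]
    noncomm_ring
  rw [e1, h0, mul_zero]

theorem commute_anti_im_e (a : Letter n) (b : Basis) :
    Commute (proj K n (X a)) (anti (im K (e b)) (im K (e b))) := by
  have e1 : anti (im K (e b : Letter n)) (im K (e b)) =
      8 * proj K n (X (e b) * X (e b)) := by
    simp only [anti, im, conjLetter, map_neg, map_mul]
    noncomm_ring
  rw [e1]
  refine (Nat.cast_commute 8 _).symm.mul_right ?_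
  refine sub_eq_zero.1 ?_
  rw [← map_mul, ← map_mul, ← map_sub]
  have hw : X (e b) * X (e b) ∈ wordSpan K (degEq n 2) := by
    refine mul_mem_wordSpan (X_mem_wordSpan _) (X_mem_wordSpan _) ?_
    rintro _ rfl _ rfl
    rfl
  have hs := e_sq_add_one_mem (K := K) (n := n) b
  have e2 : X a * (X (e b) * X (e b)) - X (e b) * X (e b) * X a =
      X a * (X (e b) * X (e b) + 1) - (X (e b) * X (e b) + 1 : Poly K n) * X a := by noncomm_ring
  refine proj_eq_zero (d := 3) (sub_mem ?_ ?_) (e2 ▸ sub_mem ?_ ?_)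
  · exact mul_mem_wordSpan (X_mem_wordSpan _) hw (by rintro _ rfl v hv; simp_all [degEq])
  · exact mul_mem_wordSpan hw (X_mem_wordSpan _) (by rintro v hv _ rfl; simp_all [degEq])
  · exact X_mul_mem_degLE _ hs
  · exact mul_X_mem_degLE _ hs

/-- By the multiplication table, `[ijk]` is the constant `-2`. -/
theorem commute_bracket_ijk (a : Letter n) :
    Commute (proj K n (X a)) (proj K n (bracket (word [e .i, e .j, e .k]))) := by
  refine commute_proj_bracket (T := [e .i, e .j, e .k]) ?_
  have hr : bracket (word [e .i, e .j, e .k]) + 2 ∈ relSpan K (degLE n 3) := by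
    have e1 : (bracket (word [e .i, e .j, e .k]) + 2 : Poly K n) =
        (X (e .i) * X (e .j) - X (e .k)) * X (e .k) + (X (e .k) * X (e .k) + 1)
        - (X (e .k) * X (e .j) + X (e .i)) * X (e .i) + (X (e .i) * X (e .i) + 1) := by
      simp only [bracket, word_cons, word_nil, conj_mul, conj_X, conj_one, conjLetter]
      rw [← one_add_one_eq_two]
      noncomm_ring
    have hmono : relSpan K (degLE n 2) ≤ relSpan K (degLE n 3) :=
      relSpan_mono fun v (hv : v.length ≤ 2) => show v.length ≤ 3 by omega
    rw [e1]
    refine add_mem (sub_mem (add_mem ?_ (hmono (e_sq_add_one_mem _))) ?_)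
      (hmono (e_sq_add_one_mem _))
    · exact mul_X_mem_degLE _ (table_mem (by simp [multTable]))
    · exact mul_X_mem_degLE _ (table_mem (by simp [multTable]))
  have e2 : comm K a [e .i, e .j, e .k] = X a * (bracket (word [e .i, e .j, e .k]) + 2) -
      (bracket (word [e .i, e .j, e .k]) + 2) * X a := by
    unfold comm; noncomm_ring
  rw [e2]
  refine sub_mem ?_ ?_
  · exact X_mul_mem_degLE _ hr
  · exact mul_X_mem_degLE _ hr

/-- The unbarred letters. -/
abbrev BaseLetter (n : ℕ) : Type := {a : Letter n // a.base = a}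

theorem BaseLetter.eq_q_or_e (a : BaseLetter n) :
    (∃ l, a = ⟨q l, rfl⟩) ∨ ∃ b, a = ⟨e b, rfl⟩ := by
  obtain ⟨l | l | b, h⟩ := a
  · exact Or.inl ⟨l, rfl⟩
  · cases h
  · exact Or.inr ⟨b, rfl⟩

theorem q_lt_q {l m : Fin n} : (q l : Letter n) < q m ↔ l < m := by
  rw [lt_iff_rank, Fin.lt_def]
  simp only [rank]
  omega

theorem not_e_lt_q {b : Basis} {m : Fin n} : ¬ (e b : Letter n) < q m := by
  have := m.2
  rw [lt_iff_rank]
  cases b <;> simp only [rank] <;> omega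

theorem commute_anti_im_diag {half : GradedQuot K n} (h2 : 2 * half = 1)
    (hh : half ∈ Subring.center (GradedQuot K n)) (a c : BaseLetter n) :
    Commute (anti (im K a.1) (im K c.1)) (im K a.1) := by
  rcases eq_or_ne a c with rfl | hac
  · unfold anti
    exact (((Commute.refl _).mul_left (Commute.refl _)).add_left
      ((Commute.refl _).mul_left (Commute.refl _)))
  rcases a.eq_q_or_e with ⟨l, rfl⟩ | ⟨b, rfl⟩ <;> rcases c.eq_q_or_e with ⟨m, rfl⟩ | ⟨b', rfl⟩
  · have hlm : l ≠ m := fun h => hac (by rw [h])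
    refine (commute_im ?_).symm
    rcases hlm.lt_or_gt with h | h
    · rw [anti_comm]
      exact commute_anti_im (commute_of_bracketFirst (.b3_5 h))
    · exact commute_anti_im (commute_of_letterFirst (.c3 h))
  · refine (commute_im ?_).symm
    rw [anti_comm]
    exact commute_anti_im (commute_of_bracketFirst (.b3_9 l b'))
  · exact commute_anti_of_commute_sq h2 hh (commute_im (commute_anti_im_e (q m) b))
  · have hb : b ≠ b' := fun h => hac (by rw [h])
    simp [anti_im_e_e hb]

theorem e_injective_of_lt {b b' : Basis} (h : (e b : Letter n) < e b') : b ≠ b' := by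
  rintro rfl
  exact lt_irrefl _ h

theorem bracketFirst_e_e (l : Fin n) {b b' : Basis} (h : (e b : Letter n) < e b') :
    BracketFirst (e b) [e b', q l] := by
  cases b <;> cases b' <;>
    first
    | exact .b3_11 l
    | exact .b3_12 l
    | exact .b3_13 l
    | (simp [lt_iff_rank, rank] at h)

theorem eq_ijk_of_lt {b b' b'' : Basis} (h : (e b : Letter n) < e b')
    (h' : (e b' : Letter n) < e b'') : b = .i ∧ b' = .j ∧ b'' = .k := by
  cases b <;> cases b' <;> cases b'' <;> simp [lt_iff_rank, rank] at h h' ⊢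

theorem antiCentral_im {half : GradedQuot K n} (h2 : 2 * half = 1)
    (hh : half ∈ Subring.center (GradedQuot K n)) (a b c : BaseLetter n) :
    AntiCentral (im K a.1) (im K b.1) (im K c.1) := by
  refine forall_of_symmetric₃ (P := fun a b c : BaseLetter n =>
    AntiCentral (im K a.1) (im K b.1) (im K c.1)) (fun _ _ _ h => h.swap12)
    (fun _ _ _ h => h.swap23) (fun a c => .of_diag (commute_anti_im_diag h2 hh a c)) ?_ a b c
  clear a b c
  intro a b c hab hbc
  have hab' : a.1 < b.1 := hab
  have hbc' : b.1 < c.1 := hbc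
  rcases a.eq_q_or_e with ⟨l, rfl⟩ | ⟨b1, rfl⟩ <;>
    rcases b.eq_q_or_e with ⟨m, rfl⟩ | ⟨b2, rfl⟩ <;>
    rcases c.eq_q_or_e with ⟨p, rfl⟩ | ⟨b3, rfl⟩ <;>
    first
    | exact (not_e_lt_q hab').elim
    | exact (not_e_lt_q hbc').elim
    | skip
  · rw [q_lt_q] at hab' hbc'
    refine (AntiCentral.of_two (a := im K (q m)) (b := im K (q p)) ?_ ?_).swap23.swap12
    · rw [anti_comm]
      exact (commute_im (commute_anti_im (commute_of_bracketFirst (.b3_1 hab' hbc')))).symm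
    · exact (commute_im (commute_anti_im (commute_of_bracketFirst (.b3_3 hab' hbc')))).symm
  · rw [q_lt_q] at hab'
    refine (AntiCentral.of_two (a := im K (q m)) (b := im K (e b3)) ?_ ?_).swap23.swap12
    · rw [anti_comm]
      exact (commute_im (commute_anti_im (commute_of_bracketFirst (.b3_6 b3 hab')))).symm
    · exact (commute_im (commute_anti_im (commute_of_bracketFirst (.b3_7 b3 hab')))).symm
  · have h : BracketFirst (e b2) [e b3, q l] := bracketFirst_e_e l hbc'
    refine (AntiCentral.of_two (a := im K (e b2)) (b := im K (e b3)) ?_ ?_).swap23.swap12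
    · rw [anti_im_e_e (e_injective_of_lt hbc')]
      exact Commute.zero_left _
    · exact (commute_im (commute_anti_im (commute_of_bracketFirst h))).symm
  · refine .of_two ?_ ?_
    · rw [anti_im_e_e (e_injective_of_lt hab')]
      exact Commute.zero_left _
    · rw [anti_im_e_e (e_injective_of_lt hbc')]
      exact Commute.zero_left _

theorem im_eq_or (a : Letter n) :
    ∃ b : BaseLetter n, im K a = im K b.1 ∨ im K a = -im K b.1 := by
  rcases a with l | l | b
  · exact ⟨⟨q l, rfl⟩, Or.inl rfl⟩
  · exact ⟨⟨q l, rfl⟩, Or.inr (by simp [im, conjLetter])⟩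
  · exact ⟨⟨e b, rfl⟩, Or.inl rfl⟩

theorem mem_center_of_commute_im {half : GradedQuot K n} (h2 : 2 * half = 1)
    (hh : half ∈ Subring.center (GradedQuot K n)) {z : GradedQuot K n}
    (h : ∀ a : BaseLetter n, Commute (im K a.1) z) : z ∈ Subring.center (GradedQuot K n) := by
  refine proj_mem_center fun a => (commute_im_iff h2 hh).1 ?_
  obtain ⟨b, hb | hb⟩ := im_eq_or (K := K) a
  · exact hb ▸ h b
  · exact hb ▸ (h b).neg_left

theorem anti_im_mem_center {half : GradedQuot K n} (h2 : 2 * half = 1)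
    (hh : half ∈ Subring.center (GradedQuot K n)) (x y : Letter n) :
    anti (im K x) (im K y) ∈ Subring.center (GradedQuot K n) := by
  have base : ∀ x y : BaseLetter n, anti (im K x.1) (im K y.1) ∈ Subring.center _ := fun x y =>
    mem_center_of_commute_im h2 hh fun a => (antiCentral_im h2 hh x y a).1.symm
  have hl : ∀ u v : GradedQuot K n, anti (-u) v = -anti u v := fun u v => by
    unfold anti; noncomm_ring
  have hr : ∀ u v : GradedQuot K n, anti u (-v) = -anti u v := fun u v => by
    unfold anti; noncomm_ring
  obtain ⟨x', hx | hx⟩ := im_eq_or (K := K) x <;> obtain ⟨y', hy | hy⟩ := im_eq_or (K := K) y <;>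
    simp only [hx, hy, hl, hr, neg_mem_iff] <;> exact base x' y'

/-- The commutator of an imaginary part with the scalar triple product of three others is
alternating in the four letters, so it vanishes as soon as it does for increasing letters. -/
theorem commute_tri_im_base {half : GradedQuot K n} (h2 : 2 * half = 1)
    (hh : half ∈ Subring.center (GradedQuot K n)) (a b c d : BaseLetter n) :
    Commute (im K a.1) (tri (im K b.1) (im K c.1) (im K d.1)) := by
  have hc := anti_im_mem_center (K := K) (n := n) h2 hh
  have h12 : ∀ a b c d : Letter n, Commute (im K a) (tri (im K b) (im K c) (im K d)) →
      Commute (im K b) (tri (im K a) (im K c) (im K d)) := fun a b c d h =>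
    commute_tri_swap12 (hc _ _) (hc _ _) h
  have h23 : ∀ a b c d : Letter n, Commute (im K a) (tri (im K b) (im K c) (im K d)) →
      Commute (im K a) (tri (im K c) (im K b) (im K d)) := fun a b c d h =>
    commute_tri_swap23 (hc _ _) h
  have h34 : ∀ a b c d : Letter n, Commute (im K a) (tri (im K b) (im K c) (im K d)) →
      Commute (im K a) (tri (im K b) (im K d) (im K c)) := fun a b c d h =>
    commute_tri_swap34 (hc _ _) h
  have of_bracket : ∀ a b c d : Letter n, LetterFirst c [b, d, a] →
      Commute (im K a) (tri (im K b) (im K c) (im K d)) := fun a b c d h =>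
    h23 _ _ _ _ (h12 _ _ _ _ (h23 _ _ _ _ (h34 _ _ _ _
      (commute_im (commute_tri_im hc (commute_of_letterFirst h))))))
  refine forall_of_symmetric₄ (P := fun a b c d : BaseLetter n =>
    Commute (im K a.1) (tri (im K b.1) (im K c.1) (im K d.1)))
    (fun _ _ _ _ => h12 _ _ _ _) (fun _ _ _ _ => h23 _ _ _ _) (fun _ _ _ _ => h34 _ _ _ _)
    (fun a c d => commute_tri_diag h2 hh (hc _ _) (hc _ _)) ?_ a b c d
  clear a b c d
  intro a b c d hab hbc hcd
  have hab' : a.1 < b.1 := hab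
  have hbc' : b.1 < c.1 := hbc
  have hcd' : c.1 < d.1 := hcd
  rcases a.eq_q_or_e with ⟨l, rfl⟩ | ⟨b1, rfl⟩ <;>
    rcases b.eq_q_or_e with ⟨m, rfl⟩ | ⟨b2, rfl⟩ <;>
    rcases c.eq_q_or_e with ⟨p, rfl⟩ | ⟨b3, rfl⟩ <;>
    rcases d.eq_q_or_e with ⟨r, rfl⟩ | ⟨b4, rfl⟩ <;>
    first
    | exact (not_e_lt_q hab').elim
    | exact (not_e_lt_q hbc').elim
    | exact (not_e_lt_q hcd').elim
    | skip
  · rw [q_lt_q] at hab' hbc' hcd'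
    exact of_bracket _ _ _ _ (.d4_324 hab' hbc' hcd')
  · rw [q_lt_q] at hab' hbc'
    exact of_bracket _ _ _ _ (.d4_32e b4 hab' hbc')
  · rw [q_lt_q] at hab'
    refine of_bracket _ _ _ _ (.d4_e2e b3 b4 hab' hcd'.le fun h => ?_)
    rw [Prod.mk.injEq] at h
    exact e_injective_of_lt hcd' (h.1.trans h.2.symm)
  · obtain ⟨rfl, rfl, rfl⟩ := eq_ijk_of_lt hbc' hcd'
    exact commute_im (commute_tri_im hc (commute_bracket_ijk _))
  · obtain ⟨rfl, rfl, rfl⟩ := eq_ijk_of_lt hbc' hcd'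
    cases b1 <;> simp [lt_iff_rank, rank] at hab'

theorem tri_im_mem_center {half : GradedQuot K n} (h2 : 2 * half = 1)
    (hh : half ∈ Subring.center (GradedQuot K n)) (x y z : Letter n) :
    tri (im K x) (im K y) (im K z) ∈ Subring.center (GradedQuot K n) := by
  have base : ∀ x y z : BaseLetter n, tri (im K x.1) (im K y.1) (im K z.1) ∈ Subring.center _ :=
    fun x y z => mem_center_of_commute_im h2 hh fun a => commute_tri_im_base h2 hh a x y z
  have h1 : ∀ u v w : GradedQuot K n, tri (-u) v w = -tri u v w := fun u v w => by
    unfold tri; noncomm_ring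
  have h2 : ∀ u v w : GradedQuot K n, tri u (-v) w = -tri u v w := fun u v w => by
    unfold tri; noncomm_ring
  have h3 : ∀ u v w : GradedQuot K n, tri u v (-w) = -tri u v w := fun u v w => by
    unfold tri; noncomm_ring
  obtain ⟨x', hx | hx⟩ := im_eq_or (K := K) x <;> obtain ⟨y', hy | hy⟩ := im_eq_or (K := K) y <;>
    obtain ⟨z', hz | hz⟩ := im_eq_or (K := K) z <;>
    simp only [hx, hy, hz, h1, h2, h3, neg_mem_iff] <;> exact base x' y' z'

theorem conj_word_eq_prod (T : List (Letter n)) :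
    conj (word T : Poly K n) = (T.reverse.map conjLetter).prod := by
  induction T with
  | nil => exact conj_one
  | cons a T ih => rw [word_cons, conj_mul, conj_X, ih]; simp

theorem exists_half (hK : ringChar K ≠ 2) :
    ∃ half : GradedQuot K n, 2 * half = 1 ∧ half ∈ Subring.center (GradedQuot K n) := by
  have h2 : (2 : K) ≠ 0 := Ring.two_ne_zero hK
  refine ⟨proj K n (algebraMap K _ 2⁻¹), ?_, proj_mem_center fun a => ?_⟩
  · rw [← map_ofNat (proj K n) 2, ← map_mul, ← map_ofNat (algebraMap K (Poly K n)) 2, ← map_mul,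
      mul_inv_cancel₀ h2, map_one, map_one]
  · exact (Algebra.commute_algebraMap_right _ _).map (proj K n)

/-- In the graded quotient every bracket of a word is central. -/
theorem proj_bracket_mem_center (hK : ringChar K ≠ 2) (T : List (Letter n)) :
    proj K n (bracket (word T)) ∈ Subring.center (GradedQuot K n) := by
  obtain ⟨half, h2, hh⟩ := exists_half (n := n) hK
  have := bracket_mem_center (x := fun a => proj K n (X a))
    (x' := fun a => proj K n (conjLetter a)) h2 hh proj_X_add_conj_mem_center
    (anti_im_mem_center h2 hh) (tri_im_mem_center h2 hh) T
  rw [bracket, map_add, conj_word_eq_prod, word, map_list_prod, map_list_prod, List.map_map,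
    List.map_map]
  exact this

/-! ### Homogeneous polynomials and central elements -/

theorem hom_word (T : List (Letter n)) : (word T : Poly K n) ∈ wordSpan K (degEq n T.length) :=
  word_mem_wordSpan rfl

theorem hom_conj_word (T : List (Letter n)) :
    conj (word T : Poly K n) ∈ wordSpan K (degEq n T.length) :=
  wordSpan_mono (by rintro _ rfl; simp [degEq]) (conj_word_mem_wordSpan T)

theorem hom_X (a : Letter n) : (X a : Poly K n) ∈ wordSpan K (degEq n 1) :=
  wordSpan_mono (by rintro _ rfl; rfl) (X_mem_wordSpan a)

theorem hom_conjLetter (a : Letter n) : (conjLetter a : Poly K n) ∈ wordSpan K (degEq n 1) :=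
  wordSpan_mono (by rintro _ rfl; rfl) (conjLetter_mem_wordSpan a)

theorem hom_tr (x : Letter n) : tr K x ∈ wordSpan K (degEq n 1) :=
  wordSpan_mono (by rintro _ (rfl | rfl) <;> rfl) (tr_mem_wordSpan x)

theorem hom_mul {d d' : ℕ} {f g : Poly K n} (hf : f ∈ wordSpan K (degEq n d))
    (hg : g ∈ wordSpan K (degEq n d')) : f * g ∈ wordSpan K (degEq n (d + d')) :=
  mul_mem_wordSpan hf hg fun u (hu : u.length = d) v (hv : v.length = d') => by
    simp [degEq, hu, hv]

theorem hom_bracket_word (T : List (Letter n)) :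
    (bracket (word T) : Poly K n) ∈ wordSpan K (degEq n T.length) :=
  add_mem (hom_word T) (hom_conj_word T)

theorem proj_norm_mem_center (hK : ringChar K ≠ 2) {x : Letter n} (hx : x.IsVar) :
    proj K n (X x * X x.bar) ∈ Subring.center (GradedQuot K n) := by
  obtain ⟨half, h2, hh⟩ := exists_half (n := n) hK
  have h := proj_bracket_mem_center hK [x, x.bar]
  have e : (bracket (word [x, x.bar]) : Poly K n) = 2 * (X x * X x.bar) := by
    rw [bracket, word_cons, word_cons, word_nil, mul_one, conj_mul, conj_X, conj_X,
      conjLetter_of_isVar hx, conjLetter_of_isVar hx.bar, bar_bar, two_mul]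
  rw [e, map_mul, map_ofNat] at h
  have := mul_mem hh h
  rwa [← mul_assoc, ← Subring.mem_center_iff.1 hh 2, h2, one_mul] at this

theorem proj_tr_mem_center (x : Letter n) : proj K n (tr K x) ∈ Subring.center _ := by
  rw [tr, bracket, conj_X, map_add]
  exact proj_X_add_conj_mem_center x

theorem mul_sub_mul_mem_degLE {d d' m : ℕ} {f c : Poly K n} (hf : f ∈ wordSpan K (degEq n d))
    (hc : c ∈ wordSpan K (degEq n d')) (h : proj K n c ∈ Subring.center _) (hm : d + d' = m) :
    f * c - c * f ∈ relSpan K (degLE n m) := by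
  subst hm
  refine mem_relSpan_of_proj_eq_zero (sub_mem (hom_mul hf hc) (add_comm d d' ▸ hom_mul hc hf)) ?_
  rw [map_sub, map_mul, map_mul, Subring.mem_center_iff.1 h, sub_self]

theorem mul_tr_sub_tr_mul_mem_degLE {d m : ℕ} {f : Poly K n} (hf : f ∈ wordSpan K (degEq n d))
    (x : Letter n) (hm : d + 1 = m) : f * tr K x - tr K x * f ∈ relSpan K (degLE n m) :=
  mul_sub_mul_mem_degLE hf (hom_tr x) (proj_tr_mem_center x) hm

/-- Commutators of letters with brackets are combinations of relations of at most their degree.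
This says nothing about leading words. -/
theorem comm_mem_degLE (hK : ringChar K ≠ 2) (a : Letter n) (T : List (Letter n)) {m : ℕ}
    (hm : T.length + 1 = m) : comm K a T ∈ relSpan K (degLE n m) :=
  mul_sub_mul_mem_degLE (hom_X a) (hom_bracket_word T) (proj_bracket_mem_center hK T) (by omega)

theorem hom_mul_mem_degLE {d d' m : ℕ} {f g : Poly K n} (hf : f ∈ wordSpan K (degEq n d))
    (hg : g ∈ relSpan K (degLE n d')) (hm : d + d' ≤ m) : f * g ∈ relSpan K (degLE n m) :=
  mul_left_mem_relSpan hf hg fun u (hu : u.length = d) v (hv : v.length ≤ d') => by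
    simp only [degLE, Set.mem_ofPred_eq, List.length_append]; omega

theorem mul_hom_mem_degLE {d d' m : ℕ} {f g : Poly K n} (hf : f ∈ relSpan K (degLE n d))
    (hg : g ∈ wordSpan K (degEq n d')) (hm : d + d' ≤ m) : f * g ∈ relSpan K (degLE n m) :=
  mul_right_mem_relSpan hf hg fun u (hu : u.length ≤ d) v (hv : v.length = d') => by
    simp only [degLE, Set.mem_ofPred_eq, List.length_append]; omega

/-! ### Bounding leading words -/

theorem WordLE.trans {u v w : List (Letter n)} (h : WordLE u v) (h' : WordLE v w) :
    WordLE u w := by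
  induction u generalizing v w with
  | nil =>
    rcases w with _ | ⟨c, w⟩
    · exact .refl _
    · exact .of_length_lt (by simp)
  | cons a u ih =>
    rcases v with _ | ⟨b, v⟩
    · simpa using h.length_le
    rcases w with _ | ⟨c, w⟩
    · simpa using h'.length_le
    rw [wordLE_cons_cons] at h h' ⊢
    rcases h with h | h | ⟨rfl, h⟩ <;> rcases h' with h' | h' | ⟨rfl, h'⟩
    · exact Or.inl (h.trans h')
    · exact Or.inl (h.trans_le h'.1)
    · exact Or.inl (h.trans_le h'.length_le)
    · exact Or.inl (h.1.trans_lt h')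
    · exact Or.inr (Or.inl ⟨h.1.trans h'.1, h.2.trans h'.2⟩)
    · exact Or.inr (Or.inl ⟨h.1.trans h'.length_le, h.2⟩)
    · exact Or.inl (h.length_le.trans_lt h')
    · exact Or.inr (Or.inl ⟨h.length_le.trans h'.1, h'.2⟩)
    · exact Or.inr (Or.inr ⟨rfl, ih h h'⟩)

theorem relSpan_upto_mono {v w : List (Letter n)} (h : WordLE v w) :
    relSpan K (upto v) ≤ relSpan K (upto w) :=
  relSpan_mono fun _ hu => WordLE.trans hu h

theorem WordLE.cons {v w : List (Letter n)} (a : Letter n) (h : WordLE v w) :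
    WordLE (a :: v) (a :: w) :=
  h.append_left [a]

theorem wordLE_of_lt (P : List (Letter n)) {x y : Letter n} {v w : List (Letter n)} (h : x < y)
    (hl : v.length ≤ w.length) : WordLE (P ++ x :: v) (P ++ y :: w) :=
  WordLE.append_left P (wordLE_cons_cons.2 (Or.inr (Or.inl ⟨hl, h⟩)))

theorem word_mul_mem_upto (P : List (Letter n)) {w : List (Letter n)} {f : Poly K n}
    (hf : f ∈ relSpan K (upto w)) : word P * f ∈ relSpan K (upto (P ++ w)) :=
  mul_left_mem_relSpan (word_mem_wordSpan (Set.mem_singleton P)) hf (by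
    rintro _ rfl v hv
    exact WordLE.append_left _ hv)

theorem X_mul_mem_upto (a : Letter n) {w : List (Letter n)} {f : Poly K n}
    (hf : f ∈ relSpan K (upto w)) : X a * f ∈ relSpan K (upto (a :: w)) := by
  rw [X_eq_word]
  exact word_mul_mem_upto [a] hf

theorem mul_word_mem_upto (P : List (Letter n)) {w : List (Letter n)} {f : Poly K n}
    (hf : f ∈ relSpan K (upto w)) : f * word P ∈ relSpan K (upto (w ++ P)) :=
  mul_right_mem_relSpan hf (word_mem_wordSpan (Set.mem_singleton P)) (by
    rintro v hv _ rfl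
    exact WordLE.append_right _ hv)

theorem mul_X_mem_upto (a : Letter n) {w : List (Letter n)} {f : Poly K n}
    (hf : f ∈ relSpan K (upto w)) : f * X a ∈ relSpan K (upto (w ++ [a])) := by
  rw [X_eq_word]
  exact mul_word_mem_upto [a] hf

/-- Multiplication on the right by a polynomial of which only the degree is known, when the bound
is lowered strictly at some place. -/
theorem mul_hom_mem_upto (P : List (Letter n)) {x y : Letter n} {v w : List (Letter n)} {m : ℕ}
    {f r : Poly K n} (hf : f ∈ relSpan K (upto (P ++ x :: v))) (h : x < y)
    (hr : r ∈ wordSpan K (degEq n m)) (hl : v.length + m ≤ w.length) :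
    f * r ∈ relSpan K (upto (P ++ y :: w)) := by
  refine mul_right_mem_relSpan hf hr fun u hu b (hb : b.length = m) => ?_
  refine (WordLE.append_right b hu).trans ?_
  rw [List.append_assoc]
  refine wordLE_of_lt P h ?_
  change (v ++ b).length ≤ _
  rw [List.length_append]
  omega

theorem X_mul_mem_of_lt {x y : Letter n} {w : List (Letter n)} {d : ℕ} {f : Poly K n}
    (hf : f ∈ relSpan K (degLE n d)) (h : x < y) (hl : d ≤ w.length) :
    X x * f ∈ relSpan K (upto (y :: w)) :=
  mul_left_mem_relSpan (X_mem_wordSpan x) hf (by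
    rintro _ rfl v hv
    exact wordLE_of_lt [] h (le_trans hv hl))

theorem tr_mul_mem_of_below {x y : Letter n} {w : List (Letter n)} {d : ℕ} {f : Poly K n}
    (hf : f ∈ relSpan K (degLE n d)) (h : Below x y) (hl : d ≤ w.length) :
    tr K x * f ∈ relSpan K (upto (y :: w)) := by
  rw [tr_of_isVar h.1, add_mul]
  exact add_mem (X_mul_mem_of_lt hf h.2.1 hl) (X_mul_mem_of_lt hf h.2.2.1 hl)

/-- The commutator `a[x] - [x]a` with `x` smaller than `a`, bounded by its leading word. -/
theorem mul_tr_sub_mem_upto {x y : Letter n} (h : Below x y) :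
    X y * tr K x - tr K x * X y ∈ relSpan K (upto [y, max x x.bar]) := by
  refine mul_tr_sub_mem h ?_ ?_ <;> refine WordLE.cons _ (wordLE_cons_cons.2 ?_)
  · rcases (le_max_left x x.bar).lt_or_eq with h | h
    · exact Or.inr (Or.inl ⟨le_rfl, h⟩)
    · exact Or.inr (Or.inr ⟨h, .refl _⟩)
  · rcases (le_max_right x x.bar).lt_or_eq with h | h
    · exact Or.inr (Or.inl ⟨le_rfl, h⟩)
    · exact Or.inr (Or.inr ⟨h, .refl _⟩)

/-- The commutator `a[x] - [x]a` with `a` and `x` smaller than `y`, multiplied on the right. -/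
theorem mul_tr_sub_mul_mem_of_below {a x y : Letter n} {w : List (Letter n)} {m : ℕ} {r : Poly K n}
    (ha : a < y) (ha' : a.bar < y) (h : Below x y) (hr : r ∈ wordSpan K (degEq n m))
    (hl : m + 1 ≤ w.length) :
    (X a * tr K x - tr K x * X a) * r ∈ relSpan K (upto (y :: w)) := by
  obtain ⟨z, z', hz, hf⟩ := exists_mul_tr_sub_mem (K := K) a x
  refine mul_hom_mem_upto [] (x := z) (v := [z']) hf ?_ hr (by simpa [add_comm] using hl)
  rcases hz with rfl | rfl | rfl | rfl
  · exact ha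
  · exact ha'
  · exact h.2.1
  · exact h.2.2.1

/-! ### Relations of degree three -/

theorem tr_eq (y : Letter n) : tr K y = X y + conjLetter y := by rw [tr, bracket, conj_X]

theorem bracket_pair (y x : Letter n) :
    (bracket (word [y, x]) : Poly K n) = X y * X x + conjLetter x * conjLetter y := by
  simp [bracket, word_cons, word_nil, conj_mul, conj_X]

theorem max_bar_of_lt {x : Letter n} (h : x < x.bar) : max x x.bar = x.bar := max_eq_right h.le

theorem Letter.Below.max_lt {x y : Letter n} (h : Below x y) : max x x.bar < y :=
  _root_.max_lt h.2.1 h.2.2.1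

theorem comm_pair_bar_right {a x y : Letter n} (hx : Below x y) (ha : a < y)
    (ha' : a.bar < y) (hlt : x < x.bar) (h : comm K a [y, x] ∈ relSpan K (upto [y, x, a])) :
    comm K a [y, x.bar] ∈ relSpan K (upto [y, x.bar, a]) := by
  have e : comm K a [y, x.bar] = -comm K a [y, x] +
      (X a * (X y * tr K x - tr K x * X y) + (X a * tr K x - tr K x * X a) * tr K y +
        tr K x * (X a * tr K y - tr K y * X a) - (X y * tr K x - tr K x * X y) * X a) := by
    rw [comm, comm, bracket_pair, bracket_pair, conjLetter_of_isVar hx.1,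
      conjLetter_of_isVar hx.1.bar, bar_bar, tr_of_isVar hx.1, tr_eq y]
    noncomm_ring
  have hyx := mul_tr_sub_mem_upto (K := K) hx
  rw [max_bar_of_lt hlt] at hyx
  rw [e]
  refine add_mem (neg_mem (relSpan_upto_mono ?_ h)) (sub_mem (add_mem (add_mem ?_ ?_) ?_) ?_)
  · exact wordLE_of_lt [y] hlt le_rfl
  · exact X_mul_mem_of_lt (mul_tr_sub_mem_degLE y x) ha (by simp)
  · exact mul_tr_sub_mul_mem_of_below ha ha' hx (hom_tr y) (by simp)
  · exact tr_mul_mem_of_below (mul_tr_sub_mem_degLE a y) hx (by simp)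
  · exact (mul_X_mem_upto a hyx :)

theorem comm_pair_bar_left {a x y : Letter n} (hx : Below x y) (hy : y.IsVar) (ha : a < y.bar)
    (ha' : a.bar < y.bar) (hlt : y < y.bar) (h : comm K a [y, x] ∈ relSpan K (upto [y, x, a])) :
    comm K a [y.bar, x] ∈ relSpan K (upto [y.bar, x, a]) := by
  have e : comm K a [y.bar, x] = -comm K a [y, x] +
      (X a * (tr K y * X x - X x * tr K y) + (X a * tr K x - tr K x * X a) * tr K y +
        tr K x * (X a * tr K y - tr K y * X a) - (tr K y * X x - X x * tr K y) * X a) := by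
    rw [comm, comm, bracket_pair, bracket_pair, conjLetter_of_isVar hy,
      conjLetter_of_isVar hy.bar, bar_bar, tr_of_isVar hy, tr_eq x]
    noncomm_ring
  have hyx := tr_mul_sub_mem (K := K) hx hy (w := [y.bar, x]) (wordLE_of_lt [] hlt le_rfl) (.refl _)
  rw [e]
  refine add_mem (neg_mem (relSpan_upto_mono ?_ h)) (sub_mem (add_mem (add_mem ?_ ?_) ?_) ?_)
  · exact wordLE_of_lt [] hlt le_rfl
  · refine X_mul_mem_of_lt (d := 2) ?_ ha (by simp)
    rw [← neg_mem_iff, neg_sub]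
    exact mul_tr_sub_mem_degLE x y
  · exact mul_tr_sub_mul_mem_of_below ha ha' hx.bar_right (hom_tr y) (by simp)
  · exact tr_mul_mem_of_below (mul_tr_sub_mem_degLE a y) hx.bar_right (by simp)
  · exact (mul_X_mem_upto a hyx :)

theorem comm_pair_bar_letter {a x y : Letter n} (hxy : Below x y) (hax : Below a x)
    (hlt : a < a.bar) (h : comm K a [y, x] ∈ relSpan K (upto [y, x, a])) :
    comm K a.bar [y, x] ∈ relSpan K (upto [y, x, a.bar]) := by
  have hay := hax.trans hxy
  have e : comm K a.bar [y, x] = -comm K a [y, x] +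
      (-(X y * (X x * tr K a - tr K a * X x)) - (X y * tr K a - tr K a * X y) * X x -
        (X x.bar * tr K a - tr K a * X x.bar) * conjLetter y +
        -(X x.bar * (conjLetter y * tr K a - tr K a * conjLetter y))) := by
    rw [comm, comm, bracket_pair, tr_of_isVar hax.1, conjLetter_of_isVar hxy.1]
    noncomm_ring
  have h1 := mul_tr_sub_mem_upto (K := K) hax
  have h2 := mul_tr_sub_mem_upto (K := K) hay
  have h3 := mul_tr_sub_mem_upto (K := K) hax.bar_right
  rw [max_bar_of_lt hlt] at h1 h2
  rw [e]
  refine add_mem (neg_mem (relSpan_upto_mono ?_ h)) (add_mem (sub_mem (sub_mem (neg_mem ?_) ?_) ?_)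
    (neg_mem ?_))
  · exact wordLE_of_lt [y, x] hlt le_rfl
  · exact X_mul_mem_upto y h1
  · exact mul_hom_mem_upto [y] h2 hax.2.2.1 (hom_X x) (by simp)
  · exact mul_hom_mem_upto [] h3 hxy.2.2.1 (hom_conjLetter y) (by simp)
  · exact X_mul_mem_of_lt (mul_tr_sub_tr_mul_mem_degLE (hom_conjLetter y) a rfl) hxy.2.2.1 (by simp)

/-- The letter `x'` is `x` with or without a bar put on it. -/
def Barred (x x' : Letter n) : Prop := x' = x ∨ x' = x.bar

theorem Letter.Below.of_barred {x y x' y' : Letter n} (h : Below x y) (hx : Barred x x')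
    (hy : Barred y y') : Below x' y' := by
  rcases hx with rfl | rfl <;> rcases hy with rfl | rfl
  · exact h
  · exact h.bar_right
  · exact h.bar_left
  · exact h.bar_left.bar_right

theorem q_lt_bar (l : Fin n) : (q l : Letter n) < (q l).bar := by
  simp [lt_iff_rank, rank]

/-- Bars can be put on the sequence of a commutator `[yx]a - a[yx]` led by `yxa`. -/
theorem comm_pair_mem_of_barred {a y : Letter n} {l : Fin n} (hx : Below (q l) y)
    (hy : y.base = y) (ha : a < y) (ha' : a.bar < y)
    (h : comm K a [y, q l] ∈ relSpan K (upto [y, q l, a])) {y' x' : Letter n}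
    (hy' : Barred y y') (hx' : Barred (q l) x') :
    comm K a [y', x'] ∈ relSpan K (upto [y', x', a]) := by
  have h1 : comm K a [y, x'] ∈ relSpan K (upto [y, x', a]) := by
    rcases hx' with rfl | rfl
    · exact h
    · exact comm_pair_bar_right hx ha ha' (q_lt_bar l) h
  rcases hy' with rfl | rfl
  · exact h1
  rcases y with m | m | b
  · have hlt := q_lt_bar m
    exact comm_pair_bar_left (hx.of_barred hx' (Or.inl rfl)) trivial (ha.trans hlt)
      (ha'.trans hlt) hlt h1
  · cases hy
  · exact h1

theorem comm_pair_mem_of_bracketFirst {a y : Letter n} {l : Fin n} (h : BracketFirst a [y, q l])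
    (hx : Below (q l) y) (ha : a < y) : comm K a [y, q l] ∈ relSpan K (upto [y, q l, a]) :=
  comm_mem_relSpan_of_bracketFirst h (wordLE_of_lt [] ha (by simp)) (wordLE_of_lt [] ha (by simp))
    (.refl _) (wordLE_of_lt [] hx.2.2.1 (by simp))

/-- The commutators `[yx]a - a[yx]`, with all placements of bars, are bounded by `yxa`. -/
theorem comm_pair_mem {a y : Letter n} {l : Fin n} (h : BracketFirst a [y, q l])
    {a' y' x' : Letter n} (ha' : Barred a a') (hy' : Barred y y') (hx' : Barred (q l) x') :
    comm K a' [y', x'] ∈ relSpan K (upto [y', x', a']) := by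
  have low : ∀ {a y : Letter n} {l : Fin n}, BracketFirst a [y, q l] → Below (q l) y →
      y.base = y → Below a y → ∀ {y' x' : Letter n}, Barred y y' → Barred (q l) x' →
      comm K a [y', x'] ∈ relSpan K (upto [y', x', a]) := fun h hx hy ha _ _ hy' hx' =>
    comm_pair_mem_of_barred hx hy ha.2.1 ha.2.2.1 (comm_pair_mem_of_bracketFirst h hx ha.2.1)
      hy' hx'
  have both : ∀ {a l : Fin n} {y : Letter n}, BracketFirst (q a) [y, q l] → a < l →
      Below (q l) y → y.base = y → ∀ {a' y' x' : Letter n}, Barred (q a) a' → Barred y y' →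
      Barred (q l) x' → comm K a' [y', x'] ∈ relSpan K (upto [y', x', a']) := by
    intro a l y h hal hx hy a' y' x' ha' hy' hx'
    have hal := Below.q_q hal
    have h1 := low h hx hy (hal.trans hx) hy' hx'
    rcases ha' with rfl | rfl
    · exact h1
    · exact comm_pair_bar_letter (hx.of_barred hx' hy') (hal.of_barred (Or.inl rfl) hx')
        (q_lt_bar a) h1
  have two : ∀ {a l : Fin n} {y : Letter n}, BracketFirst (q a) [y, q l] →
      BracketFirst (qb a) [y, q l] → Below (q a) y →
      Below (q l) y → y.base = y → ∀ {a' y' x' : Letter n}, Barred (q a) a' → Barred y y' →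
      Barred (q l) x' → comm K a' [y', x'] ∈ relSpan K (upto [y', x', a']) := by
    intro a l y h h' ha hx hy a' y' x' ha' hy' hx'
    rcases ha' with rfl | rfl
    · exact low h hx hy ha hy' hx'
    · exact low h' hx hy ha.bar_left hy' hx'
  have swap : ∀ {a : Fin n} {a' : Letter n}, Barred (qb a) a' → Barred (q a) a' := fun h => h.symm
  have basis : ∀ {b b' : Basis} {l : Fin n}, BracketFirst (e b) [e b', q l] →
      (e b : Letter n) < e b' → ∀ {a' y' x' : Letter n}, Barred (e b) a' → Barred (e b') y' →
      Barred (q l) x' → comm K a' [y', x'] ∈ relSpan K (upto [y', x', a']) := by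
    intro b b' l h hb a' y' x' ha' hy' hx'
    have : a' = e b := by rcases ha' with rfl | rfl <;> rfl
    subst this
    exact comm_pair_mem_of_barred (.q_e l b') rfl hb hb
      (comm_pair_mem_of_bracketFirst h (.q_e l b') hb) hy' hx'
  cases h with
  | b3_1 h1 h2 => exact both (.b3_1 h1 h2) h1 (.q_q h2) rfl ha' hy' hx'
  | b3_2 h1 h2 =>
    exact two (.b3_3 h1 h2) (.b3_2 h1 h2) (.q_q h2) (.q_q (h1.trans h2)) rfl (swap ha') hy' hx'
  | b3_3 h1 h2 =>
    exact two (.b3_3 h1 h2) (.b3_2 h1 h2) (.q_q h2) (.q_q (h1.trans h2)) rfl ha' hy' hx'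
  | b3_4 h1 => exact two (.b3_5 h1) (.b3_4 h1) (.q_q h1) (.q_q h1) rfl (swap ha') hy' hx'
  | b3_5 h1 => exact two (.b3_5 h1) (.b3_4 h1) (.q_q h1) (.q_q h1) rfl ha' hy' hx'
  | b3_6 b h1 => exact both (.b3_6 b h1) h1 (.q_e _ b) rfl ha' hy' hx'
  | b3_7 b h1 => exact two (.b3_7 b h1) (.b3_8 b h1) (.q_e _ b) (.q_e _ b) rfl ha' hy' hx'
  | b3_8 b h1 => exact two (.b3_7 b h1) (.b3_8 b h1) (.q_e _ b) (.q_e _ b) rfl (swap ha') hy' hx'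
  | b3_9 _ b => exact two (.b3_9 _ b) (.b3_10 _ b) (.q_e _ b) (.q_e _ b) rfl ha' hy' hx'
  | b3_10 _ b => exact two (.b3_9 _ b) (.b3_10 _ b) (.q_e _ b) (.q_e _ b) rfl (swap ha') hy' hx'
  | b3_11 => exact basis (.b3_11 _) (by simp [lt_iff_rank, rank]) ha' hy' hx'
  | b3_12 => exact basis (.b3_12 _) (by simp [lt_iff_rank, rank]) ha' hy' hx'
  | b3_13 => exact basis (.b3_13 _) (by simp [lt_iff_rank, rank]) ha' hy' hx'

/-- The commutators `y[yx] - [yx]y`, with all placements of bars. The leading word is `yyx`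
except for `y[ȳx] - [ȳx]y`, where it is `ȳxy`; both are included in the bound. -/
theorem comm_square_mem {l m : Fin n} (hlm : l < m) {y₁ y₂ x : Letter n} (hy₁ : Barred (q m) y₁)
    (hy₂ : Barred (q m) y₂) (hx : Barred (q l) x) {w : List (Letter n)}
    (h1 : WordLE [y₁, y₂, x] w) (h2 : WordLE [y₂, x, y₁] w) :
    comm K y₁ [y₂, x] ∈ relSpan K (upto w) := by
  have hb := Below.q_q hlm
  have hlt := q_lt_bar m
  have hlt' := q_lt_bar l
  have hbm : Barred (q m) (q m) := Or.inl rfl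
  have base : comm K (q m) [q m, q l] ∈ relSpan K (upto [q m, q m, q l]) :=
    comm_mem_relSpan_of_letterFirst (.c3 hlm) (.refl _) (wordLE_of_lt [q m] hb.2.2.1 (by simp))
      (wordLE_of_lt [q m] hb.2.1 (by simp)) (wordLE_of_lt [] hb.2.2.1 (by simp))
  have barx : ∀ x, Barred (q l) x → comm K (q m) [q m, x] ∈ relSpan K (upto [q m, q m, x]) := by
    rintro x (rfl | rfl)
    · exact base
    have e1 : comm K (q m) [q m, qb l] = -comm K (q m) [q m, q l] +
        (X (q m) * (X (q m) * tr K (q l) - tr K (q l) * X (q m)) -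
          (X (q m) * tr K (q l) - tr K (q l) * X (q m)) * X (q m) +
          (X (q m) * tr K (q l) - tr K (q l) * X (q m)) * tr K (q m) +
          tr K (q l) * (X (q m) * tr K (q m) - tr K (q m) * X (q m))) := by
      rw [comm, comm, bracket_pair, bracket_pair, tr_of_isVar (x := q l) trivial, tr_eq (q m)]
      simp only [conjLetter, bar_q]
      noncomm_ring
    have h := mul_tr_sub_mem_upto (K := K) hb
    rw [max_bar_of_lt hlt'] at h
    rw [bar_q] at *
    rw [e1]
    refine add_mem (neg_mem (relSpan_upto_mono (wordLE_of_lt [q m, q m] hlt' le_rfl) base))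
      (add_mem (add_mem (sub_mem ?_ ?_) ?_) ?_)
    · exact X_mul_mem_upto _ h
    · exact mul_hom_mem_upto [q m] h hb.2.2.1 (hom_X _) (by simp)
    · exact mul_hom_mem_upto [q m] h hb.2.2.1 (hom_tr _) (by simp)
    · exact tr_mul_mem_of_below (mul_tr_sub_mem_degLE _ _) hb (by simp)
  have bary₁ : comm K y₁ [q m, x] ∈ relSpan K (upto [y₁, q m, x]) := by
    rcases hy₁ with rfl | rfl
    · exact barx x hx
    have hb' : Below x (q m) := hb.of_barred hx hbm
    have e1 : comm K (qb m) [q m, x] = -comm K (q m) [q m, x] +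
        (-(X (q m) * X (q m).bar - X (q m).bar * X (q m)) * X x -
          X (q m) * (X x * tr K (q m) - tr K (q m) * X x) +
          (tr K (q m) * X x.bar - X x.bar * tr K (q m)) * X (qb m) -
          X x.bar * (X (qb m) * tr K (q m) - tr K (q m) * X (qb m))) := by
      rw [comm, comm, bracket_pair, tr_of_isVar (x := q m) trivial, conjLetter_of_isVar hb'.1]
      simp only [conjLetter, bar_q]
      noncomm_ring
    have h := mul_bar_sub_mem (K := K) (x := q m) trivial (w := [qb m, q m])
      (wordLE_of_lt [] hlt le_rfl) (.refl _)
    have h' := tr_mul_sub_mem (K := K) hb'.bar_left trivial (w := [qb m, x.bar])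
      (wordLE_of_lt [] hlt le_rfl) (.refl _)
    rw [bar_q] at *
    rw [e1]
    refine add_mem (neg_mem (relSpan_upto_mono (wordLE_of_lt [] hlt le_rfl) (barx x hx)))
      (sub_mem (add_mem (sub_mem ?_ ?_) ?_) ?_)
    · rw [neg_mul, neg_mem_iff]
      exact (mul_X_mem_upto x h :)
    · exact X_mul_mem_of_lt (mul_tr_sub_mem_degLE _ _) hlt (by simp)
    · exact mul_hom_mem_upto [qb m] h' hb'.2.2.1 (hom_X _) (by simp)
    · exact X_mul_mem_of_lt (mul_tr_sub_mem_degLE _ _) hb'.bar_right.2.2.1 (by simp)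
  rcases hy₂ with rfl | rfl
  · exact relSpan_upto_mono h1 bary₁
  have hb₁ : Below x y₁ := hb.of_barred hx hy₁
  have hb₂ : Below x (q m) := hb.of_barred hx hbm
  have e1 : comm K y₁ [qb m, x] = -comm K y₁ [q m, x] +
      (X y₁ * (tr K (q m) * X x - X x * tr K (q m)) -
        (tr K (q m) * X x - X x * tr K (q m)) * X y₁ +
        (X y₁ * tr K x - tr K x * X y₁) * tr K (q m) +
        tr K x * (X y₁ * tr K (q m) - tr K (q m) * X y₁)) := by
    rw [comm, comm, bracket_pair, bracket_pair, tr_of_isVar (x := q m) trivial, tr_eq x]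
    simp only [conjLetter, bar_q]
    noncomm_ring
  have h := tr_mul_sub_mem (K := K) hb₂ trivial (w := [qb m, x])
    (wordLE_of_lt [] hlt le_rfl) (.refl _)
  rw [bar_q] at *
  rw [e1]
  refine add_mem (neg_mem (relSpan_upto_mono (.trans (wordLE_of_lt [y₁] hlt le_rfl) h1) bary₁))
    (add_mem (add_mem (sub_mem ?_ ?_) ?_) ?_)
  · exact relSpan_upto_mono h1 (X_mul_mem_upto y₁ h :)
  · exact relSpan_upto_mono h2 (mul_X_mem_upto y₁ h :)
  · refine relSpan_upto_mono h1 (mul_hom_mem_upto [y₁] (mul_tr_sub_mem_upto hb₁) ?_ (hom_tr _)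
      (by simp))
    exact hb₂.bar_right.max_lt
  · exact relSpan_upto_mono h1 (tr_mul_mem_of_below (mul_tr_sub_mem_degLE _ _) hb₁ (by simp))

/-- The remaining commutators `z[yx] - [yx]z` of three distinct variables, obtained from the
other two by the Jacobi identity. -/
theorem comm_jacobi_mem {l m p : Fin n} (hlm : l < m) (hmp : m < p) {x y z : Letter n}
    (hx : Barred (q l) x) (hy : Barred (q m) y) (hz : Barred (q p) z) :
    comm K z [y, x] ∈ relSpan K (upto [z, y, x]) := by
  have hxy : Below x y := (Below.q_q hlm).of_barred hx hy
  have hyz : Below y z := (Below.q_q hmp).of_barred hy hz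
  have hxz := hxy.trans hyz
  have hzv : z.IsVar := by rcases hz with rfl | rfl <;> trivial
  have hx' : Barred (q l) x.bar := by rcases hx with rfl | rfl <;> simp [Barred]
  have hy' : Barred (q m) y.bar := by rcases hy with rfl | rfl <;> simp [Barred]
  have e1 : comm K z [y, x] = -comm K x [z, y] - comm K y.bar [z, x.bar] -
      X y.bar * (tr K z * X x - X x * tr K z) + X y.bar * (X z * tr K x - tr K x * X z) -
      X x * (tr K z * X y.bar - X y.bar * tr K z) + X x * (X z * tr K y - tr K y * X z) +
      (X x * tr K y - tr K y * X x) * X z + (X y.bar * tr K x - tr K x * X y.bar) * X z := by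
    rw [comm, comm, comm, bracket_pair, bracket_pair, bracket_pair, tr_of_isVar hxy.1,
      tr_of_isVar hyz.1, tr_of_isVar hzv, conjLetter_of_isVar hxy.1, conjLetter_of_isVar hyz.1,
      conjLetter_of_isVar hzv, conjLetter_of_isVar hxy.1.bar, bar_bar]
    noncomm_ring
  have hswap : ∀ a b : Letter n, tr K a * X b - X b * tr K a ∈ relSpan K (degLE n 2) := by
    intro a b
    rw [← neg_mem_iff, neg_sub]
    exact mul_tr_sub_mem_degLE b a
  rw [e1]
  refine add_mem (add_mem (add_mem (sub_mem (add_mem (sub_mem (sub_mem (neg_mem ?_) ?_) ?_) ?_) ?_)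
    ?_) ?_) ?_
  · exact comm_pair_mem (.b3_1 hlm hmp) hx hz hy
  · refine relSpan_upto_mono ?_ (comm_pair_mem (.b3_3 hlm hmp) hy' hz hx')
    exact wordLE_of_lt [z] hxy.2.2.1 le_rfl
  · exact X_mul_mem_of_lt (hswap _ _) hyz.2.2.1 (by simp)
  · exact X_mul_mem_of_lt (mul_tr_sub_mem_degLE _ _) hyz.2.2.1 (by simp)
  · exact X_mul_mem_of_lt (hswap _ _) hxz.2.1 (by simp)
  · exact X_mul_mem_of_lt (mul_tr_sub_mem_degLE _ _) hxz.2.1 (by simp)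
  · exact mul_tr_sub_mul_mem_of_below hxz.2.1 hxz.2.2.1 hyz (hom_X _) (by simp)
  · exact mul_tr_sub_mul_mem_of_below hyz.2.2.1 (by simpa using hyz.2.1) hxz (hom_X _) (by simp)

/-! ### Bars on the outer letters of a long commutator -/

/-- The commutator of `a` with the bracket of `y U x` is a combination of multiples of elements
of `BG` with words up to its leading word `a y U x`. -/
def Rel (K : Type*) [Field K] {n : ℕ} (a y : Letter n) (U : List (Letter n)) (x : Letter n) :
    Prop :=
  comm K a (y :: (U ++ [x])) ∈ relSpan K (upto (a :: y :: (U ++ [x])))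

theorem bracket_outer (y : Letter n) (U : List (Letter n)) (x : Letter n) :
    (bracket (word (y :: (U ++ [x]))) : Poly K n) =
      X y * word U * X x + conjLetter x * conj (word U) * conjLetter y := by
  simp [bracket, word_cons, word_append, word_nil, conj_mul, conj_X, mul_assoc]

theorem word_mul_tr_sub_mem {x : Letter n} {U : List (Letter n)} (hU : ∀ u ∈ U, Below x u)
    (hlt : x < x.bar) : word U * tr K x - tr K x * word U ∈ relSpan K (upto (U ++ [x.bar])) := by
  induction U with
  | nil => simp [word_nil]
  | cons u U ih =>
    have hu := hU u (by simp)
    have e1 : word (u :: U) * tr K x - tr K x * word (u :: U) =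
        X u * (word U * tr K x - tr K x * word U) + (X u * tr K x - tr K x * X u) * word U := by
      rw [word_cons]; noncomm_ring
    rw [e1]
    refine add_mem (X_mul_mem_upto u (ih fun v hv => hU v (by simp [hv]))) ?_
    have h := mul_tr_sub_mem_upto (K := K) hu
    rw [max_bar_of_lt hlt] at h
    refine relSpan_upto_mono (WordLE.cons u ?_) (mul_word_mem_upto U h :)
    cases U with
    | nil => exact .refl _
    | cons v V => exact wordLE_of_lt [] (hU v (by simp)).2.2.1 (by simp)

theorem Rel.bar_last (hK : ringChar K ≠ 2) {a y x : Letter n} {U : List (Letter n)}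
    (hxa : Below x a) (hya : Below y a) (hxy : Below x y) (hU : ∀ u ∈ U, Below x u)
    (hlt : x < x.bar) (h : Rel K a y U x) : Rel K a y U x.bar := by
  have e1 : comm K a (y :: (U ++ [x.bar])) = -comm K a (y :: (U ++ [x])) +
      (X a * (X y * (word U * tr K x - tr K x * word U)) +
        X a * ((X y * tr K x - tr K x * X y) * word U) +
        (X a * tr K x - tr K x * X a) * bracket (word (y :: U)) +
        tr K x * comm K a (y :: U) -
        X y * ((word U * tr K x - tr K x * word U) * X a) -
        (X y * tr K x - tr K x * X y) * (word U * X a)) := by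
    rw [comm, comm, comm, bracket_outer, bracket_outer, bracket, word_cons, conj_mul, conj_X,
      conjLetter_of_isVar hxa.1, conjLetter_of_isVar hxa.1.bar, bar_bar, tr_of_isVar hxa.1]
    noncomm_ring
  have hax := mul_tr_sub_mem_upto (K := K) hxa
  have hyx := mul_tr_sub_mem_upto (K := K) hxy
  have hUx := word_mul_tr_sub_mem (K := K) hU hlt
  rw [Rel, e1]
  refine add_mem (neg_mem (relSpan_upto_mono ?_ h)) (sub_mem (sub_mem (add_mem (add_mem (add_mem
    ?_ ?_) ?_) ?_) ?_) ?_)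
  · exact wordLE_of_lt (a :: y :: U) hlt le_rfl
  · exact X_mul_mem_upto a (X_mul_mem_upto y hUx :)
  · rw [max_bar_of_lt hlt] at hyx
    refine X_mul_mem_upto a (relSpan_upto_mono (WordLE.cons y ?_) (mul_word_mem_upto U hyx :))
    cases U with
    | nil => exact .refl _
    | cons v V => exact wordLE_of_lt [] (hU v (by simp)).2.2.1 (by simp)
  · exact mul_hom_mem_upto [a] hax hxy.max_lt (hom_bracket_word _) (by simp)
  · exact tr_mul_mem_of_below (comm_mem_degLE hK a (y :: U) rfl) hxa (by simp)
  · exact X_mul_mem_of_lt (mul_hom_mem_degLE (mul_tr_sub_tr_mul_mem_degLE (hom_word U) x rfl)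
      (hom_X a) le_rfl) hya.2.1 (by simp)
  · exact mul_hom_mem_upto [] hyx hya.2.1 (hom_mul (hom_word U) (hom_X a)) (by simp; omega)

theorem Rel.bar_first (hK : ringChar K ≠ 2) {a y x u : Letter n} {U : List (Letter n)}
    (hxa : Below x a) (hya : Below y a) (hxy : Below x y) (hu : Below x u)
    (hlt : y < y.bar) (h : Rel K a y (u :: U) x) : Rel K a y.bar (u :: U) x := by
  have e1 : comm K a (y.bar :: (u :: U ++ [x])) = -comm K a (y :: (u :: U ++ [x])) +
      (X a * (X x.bar * (conj (word (u :: U)) * tr K y - tr K y * conj (word (u :: U)))) -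
        X a * ((tr K y * X x.bar - X x.bar * tr K y) * conj (word (u :: U))) +
        (X a * tr K y - tr K y * X a) * word (u :: U ++ [x]) +
        (X a * tr K y - tr K y * X a) * X x.bar * conj (word (u :: U)) +
        tr K y * comm K a (u :: U ++ [x]) -
        X x.bar * ((conj (word (u :: U)) * tr K y - tr K y * conj (word (u :: U))) * X a) +
        (tr K y * X x.bar - X x.bar * tr K y) * (conj (word (u :: U)) * X a)) := by
    have e2 : (bracket (word (u :: U ++ [x])) : Poly K n) =
        word (u :: U) * X x + X x.bar * conj (word (u :: U)) := by
      rw [bracket, word_append, conj_mul, ← X_eq_word, conj_X, conjLetter_of_isVar hxa.1]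
    rw [comm, comm, comm, bracket_outer, bracket_outer, e2, word_append, ← X_eq_word,
      conjLetter_of_isVar hxa.1, conjLetter_of_isVar hya.1, conjLetter_of_isVar hya.1.bar, bar_bar,
      tr_of_isVar hya.1]
    noncomm_ring
  have hay := mul_tr_sub_mem_upto (K := K) hya
  rw [max_bar_of_lt hlt] at hay
  have hyx := tr_mul_sub_mem (K := K) hxy.bar_left hya.1 (w := [y.bar, x.bar])
    (wordLE_of_lt [] hlt le_rfl) (.refl _)
  have hUy := mul_tr_sub_tr_mul_mem_degLE (hom_conj_word (K := K) (u :: U)) y rfl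
  rw [Rel, e1]
  refine add_mem (neg_mem (relSpan_upto_mono ?_ h)) (add_mem (sub_mem (add_mem (add_mem (add_mem
    (sub_mem ?_ ?_) ?_) ?_) ?_) ?_) ?_)
  · exact wordLE_of_lt [a] hlt le_rfl
  · exact X_mul_mem_upto a (X_mul_mem_of_lt hUy hxy.bar_right.2.2.1 (by simp))
  · exact X_mul_mem_upto a (mul_hom_mem_upto [y.bar] hyx hu.2.2.1 (hom_conj_word _) (by simp))
  · exact (mul_word_mem_upto (u :: U ++ [x]) hay :)
  · exact mul_hom_mem_upto [a, y.bar] (mul_X_mem_upto x.bar hay) hu.2.2.1 (hom_conj_word _)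
      (by simp)
  · exact tr_mul_mem_of_below (comm_mem_degLE hK a _ rfl) hya (by simp)
  · exact X_mul_mem_of_lt (mul_hom_mem_degLE hUy (hom_X a) le_rfl) hxa.2.2.1 (by simp)
  · exact mul_hom_mem_upto [] hyx hya.2.2.1 (hom_mul (hom_conj_word _) (hom_X a))
      (by simp; omega)

theorem Rel.bar_letter {a y x : Letter n} {U : List (Letter n)} (ha : a.IsVar)
    (hxa : Below x a) (hya : Below y a) (hxy : Below x y)
    (hlt : a < a.bar) (h : Rel K a y U x) : Rel K a.bar y U x := by
  have e1 : comm K a.bar (y :: (U ++ [x])) = -comm K a (y :: (U ++ [x])) +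
      ((tr K a * X y - X y * tr K a) * word (U ++ [x]) +
        (tr K a * X x.bar - X x.bar * tr K a) * (conj (word U) * X y.bar) -
        X y * (word (U ++ [x]) * tr K a - tr K a * word (U ++ [x])) -
        X x.bar * (conj (word U) * X y.bar * tr K a - tr K a * (conj (word U) * X y.bar))) := by
    rw [comm, comm, bracket_outer, word_append, ← X_eq_word, conjLetter_of_isVar hxa.1,
      conjLetter_of_isVar hya.1, tr_of_isVar ha]
    noncomm_ring
  have h1 := tr_mul_sub_mem (K := K) hya ha (w := [a.bar, y])
    (wordLE_of_lt [] hlt le_rfl) (.refl _)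
  have h2 := tr_mul_sub_mem (K := K) hxa.bar_left ha (w := [a.bar, x.bar])
    (wordLE_of_lt [] hlt le_rfl) (.refl _)
  rw [Rel, e1]
  refine add_mem (neg_mem (relSpan_upto_mono ?_ h)) (sub_mem (sub_mem (add_mem ?_ ?_) ?_) ?_)
  · exact wordLE_of_lt [] hlt le_rfl
  · exact (mul_word_mem_upto (U ++ [x]) h1 :)
  · exact mul_hom_mem_upto [a.bar] h2 hxy.2.2.1 (hom_mul (hom_conj_word _) (hom_X _)) (by simp)
  · exact X_mul_mem_of_lt (mul_tr_sub_tr_mul_mem_degLE (hom_word _) a rfl) hya.bar_right.2.1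
      (by simp)
  · exact X_mul_mem_of_lt (mul_tr_sub_tr_mul_mem_degLE (hom_mul (hom_conj_word _) (hom_X _)) a rfl)
      hxa.bar_right.2.2.1 (by simp)

/-! ### Commutators with a sorted sequence of inner letters -/

theorem mul_bar_sub_mem_degLE {w : Letter n} (hw : w.IsVar) :
    (X w * X w.bar - X w.bar * X w : Poly K n) ∈ relSpan K (degLE n 2) := by
  convert mul_tr_sub_mem_degLE (K := K) w w using 1
  rw [tr_of_isVar hw]
  noncomm_ring

/-- Two equal inner letters before the last letter `x`: since `w² = [w]w - w̄w`, they can be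
traded for central factors, and the words that occur do not exceed `wwx`. -/
theorem sq_mul_sub_mem {l m : Fin n} (hlm : l < m) {w x : Letter n} (hw : Barred (q m) w)
    (hx : Barred (q l) x) :
    X w * X w * X x - X w * X x * tr K w + X x * (X w * X w.bar) ∈
      relSpan K (upto [w, w, x]) := by
  have hxw : Below x w := (Below.q_q hlm).of_barred hx hw
  have hwv : w.IsVar := by rcases hw with rfl | rfl <;> trivial
  have e1 : X w * X w * X x - X w * X x * tr K w + X x * (X w * X w.bar) =
      comm K w [w, x] - (X w * tr K x - tr K x * X w) * X w.bar -
        X x.bar * (X w * X w.bar - X w.bar * X w) := by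
    rw [comm, bracket_pair, tr_of_isVar hwv, tr_of_isVar hxw.1, conjLetter_of_isVar hxw.1,
      conjLetter_of_isVar hwv]
    noncomm_ring
  rw [e1]
  refine sub_mem (sub_mem ?_ ?_) ?_
  · exact comm_square_mem hlm hw hw hx (.refl _) (wordLE_of_lt [w] hxw.2.1 (by simp))
  · exact mul_hom_mem_upto [w] (mul_tr_sub_mem_upto hxw) hxw.max_lt (hom_X _) (by simp)
  · exact X_mul_mem_of_lt (mul_bar_sub_mem_degLE hwv) hxw.2.2.1 (by simp)

theorem norm_mul_sub_mem {l m : Fin n} (hlm : l < m) {x : Letter n} (hx : Barred (q l) x) :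
    X (q m) * X (qb m) * X x - X x * (X (q m) * X (qb m)) ∈
      relSpan K (upto [q m, qb m, x]) := by
  have hxw : Below x (q m) := (Below.q_q hlm).of_barred hx (Or.inl rfl)
  have hlt := q_lt_bar m
  have e1 : X (q m) * X (qb m) * X x - X x * (X (q m) * X (qb m)) =
      X (q m) * (tr K (q m) * X x - X x * tr K (q m)) -
        (X (q m) * X (q m) * X x - X (q m) * X x * tr K (q m) +
          X x * (X (q m) * X (qb m))) := by
    rw [tr_of_isVar (x := q m) trivial, bar_q]
    noncomm_ring
  rw [e1]
  refine sub_mem (X_mul_mem_upto (q m) (w := [qb m, x]) ?_) (relSpan_upto_mono ?_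
    (sq_mul_sub_mem hlm (Or.inl rfl) hx))
  · exact tr_mul_sub_mem hxw trivial (wordLE_of_lt [] hlt le_rfl) (.refl _)
  · exact wordLE_of_lt [q m] hlt le_rfl

section Central

variable {w : Letter n} {d : ℕ} {G : Poly K n}

theorem norm_commute_mem (hK : ringChar K ≠ 2) (hw : w.IsVar) (hG : G ∈ wordSpan K (degEq n d)) :
    X w * X w.bar * G - G * (X w * X w.bar) ∈ relSpan K (degLE n (d + 2)) := by
  rw [← neg_mem_iff, neg_sub]
  exact mul_sub_mul_mem_degLE hG (hom_mul (hom_X w) (hom_X _)) (proj_norm_mem_center hK hw) rfl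

theorem sq_relation_mem (hK : ringChar K ≠ 2) (hw : w.IsVar) (hG : G ∈ wordSpan K (degEq n d)) :
    X w * X w * G - X w * G * tr K w + G * (X w * X w.bar) ∈ relSpan K (degLE n (d + 2)) := by
  have e1 : X w * X w * G - X w * G * tr K w + G * (X w * X w.bar) =
      -(X w * (G * tr K w - tr K w * G)) - (X w * X w.bar * G - G * (X w * X w.bar)) := by
    rw [tr_of_isVar hw]; noncomm_ring
  rw [e1]
  refine sub_mem (neg_mem ?_) (norm_commute_mem hK hw hG)
  exact hom_mul_mem_degLE (hom_X w) (mul_tr_sub_tr_mul_mem_degLE hG w rfl) (by omega)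

theorem sq_bar_relation_mem (hK : ringChar K ≠ 2) (hw : w.IsVar)
    (hG : G ∈ wordSpan K (degEq n d)) :
    X w.bar * X w.bar * G - X w.bar * G * tr K w + G * (X w * X w.bar) ∈
      relSpan K (degLE n (d + 2)) := by
  have e1 : X w.bar * X w.bar * G - X w.bar * G * tr K w + G * (X w * X w.bar) =
      -(X w.bar * (G * tr K w - tr K w * G)) - (X w * X w.bar * G - G * (X w * X w.bar)) +
        (X w * X w.bar - X w.bar * X w) * G := by
    rw [tr_of_isVar hw]; noncomm_ring
  rw [e1]
  refine add_mem (sub_mem (neg_mem ?_) (norm_commute_mem hK hw hG)) ?_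
  · exact hom_mul_mem_degLE (hom_X _) (mul_tr_sub_tr_mul_mem_degLE hG w rfl) (by omega)
  · exact mul_hom_mem_degLE (mul_bar_sub_mem_degLE hw) hG (by omega)

end Central

theorem conj_word_append (U V : List (Letter n)) :
    conj (word (U ++ V) : Poly K n) = conj (word V) * conj (word U) := by
  rw [word_append, conj_mul]

theorem conj_word_pair {w v : Letter n} (hw : w.IsVar) (hv : v.IsVar) :
    conj (word [w, v] : Poly K n) = X v.bar * X w.bar := by
  rw [word_cons, conj_mul, ← X_eq_word, conj_X, conj_X, conjLetter_of_isVar hw,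
    conjLetter_of_isVar hv]

theorem word_pair (w v : Letter n) : (word [w, v] : Poly K n) = X w * X v := by
  rw [word_cons, ← X_eq_word]

/-- The inner letters `w w` can be appended, by `w² = [w]w - w̄w`, if `w` and nothing at all can. -/
theorem Rel.append_sq (hK : ringChar K ≠ 2) {l m : Fin n} (hlm : l < m) {a y w x : Letter n}
    (hw : Barred (q m) w) (hx : Barred (q l) x) {A : List (Letter n)}
    (hxa : Below x a) (hya : Below y a) (hxy : Below x y)
    (h1 : Rel K a y (A ++ [w]) x) (h0 : Rel K a y A x) : Rel K a y (A ++ [w, w]) x := by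
  have hwv : w.IsVar := by rcases hw with rfl | rfl <;> trivial
  have hxw : Below x w := (Below.q_q hlm).of_barred hx hw
  have e1 : comm K a (y :: (A ++ [w, w] ++ [x])) =
      comm K a (y :: (A ++ [w] ++ [x])) * tr K w - comm K a (y :: (A ++ [x])) * (X w * X w.bar) +
      X a * (X y * (word A * (X w * X w * X x - X w * X x * tr K w + X x * (X w * X w.bar)))) +
      X a * (X x.bar * (X w.bar * X w.bar * (conj (word A) * X y.bar) -
        X w.bar * (conj (word A) * X y.bar) * tr K w +
        conj (word A) * X y.bar * (X w * X w.bar))) -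
      X y * (word A * (X w * X w * (X x * X a) - X w * (X x * X a) * tr K w +
        X x * X a * (X w * X w.bar))) -
      X x.bar * (X w.bar * X w.bar * (conj (word A) * X y.bar * X a) -
        X w.bar * (conj (word A) * X y.bar * X a) * tr K w +
        conj (word A) * X y.bar * X a * (X w * X w.bar)) := by
    rw [comm, comm, comm, bracket_outer, bracket_outer, bracket_outer, word_append, word_append,
      conj_mul, conj_mul, conj_word_pair hwv hwv, word_pair, ← X_eq_word, conj_X,
      conjLetter_of_isVar hxa.1, conjLetter_of_isVar hya.1, conjLetter_of_isVar hwv]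
    noncomm_ring
  have hG := hom_mul (hom_conj_word (K := K) A) (hom_X y.bar)
  rw [Rel, e1]
  refine sub_mem (sub_mem (add_mem (add_mem (sub_mem ?_ ?_) ?_) ?_) ?_) ?_
  · have := mul_hom_mem_upto (a :: y :: (A ++ [w])) (v := []) (w := [x]) (by simpa [Rel] using h1)
      hxw.2.1 (hom_tr w) (by simp)
    simpa using this
  · have := mul_hom_mem_upto (a :: y :: A) (v := []) (w := [w, x]) h0 hxw.2.1
      (hom_mul (hom_X w) (hom_X w.bar)) (by simp)
    simpa using this
  · have := X_mul_mem_upto a (X_mul_mem_upto y (word_mul_mem_upto A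
      (sq_mul_sub_mem (K := K) hlm hw hx)))
    simpa using this
  · exact X_mul_mem_upto a (X_mul_mem_of_lt (sq_bar_relation_mem hK hwv hG) hxy.2.2.1 (by simp))
  · exact X_mul_mem_of_lt (hom_mul_mem_degLE (hom_word A)
      (sq_relation_mem hK hwv (hom_mul (hom_X x) (hom_X a))) le_rfl) hya.2.1 (by simp)
  · exact X_mul_mem_of_lt (sq_bar_relation_mem hK hwv (hom_mul hG (hom_X a))) hxa.2.2.1 (by simp)

/-- The inner letters `q q̄` can be appended, because `q q̄` is central up to smaller words. -/
theorem Rel.append_norm (hK : ringChar K ≠ 2) {l m : Fin n} (hlm : l < m) {a y x : Letter n}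
    (hx : Barred (q l) x) {A : List (Letter n)} (hxa : Below x a) (hya : Below y a)
    (hxy : Below x y) (h0 : Rel K a y A x) : Rel K a y (A ++ [q m, qb m]) x := by
  have hxw : Below x (q m) := (Below.q_q hlm).of_barred hx (Or.inl rfl)
  have e1 : comm K a (y :: (A ++ [q m, qb m] ++ [x])) =
      comm K a (y :: (A ++ [x])) * (X (q m) * X (qb m)) +
      X a * (X y * (word A * (X (q m) * X (qb m) * X x - X x * (X (q m) * X (qb m))))) +
      X a * (X x.bar * (X (q m) * X (qb m) * (conj (word A) * X y.bar) -
        conj (word A) * X y.bar * (X (q m) * X (qb m)))) -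
      X y * (word A * (X (q m) * X (qb m) * (X x * X a) - X x * X a * (X (q m) * X (qb m)))) -
      X x.bar * (X (q m) * X (qb m) * (conj (word A) * X y.bar * X a) -
        conj (word A) * X y.bar * X a * (X (q m) * X (qb m))) := by
    rw [comm, comm, bracket_outer, bracket_outer, word_append, conj_mul,
      conj_word_pair (w := q m) (v := qb m) trivial trivial, word_pair,
      conjLetter_of_isVar hxa.1, conjLetter_of_isVar hya.1]
    simp only [bar]
    noncomm_ring
  have hG := hom_mul (hom_conj_word (K := K) A) (hom_X y.bar)
  have hwv : (q m : Letter n).IsVar := trivial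
  rw [Rel, e1]
  refine sub_mem (sub_mem (add_mem (add_mem ?_ ?_) ?_) ?_) ?_
  · have := mul_hom_mem_upto (a :: y :: A) (v := []) (w := [qb m, x]) h0 hxw.2.1
      (hom_mul (hom_X (q m)) (hom_X (qb m))) (by simp)
    simpa using this
  · have := X_mul_mem_upto a (X_mul_mem_upto y (word_mul_mem_upto A
      (norm_mul_sub_mem (K := K) hlm hx)))
    simpa using this
  · exact X_mul_mem_upto a (X_mul_mem_of_lt (norm_commute_mem hK hwv hG) hxy.2.2.1 (by simp))
  · exact X_mul_mem_of_lt (hom_mul_mem_degLE (hom_word A)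
      (norm_commute_mem hK hwv (hom_mul (hom_X x) (hom_X a))) le_rfl) hya.2.1 (by simp)
  · exact X_mul_mem_of_lt (norm_commute_mem hK hwv (hom_mul hG (hom_X a))) hxa.2.2.1 (by simp)

/-- A bar can be put on the last inner letter. -/
theorem Rel.bar_inner {a y w x : Letter n} {A : List (Letter n)} (hw : w.IsVar)
    (hxw : Below x w) (hlt : w < w.bar) (hxa : Below x a) (hya : Below y a) (hxy : Below x y)
    (h1 : Rel K a y (A ++ [w]) x) (h0 : Rel K a y A x) : Rel K a y (A ++ [w.bar]) x := by
  have e1 : comm K a (y :: (A ++ [w.bar] ++ [x])) = -comm K a (y :: (A ++ [w] ++ [x])) +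
      (X a * (X y * (word A * (tr K w * X x - X x * tr K w))) -
        X a * (X x.bar * (conj (word A) * X y.bar * tr K w - tr K w * (conj (word A) * X y.bar))) +
        comm K a (y :: (A ++ [x])) * tr K w +
        X y * (word A * X x * (X a * tr K w - tr K w * X a)) +
        X x.bar * (conj (word A) * X y.bar * (X a * tr K w - tr K w * X a)) +
        X y * (word A * ((X x * tr K w - tr K w * X x) * X a)) +
        X x.bar * ((conj (word A) * X y.bar * tr K w - tr K w * (conj (word A) * X y.bar)) *
          X a)) := by
    rw [comm, comm, comm, bracket_outer, bracket_outer, bracket_outer, word_append, word_append,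
      conj_mul, conj_mul, ← X_eq_word, ← X_eq_word, conj_X, conj_X, conjLetter_of_isVar hxa.1,
      conjLetter_of_isVar hya.1, conjLetter_of_isVar hw, conjLetter_of_isVar hw.bar, bar_bar,
      tr_of_isVar hw]
    noncomm_ring
  have hG := hom_mul (hom_conj_word (K := K) A) (hom_X y.bar)
  have hwx := tr_mul_sub_mem (K := K) hxw hw (w := [w.bar, x])
    (wordLE_of_lt [] hlt le_rfl) (.refl _)
  rw [Rel, e1]
  refine add_mem (neg_mem (relSpan_upto_mono ?_ h1)) (add_mem (add_mem (add_mem (add_mem (add_mem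
    (sub_mem ?_ ?_) ?_) ?_) ?_) ?_) ?_)
  · have := wordLE_of_lt (a :: y :: A) (v := [x]) (w := [x]) hlt le_rfl
    simpa using this
  · have := X_mul_mem_upto a (X_mul_mem_upto y (word_mul_mem_upto A hwx))
    simpa using this
  · exact X_mul_mem_upto a (X_mul_mem_of_lt (mul_tr_sub_tr_mul_mem_degLE hG w rfl) hxy.2.2.1
      (by simp))
  · have := mul_hom_mem_upto (a :: y :: A) (v := []) (w := [x]) h0 hxw.bar_right.2.1
      (hom_tr w) (by simp)
    simpa using this
  · exact X_mul_mem_of_lt (hom_mul_mem_degLE (hom_mul (hom_word A) (hom_X x))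
      (mul_tr_sub_mem_degLE a w) le_rfl) hya.2.1 (by simp)
  · exact X_mul_mem_of_lt (hom_mul_mem_degLE hG (mul_tr_sub_mem_degLE a w) le_rfl) hxa.2.2.1
      (by simp)
  · exact X_mul_mem_of_lt (hom_mul_mem_degLE (hom_word A)
      (mul_hom_mem_degLE (mul_tr_sub_mem_degLE x w) (hom_X a) le_rfl) le_rfl) hya.2.1 (by simp)
  · exact X_mul_mem_of_lt (mul_hom_mem_degLE (mul_tr_sub_tr_mul_mem_degLE hG w rfl) (hom_X a)
      le_rfl) hxa.2.2.1 (by simp)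

/-- Adjacent inner letters `q q̄` can be interchanged. -/
theorem Rel.swap {m : Fin n} {a y x : Letter n} {B D : List (Letter n)}
    (hxa : Below x a) (hya : Below y a) (hxy : Below x y)
    (h : Rel K a y (B ++ [q m, qb m] ++ D) x) : Rel K a y (B ++ [qb m, q m] ++ D) x := by
  have e1 : comm K a (y :: (B ++ [qb m, q m] ++ D ++ [x])) =
      comm K a (y :: (B ++ [q m, qb m] ++ D ++ [x])) -
      X a * (X y * (word B * ((X (q m) * X (q m).bar - X (q m).bar * X (q m)) *
        word (D ++ [x])))) -
      X a * (X x.bar * (conj (word D) * ((X (q m) * X (q m).bar - X (q m).bar * X (q m)) *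
        (conj (word B) * X y.bar)))) +
      X y * (word B * ((X (q m) * X (q m).bar - X (q m).bar * X (q m)) *
        (word (D ++ [x]) * X a))) +
      X x.bar * (conj (word D) * ((X (q m) * X (q m).bar - X (q m).bar * X (q m)) *
        (conj (word B) * X y.bar * X a))) := by
    have hw : ∀ u v : Letter n, (word (B ++ [u, v] ++ D) : Poly K n) =
        word B * (X u * X v) * word D := fun u v => by
      rw [word_append, word_append, word_pair]
    have hc : ∀ {u v : Letter n}, u.IsVar → v.IsVar →
        (conj (word (B ++ [u, v] ++ D)) : Poly K n) =
          conj (word D) * (X v.bar * X u.bar) * conj (word B) := fun hu hv => by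
      rw [conj_word_append, conj_word_append, conj_word_pair hu hv]
      simp only [mul_assoc]
    rw [comm, comm, bracket_outer, bracket_outer,
      hc (u := q m) (v := qb m) trivial trivial, hc (u := qb m) (v := q m) trivial trivial, hw, hw,
      conjLetter_of_isVar hxa.1, conjLetter_of_isVar hya.1, word_append, ← X_eq_word, bar_q, bar_qb]
    noncomm_ring
  have hlt := q_lt_bar m
  have hm := mul_bar_sub_mem_degLE (K := K) (w := q m) trivial
  have hm' := mul_bar_sub_mem (K := K) (x := q m) trivial (w := [qb m, q m])
    (wordLE_of_lt [] hlt le_rfl) (.refl _)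
  rw [Rel, e1]
  refine add_mem (add_mem (sub_mem (sub_mem ?_ ?_) ?_) ?_) ?_
  · refine relSpan_upto_mono ?_ h
    have := wordLE_of_lt (a :: y :: B) (v := qb m :: (D ++ [x])) (w := q m :: (D ++ [x])) hlt
      (by simp)
    simpa using this
  · have := X_mul_mem_upto a (X_mul_mem_upto y (word_mul_mem_upto B
      (mul_word_mem_upto (D ++ [x]) hm')))
    simpa using this
  · exact X_mul_mem_upto a (X_mul_mem_of_lt (hom_mul_mem_degLE (hom_conj_word D)
      (mul_hom_mem_degLE hm (hom_mul (hom_conj_word B) (hom_X _)) le_rfl) le_rfl) hxy.2.2.1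
      (by simp; omega))
  · exact X_mul_mem_of_lt (hom_mul_mem_degLE (hom_word B)
      (mul_hom_mem_degLE hm (hom_mul (hom_word _) (hom_X _)) le_rfl) le_rfl) hya.2.1
      (by simp; omega)
  · exact X_mul_mem_of_lt (hom_mul_mem_degLE (hom_conj_word D)
      (mul_hom_mem_degLE hm (hom_mul (hom_mul (hom_conj_word B) (hom_X _)) (hom_X a)) le_rfl)
      le_rfl) hxa.2.2.1 (by simp; omega)

/-! ### All placements of bars in a long commutator -/

theorem Rel.of_letterFirst {a y x : Letter n} {U : List (Letter n)}
    (hxa : Below x a) (hya : Below y a) (hxy : Below x y)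
    (h : LetterFirst a (y :: (U ++ [x]))) : Rel K a y U x := by
  refine comm_mem_relSpan_of_letterFirst h (.refl _) ?_ ?_ ?_
  · have := wordLE_of_lt [a] (v := (U.map bar).reverse ++ [y.bar]) (w := U ++ [x]) hxy.2.2.1
      (by simp)
    simpa [upto] using this
  · have := wordLE_of_lt [] (v := U ++ [x, a]) (w := y :: (U ++ [x])) hya.2.1 (by simp)
    simpa [upto] using this
  · have := wordLE_of_lt [] (v := (U.map bar).reverse ++ [y.bar, a]) (w := y :: (U ++ [x]))
      hxa.2.2.1 (by simp)
    simpa [upto] using this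

/-- Bars can be put on the letter and on the outer letters of the sequence. -/
theorem Rel.bar_outer (hK : ringChar K ≠ 2) {l₁ l₂ : Fin n} {a : Letter n} (h12 : l₁ < l₂)
    (h2a : Below (q l₂) a) (ha : a.base = a) {U : List (Letter n)} (hU : U ≠ [])
    (hlU : ∀ v ∈ U, Below (q l₁) v) (h : Rel K a (q l₂) U (q l₁)) {a' y x : Letter n}
    (ha' : Barred a a') (hy : Barred (q l₂) y) (hx : Barred (q l₁) x) : Rel K a' y U x := by
  obtain ⟨u, U, rfl⟩ := List.exists_cons_of_ne_nil hU
  have hxy := Below.q_q h12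
  have hb : ∀ z : Letter n, Barred z z := fun z => Or.inl rfl
  have h1 : Rel K a (q l₂) (u :: U) x := by
    rcases hx with rfl | rfl
    · exact h
    · exact h.bar_last hK (hxy.trans h2a) h2a hxy hlU (q_lt_bar l₁)
  have h2 : Rel K a y (u :: U) x := by
    rcases hy with rfl | rfl
    · exact h1
    · exact h1.bar_first hK ((hxy.trans h2a).of_barred hx (hb a)) h2a (hxy.of_barred hx (hb _))
        ((hlU u (by simp)).of_barred hx (hb _)) (q_lt_bar l₂)
  rcases ha' with rfl | rfl
  · exact h2
  rcases a with m | m | b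
  · exact h2.bar_letter trivial ((hxy.trans h2a).of_barred hx (hb _)) (h2a.of_barred hy (hb _))
      (hxy.of_barred hx hy) (q_lt_bar m)
  · cases ha
  · exact h2

theorem Letter.IsVar.exists_barred {u : Letter n} (h : u.IsVar) : ∃ m, Barred (q m) u := by
  rcases u with m | m | b
  · exact ⟨m, Or.inl rfl⟩
  · exact ⟨m, Or.inr rfl⟩
  · exact h.elim

theorem le_of_q_le {l m : Fin n} {u : Letter n} (hu : Barred (q m) u) (h : q l ≤ u) : l ≤ m := by
  rcases hu with rfl | rfl <;> simp only [le_iff_rank, rank, bar] at h <;>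
    exact Fin.le_def.2 (by omega)

theorem barred_of_le_of_le {m : Fin n} {w u : Letter n} (hu : Barred (q m) u) (h : q m ≤ w)
    (h' : w ≤ u) : Barred (q m) w := by
  have h'' : w ≤ qb m := by
    rcases hu with rfl | rfl
    · exact h'.trans (q_lt_bar m).le
    · exact h'
  have := m.2
  rcases w with p | p | b
  · simp only [le_iff_rank, rank] at h h''
    obtain rfl : p = m := Fin.ext (by omega)
    exact Or.inl rfl
  · simp only [le_iff_rank, rank] at h h''
    obtain rfl : p = m := Fin.ext (by omega)
    exact Or.inr rfl
  · exfalso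
    cases b <;> simp only [le_iff_rank, rank] at h h'' <;> omega

/-- The commutators of a variable with a bracket whose inner letters are sorted. `BG` provides
those whose last inner letter is unbarred and larger than the inner letters before it; an inner
sequence ending in `w w` or in `q q̄` is shortened by means of the centrality of `[w]` and
`w w̄`. -/
theorem rel_of_sorted (hK : ringChar K ≠ 2) {l₁ l₂ l₃ : Fin n} (h12 : l₁ < l₂) (h23 : l₂ < l₃)
    {a y x : Letter n} (ha : Barred (q l₃) a) (hy : Barred (q l₂) y) (hx : Barred (q l₁) x)
    {A : List (Letter n)} (hA : ∀ u ∈ A, u.IsVar ∧ q l₃ ≤ u) (hs : A.Pairwise (· ≤ ·)) :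
    Rel K a y A x := by
  have hxy : Below x y := (Below.q_q h12).of_barred hx hy
  have hya : Below y a := (Below.q_q h23).of_barred hy ha
  have hxa := hxy.trans hya
  induction hN : A.length using Nat.strong_induction_on generalizing A with
  | _ N ih =>
    rcases List.eq_nil_or_concat A with rfl | ⟨A₀, u, rfl⟩
    · exact comm_jacobi_mem h12 h23 hx hy ha
    rw [List.concat_eq_append] at *
    rw [List.pairwise_append] at hs
    have hA₀ : ∀ v ∈ A₀, v.IsVar ∧ q l₃ ≤ v := fun v hv => hA v (by simp [hv])
    obtain ⟨huv, hu3⟩ := hA u (by simp)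
    obtain ⟨m, hm⟩ := huv.exists_barred
    have h3m := le_of_q_le hm hu3
    have h1m : l₁ < m := (h12.trans h23).trans_le h3m
    have hxm : Below x (q m) := (Below.q_q h1m).of_barred hx (Or.inl rfl)
    have r₀ : Rel K a y A₀ x := ih A₀.length (by simp at hN; omega) hA₀ hs.1 rfl
    by_cases hall : ∀ v ∈ A₀, v < q m
    · have r₁ : Rel K a y (A₀ ++ [q m]) x := by
        have hl : LetterFirst (q l₃) (q l₂ :: (A₀ ++ [q m] ++ [q l₁])) := by
          rcases A₀ with _ | ⟨c, A₀⟩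
          · rcases h3m.eq_or_lt with rfl | h
            · exact .d4_323 h12 h23
            · exact .d4_324 h12 h23 h
          · rw [List.append_assoc]
            exact .dm_var _ h12 h23 (by simp)
              (fun v hv => ⟨(hA₀ v hv).1, (hA₀ v hv).2, hall v hv⟩) hs.1
        refine (Rel.of_letterFirst (.q_q (h12.trans h23)) (.q_q h23) (.q_q h12) hl).bar_outer hK h12
          (.q_q h23) rfl (by simp) ?_ ha hy hx
        intro v hv
        rcases List.mem_append.1 hv with hv | hv
        · obtain ⟨p, hp⟩ := (hA₀ v hv).1.exists_barred
          exact (Below.q_q ((h12.trans h23).trans_le (le_of_q_le hp (hA₀ v hv).2))).of_barred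
            (Or.inl rfl) hp
        · rw [List.mem_singleton.1 hv]
          exact .q_q h1m
      rcases hm with rfl | rfl
      · exact r₁
      · exact r₁.bar_inner trivial hxm (q_lt_bar m) hxa hya hxy r₀
    · push Not at hall
      obtain ⟨v, hv, hmv⟩ := hall
      rcases List.eq_nil_or_concat A₀ with rfl | ⟨A₁, w, rfl⟩
      · simp at hv
      rw [List.concat_eq_append] at *
      have hwu : w ≤ u := hs.2.2 w (by simp) u (by simp)
      have hs₁ := List.pairwise_append.1 hs.1
      have hvw : v ≤ w := by
        rcases List.mem_append.1 hv with hv | hv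
        · exact hs₁.2.2 v hv w (by simp)
        · exact (List.mem_singleton.1 hv).le
      have r₁ : Rel K a y A₁ x := ih A₁.length (by simp at hN; omega)
        (fun v hv => hA₀ v (by simp [hv])) hs₁.1 rfl
      have hw := barred_of_le_of_le hm (hmv.trans hvw) hwu
      rw [List.append_assoc]
      rcases hm with rfl | rfl <;> rcases hw with rfl | rfl
      · exact r₀.append_sq hK h1m (Or.inl rfl) hx hxa hya hxy r₁
      · exact absurd (q_lt_bar m) hwu.not_gt
      · exact Rel.append_norm hK h1m hx hxa hya hxy r₁
      · exact r₀.append_sq hK h1m (Or.inr rfl) hx hxa hya hxy r₁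

/-! ### Sorting the inner letters -/

theorem base_le (x : Letter n) : x.base ≤ x := by
  cases x
  · exact le_rfl
  · exact (q_lt_bar _).le
  · exact le_rfl

theorem eq_of_base_le {x y : Letter n} (h : x.base ≤ y.base) (h' : y < x) :
    ∃ l, x = qb l ∧ y = q l := by
  rcases x with l | l | b
  · exact absurd (h.trans (base_le y)) h'.not_ge
  · obtain hm : Barred (q l) y := barred_of_le_of_le (Or.inr rfl) (h.trans (base_le y)) h'.le
    rcases hm with rfl | rfl
    · exact ⟨l, rfl, rfl⟩
    · exact absurd h' (lt_irrefl _)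
  · exact absurd (h.trans (base_le y)) h'.not_ge

/-- Insertion of a single letter into a sorted sequence. -/
theorem of_sorted_of_swap_cons {P : List (Letter n) → Prop}
    (hswap : ∀ B D m, P (B ++ [q m, qb m] ++ D) → P (B ++ [qb m, q m] ++ D))
    {R : List (Letter n)} {x : Letter n} {S pre : List (Letter n)}
    (hb : ((x :: S).map base).Pairwise (· ≤ ·)) (hs : S.Pairwise (· ≤ ·))
    (h : ∀ S', S'.Pairwise (· ≤ ·) → S'.map base = (x :: S).map base → P (pre ++ S' ++ R)) :
    P (pre ++ x :: S ++ R) := by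
  induction S generalizing pre x with
  | nil => exact h [x] (by simp) rfl
  | cons y S ih =>
    by_cases hxy : x ≤ y
    · refine h _ (List.pairwise_cons.2 ⟨?_, hs⟩) rfl
      rintro z hz
      rcases List.mem_cons.1 hz with rfl | hz
      · exact hxy
      · exact hxy.trans ((List.pairwise_cons.1 hs).1 z hz)
    · rw [List.map_cons, List.map_cons, List.pairwise_cons] at hb
      obtain ⟨l, rfl, rfl⟩ := eq_of_base_le (hb.1 y.base (by simp)) (not_le.1 hxy)
      have := hswap pre (S ++ R) l
      simp only [List.append_assoc, List.cons_append, List.nil_append] at this ⊢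
      apply this
      have := ih (x := qb l) (pre := pre ++ [q l]) hb.2 (List.pairwise_cons.1 hs).2 ?_
      · simpa using this
      · intro S' hS' hbS'
        have := h (q l :: S') (List.pairwise_cons.2 ⟨?_, hS'⟩) (by simpa [base] using hbS')
        · simpa using this
        · intro z hz
          refine le_trans ?_ (base_le z)
          have hz' : z.base ∈ S'.map base := List.mem_map_of_mem hz
          rw [hbS'] at hz'
          rcases List.mem_cons.1 hz' with hz' | hz'
          · exact hz'.ge
          · exact (List.pairwise_cons.1 hb.2).1 _ hz'

/-- A property of words that is inherited under `q q̄ ↦ q̄ q` holds as soon as it holds after the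
barred and unbarred copies of each variable have been sorted. -/
theorem of_sorted_of_swap {P : List (Letter n) → Prop}
    (hswap : ∀ B D m, P (B ++ [q m, qb m] ++ D) → P (B ++ [qb m, q m] ++ D))
    {R : List (Letter n)} {A pre : List (Letter n)}
    (hb : (A.map base).Pairwise (· ≤ ·))
    (h : ∀ S, S.Pairwise (· ≤ ·) → S.map base = A.map base → P (pre ++ S ++ R)) :
    P (pre ++ A ++ R) := by
  induction A generalizing pre with
  | nil => exact h [] List.Pairwise.nil rfl
  | cons x A ih =>
    have := ih (pre := pre ++ [x]) (List.pairwise_cons.1 hb).2 ?_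
    · simpa using this
    · intro S hS hSA
      have := of_sorted_of_swap_cons hswap (R := R) (x := x) (S := S) (pre := pre)
        (by simpa [hSA] using hb) hS (fun S' h1 h2 => h S' h1 (by simpa [hSA] using h2))
      simpa using this

/-! ### Leading words -/

/-- The polynomial `f` is a combination of multiples of elements of `BG` that are bounded by a
monomial of `f`. -/
def BoundedBySelf (f : Poly K n) : Prop :=
  ∃ w, f ∈ relSpan K (upto w) ∧ f.coeff (FreeMonoid.ofList w) ≠ 0

theorem BoundedBySelf.neg {f : Poly K n} (h : BoundedBySelf f) : BoundedBySelf (-f) := by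
  obtain ⟨w, h1, h2⟩ := h
  exact ⟨w, neg_mem h1, by simpa using h2⟩

theorem BoundedBySelf.of_sub_mem {f : Poly K n} {w : List (Letter n)} {D : Set (List (Letter n))}
    (h : f ∈ relSpan K (upto w)) (hf : f - word w ∈ wordSpan K D) (hw : w ∉ D) :
    BoundedBySelf f := by
  refine ⟨w, h, fun h0 => hw ?_⟩
  refine mem_of_mem_support hf (v := FreeMonoid.ofList w) (Finsupp.mem_support_iff.2 ?_)
  rw [MonoidAlgebra.coeff_sub, Finsupp.sub_apply, h0, word_eq_single]
  simp

/-- The case of a commutator led by the word `a T`. -/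
theorem BoundedBySelf.comm_of_ne {a : Letter n} {T : List (Letter n)}
    (h : comm K a T ∈ relSpan K (upto (a :: T))) (h1 : a :: (T.map bar).reverse ≠ a :: T)
    (h2 : T ++ [a] ≠ a :: T) (h3 : (T.map bar).reverse ++ [a] ≠ a :: T) :
    BoundedBySelf (comm K a T) := by
  refine .of_sub_mem h
    (D := {a :: (T.map bar).reverse, T ++ [a], (T.map bar).reverse ++ [a]}) ?_ ?_
  · have e1 : comm K a T - word (a :: T) = X a * conj (word T) - word T * X a -
        conj (word T) * X a := by
      rw [comm, bracket, word_cons]; noncomm_ring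
    have hX := X_mem_wordSpan (K := K) a
    have hc := conj_word_mem_wordSpan (K := K) T
    rw [e1]
    refine sub_mem (sub_mem (mul_mem_wordSpan hX hc ?_)
      (mul_mem_wordSpan (word_mem_wordSpan (Set.mem_singleton T)) hX ?_))
      (mul_mem_wordSpan hc hX ?_) <;> rintro _ rfl _ rfl <;> simp
  · rintro (h | h | h)
    · exact h1 h.symm
    · exact h2 h.symm
    · exact h3 h.symm

/-- The case of a commutator led by the word `T a`. -/
theorem BoundedBySelf.comm_of_ne_append {a : Letter n} {T : List (Letter n)}
    (h : comm K a T ∈ relSpan K (upto (T ++ [a]))) (h1 : a :: (T.map bar).reverse ≠ T ++ [a])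
    (h2 : a :: T ≠ T ++ [a]) (h3 : (T.map bar).reverse ++ [a] ≠ T ++ [a]) :
    BoundedBySelf (comm K a T) := by
  rw [← neg_neg (comm K a T)]
  refine BoundedBySelf.neg (.of_sub_mem (neg_mem h)
    (D := {a :: (T.map bar).reverse, a :: T, (T.map bar).reverse ++ [a]}) ?_ ?_)
  · have e1 : -comm K a T - word (T ++ [a]) = conj (word T) * X a - X a * word T -
        X a * conj (word T) := by
      rw [comm, bracket, word_append, ← X_eq_word]; noncomm_ring
    have hX := X_mem_wordSpan (K := K) a
    have hc := conj_word_mem_wordSpan (K := K) T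
    rw [e1]
    refine sub_mem (sub_mem (mul_mem_wordSpan hc hX ?_)
      (mul_mem_wordSpan hX (word_mem_wordSpan (Set.mem_singleton T)) ?_))
      (mul_mem_wordSpan hX hc ?_) <;> rintro _ rfl _ rfl <;> simp
  · rintro (h | h | h)
    · exact h1 h.symm
    · exact h2 h.symm
    · exact h3 h.symm

theorem Rel.boundedBySelf {a y x : Letter n} {U : List (Letter n)} (hxa : Below x a)
    (hya : Below y a) (hxy : Below x y) (h : Rel K a y U x) :
    BoundedBySelf (comm K a (y :: (U ++ [x]))) := by
  refine .comm_of_ne h ?_ ?_ ?_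
  · simp [hxy.2.2.1.ne]
  · simp [hya.2.1.ne]
  · simp [hxa.2.2.1.ne]

/-! ### The variants of the commutators in `BG` -/

theorem Barred.base_eq {a a' : Letter n} (h : Barred a a') : a'.base = a.base := by
  rcases h with rfl | rfl
  · rfl
  · cases a <;> rfl

theorem Barred.of_e {b : Basis} {a : Letter n} (h : Barred (e b) a) : a = e b := by
  rcases h with rfl | rfl <;> rfl

theorem tr_of_barred {a a' : Letter n} (h : Barred a a') : tr K a' = tr K a := by
  rcases h with rfl | rfl
  · rfl
  · exact tr_bar a

theorem comm_singleton_of_barred {a x x' : Letter n} (h : Barred x x') :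
    comm K a [x'] = comm K a [x] := by
  rw [comm_singleton, comm_singleton, tr_of_barred h]

/-- The commutator `a[x] - [x]a` does not change when a bar is put on `x`, so it is led by `a q̄`
whether `x` is `q` or `q̄`. -/
theorem boundedBySelf_comm_bar {a : Letter n} {l : Fin n} (h : Below (q l) a) {x : Letter n}
    (hx : Barred (q l) x) : BoundedBySelf (comm K a [x]) := by
  have hlt := q_lt_bar l
  rw [comm_singleton_of_barred hx, ← comm_singleton_of_barred (x' := qb l) (Or.inr rfl)]
  refine .comm_of_ne ?_ ?_ ?_ ?_
  · have := mul_tr_sub_mem_upto (K := K) h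
    rw [max_bar_of_lt hlt] at this
    rwa [comm_singleton_of_barred (x := q l) (x' := qb l) (Or.inr rfl), comm_singleton]
  · simp
  · simpa using fun h' => absurd h' h.2.2.1.ne
  · simpa using fun h' => absurd h' h.2.1.ne

/-- The counterpart of `boundedBySelf_comm_bar` for a letter `a` below the variable; the leading
word is `q̄ a`. -/
theorem boundedBySelf_bar_comm {a : Letter n} {l : Fin n} (h : Below a (q l)) {x : Letter n}
    (hx : Barred (q l) x) : BoundedBySelf (comm K a [x]) := by
  have hlt := q_lt_bar l
  rw [comm_singleton_of_barred hx, ← comm_singleton_of_barred (x' := qb l) (Or.inr rfl)]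
  refine .comm_of_ne_append ?_ ?_ ?_ ?_
  · have := tr_mul_sub_mem (K := K) h trivial (w := [qb l, a]) (wordLE_of_lt [] hlt le_rfl)
      (.refl _)
    rwa [comm_singleton_of_barred (x := q l) (x' := qb l) (Or.inr rfl), comm_singleton,
      ← neg_mem_iff, neg_sub]
  · simpa using fun h' => absurd h' h.2.2.2.1.ne
  · simpa using fun h' => absurd h' h.2.2.2.1.ne
  · simp

/-- The leading word is `y₁ y₂ x`, except for `y₁ = q` and `y₂ = q̄`, where it is `y₂ x y₁`. -/
theorem boundedBySelf_square {l m : Fin n} (hlm : l < m) {y₁ y₂ x : Letter n}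
    (hy₁ : Barred (q m) y₁) (hy₂ : Barred (q m) y₂) (hx : Barred (q l) x) :
    BoundedBySelf (comm K y₁ [y₂, x]) := by
  have h1 : Below x y₁ := (Below.q_q hlm).of_barred hx hy₁
  have h2 : Below x y₂ := (Below.q_q hlm).of_barred hx hy₂
  by_cases hy : y₁ < y₂
  · refine .comm_of_ne_append ?_ ?_ ?_ ?_
    · exact comm_square_mem hlm hy₁ hy₂ hx (wordLE_of_lt [] hy le_rfl) (.refl _)
    · simp [hy.ne]
    · simp [hy.ne]
    · simp [h2.2.2.1.ne]
  · refine .comm_of_ne ?_ ?_ ?_ ?_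
    · refine comm_square_mem hlm hy₁ hy₂ hx (.refl _) ?_
      rcases (not_lt.1 hy).lt_or_eq with hy | rfl
      · exact wordLE_of_lt [] hy le_rfl
      · exact wordLE_of_lt [y₂] h1.2.1 le_rfl
    · simp [h2.2.2.1.ne]
    · simp [h2.2.1.ne]
    · simp [h1.2.2.1.ne]

theorem boundedBySelf_of_bracketFirst {a : Letter n} {T : List (Letter n)} (h : BracketFirst a T)
    {a' : Letter n} {T' : List (Letter n)} (ha : Barred a a') (hT : List.Forall₂ Barred T T') :
    BoundedBySelf (comm K a' T') := by
  have pair : ∀ {a y : Letter n} {l : Fin n}, BracketFirst a [y, q l] → Below (q l) y →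
      a.base ≠ y.base → ∀ {a' : Letter n} {T' : List (Letter n)}, Barred a a' →
      List.Forall₂ Barred [y, q l] T' → BoundedBySelf (comm K a' T') := by
    intro a y l h hxy hne a' T' ha hT
    rcases hT with _ | ⟨hy, _ | ⟨hx, _ | _⟩⟩
    have hxy' := hxy.of_barred hx hy
    have hay : a' ≠ _ := fun h => hne (by rw [← ha.base_eq, ← hy.base_eq, h])
    refine .comm_of_ne_append (comm_pair_mem h ha hy hx) ?_ ?_ ?_
    · simp [hay]
    · simp [hay]
    · simp [hxy'.2.2.1.ne]
  have single : ∀ {a : Letter n} {l : Fin n}, Below a (q l) →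
      ∀ {a' : Letter n} {T' : List (Letter n)}, Barred a a' →
      List.Forall₂ Barred [q l] T' → BoundedBySelf (comm K a' T') := by
    intro a l h a' T' ha hT
    rcases hT with _ | ⟨hx, _ | _⟩
    exact boundedBySelf_bar_comm (h.of_barred ha (Or.inl rfl)) hx
  have hlt : ∀ {l m : Fin n}, l < m → (q l : Letter n) ≠ q m := fun h => (Below.q_q h).2.1.ne
  cases h with
  | b2_1 h1 => exact single (Below.q_q h1).bar_left ha hT
  | b2_2 h1 => exact single (.q_q h1) ha hT
  | b3_1 h1 h2 => exact pair (.b3_1 h1 h2) (.q_q h2) (hlt (h1.trans h2)) ha hT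
  | b3_2 h1 h2 => exact pair (.b3_2 h1 h2) (.q_q (h1.trans h2)) (hlt h2) ha hT
  | b3_3 h1 h2 => exact pair (.b3_3 h1 h2) (.q_q (h1.trans h2)) (hlt h2) ha hT
  | b3_4 h1 => exact pair (.b3_4 h1) (.q_q h1) (hlt h1) ha hT
  | b3_5 h1 => exact pair (.b3_5 h1) (.q_q h1) (hlt h1) ha hT
  | b3_6 b h1 => exact pair (.b3_6 b h1) (.q_e _ b) (by simp [base]) ha hT
  | b3_7 b h1 => exact pair (.b3_7 b h1) (.q_e _ b) (by simp [base]) ha hT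
  | b3_8 b h1 => exact pair (.b3_8 b h1) (.q_e _ b) (by simp [base]) ha hT
  | b3_9 _ b => exact pair (.b3_9 _ b) (.q_e _ b) (by simp [base]) ha hT
  | b3_10 _ b => exact pair (.b3_10 _ b) (.q_e _ b) (by simp [base]) ha hT
  | b3_11 => exact pair (.b3_11 _) (.q_e _ _) (by simp [base]) ha hT
  | b3_12 => exact pair (.b3_12 _) (.q_e _ _) (by simp [base]) ha hT
  | b3_13 => exact pair (.b3_13 _) (.q_e _ _) (by simp [base]) ha hT

theorem map_base_of_barred {A A' : List (Letter n)} (h : List.Forall₂ Barred A A') :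
    A'.map base = A.map base := by
  induction h with
  | nil => rfl
  | cons h _ ih => rw [List.map_cons, List.map_cons, h.base_eq, ih]

theorem base_le_base {x y : Letter n} (h : x ≤ y) : x.base ≤ y.base := by
  rcases x with ⟨l, hl⟩ | ⟨l, hl⟩ | (_ | _ | _) <;>
    rcases y with ⟨m, hm⟩ | ⟨m, hm⟩ | (_ | _ | _) <;>
    simp only [base, le_iff_rank, rank] at h ⊢ <;> omega

/-- A sequence with the same underlying letters as `A` inherits a lower bound by an unbarred
variable. -/
theorem forall_of_map_base_eq {A S : List (Letter n)} {l : Fin n} (h : S.map base = A.map base)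
    (hA : ∀ x ∈ A, x.IsVar ∧ q l ≤ x) : ∀ x ∈ S, x.IsVar ∧ q l ≤ x := by
  intro x hx
  have hx' : x.base ∈ S.map base := List.mem_map_of_mem hx
  rw [h] at hx'
  obtain ⟨y, hy, hyx⟩ := List.mem_map.1 hx'
  obtain ⟨h1, h2⟩ := hA y hy
  refine ⟨?_, (base_le_base h2).trans (hyx.le.trans (base_le x))⟩
  rcases y with m | m | b <;> rcases x with p | p | b' <;> trivial

theorem Rel.of_sorted {a y x : Letter n} {A R : List (Letter n)} (hxa : Below x a)
    (hya : Below y a) (hxy : Below x y) (hb : (A.map base).Pairwise (· ≤ ·))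
    (h : ∀ S, S.Pairwise (· ≤ ·) → S.map base = A.map base → Rel K a y (S ++ R) x) :
    Rel K a y (A ++ R) x :=
  of_sorted_of_swap (P := fun U => Rel K a y U x) (pre := []) (R := R)
    (fun _ _ _ => Rel.swap hxa hya hxy) hb h

theorem pairwise_map_base {A : List (Letter n)} (h : A.Pairwise (· ≤ ·)) :
    (A.map base).Pairwise (· ≤ ·) :=
  List.pairwise_map.2 (h.imp base_le_base)

/-- The case of inner letters that are all variables. -/
theorem rel_of_barred_sorted (hK : ringChar K ≠ 2) {l₁ l₂ l₃ : Fin n} (h12 : l₁ < l₂)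
    (h23 : l₂ < l₃) {a y x : Letter n} (ha : Barred (q l₃) a) (hy : Barred (q l₂) y)
    (hx : Barred (q l₁) x) {A A' : List (Letter n)} (hA : ∀ u ∈ A, u.IsVar ∧ q l₃ ≤ u)
    (hs : (A.map base).Pairwise (· ≤ ·)) (hA' : List.Forall₂ Barred A A') : Rel K a y A' x := by
  have hxy : Below x y := (Below.q_q h12).of_barred hx hy
  have hya : Below y a := (Below.q_q h23).of_barred hy ha
  have hb := map_base_of_barred hA'
  have := Rel.of_sorted (K := K) (R := []) (A := A') (hxy.trans hya) hya hxy (by rwa [hb])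
    fun S hS hbS => by
      rw [List.append_nil]
      exact rel_of_sorted hK h12 h23 ha hy hx (forall_of_map_base_eq (hbS.trans hb) hA) hS
  simpa using this

/-- The commutators whose last inner letter is the basis letter `e b`: as these are in `BG` for all
sorted sequences `S` of the other inner letters, only the outer bars and the sorting remain. -/
theorem rel_of_barred_basis (hK : ringChar K ≠ 2) {l₁ l₂ : Fin n} (h12 : l₁ < l₂)
    {a₀ a y x : Letter n} (h2a : Below (q l₂) a₀) (ha₀ : a₀.base = a₀) (b : Basis)
    (ha : Barred a₀ a) (hy : Barred (q l₂) y) (hx : Barred (q l₁) x) {A A' : List (Letter n)}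
    (hA : ∀ u ∈ A, u.IsVar ∧ q l₂ ≤ u) (hs : (A.map base).Pairwise (· ≤ ·))
    (hA' : List.Forall₂ Barred A A')
    (hl : ∀ S : List (Letter n), S.Pairwise (· ≤ ·) → S.map base = A.map base →
      LetterFirst a₀ (q l₂ :: (S ++ [e b, q l₁]))) : Rel K a y (A' ++ [e b]) x := by
  have hxy : Below x y := (Below.q_q h12).of_barred hx hy
  have hya : Below y a := h2a.of_barred hy ha
  have hb := map_base_of_barred hA'
  refine Rel.of_sorted (hxy.trans hya) hya hxy (by rwa [hb]) fun S hS hbS => ?_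
  refine Rel.bar_outer hK h12 h2a ha₀ (by simp) ?_ (Rel.of_letterFirst
    ((Below.q_q h12).trans h2a) h2a (.q_q h12) ?_) ha hy hx
  · intro v hv
    rcases List.mem_append.1 hv with hv | hv
    · obtain ⟨h1, h2⟩ := forall_of_map_base_eq (hbS.trans hb) hA v hv
      obtain ⟨p, hp⟩ := h1.exists_barred
      exact (Below.q_q (h12.trans_le (le_of_q_le hp h2))).of_barred (Or.inl rfl) hp
    · rw [List.mem_singleton.1 hv]
      exact .q_e _ b
  · simpa using hl S hS (hbS.trans hb)

theorem exists_of_forall₂_append {α β : Type*} {R : α → β → Prop} {A B : List α} {T : List β}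
    (h : List.Forall₂ R (A ++ B) T) :
    ∃ A' B', List.Forall₂ R A A' ∧ List.Forall₂ R B B' ∧ T = A' ++ B' := by
  induction A generalizing T with
  | nil => exact ⟨[], T, .nil, h, rfl⟩
  | cons a A ih =>
    rcases h with _ | ⟨h1, h2⟩
    obtain ⟨A', B', hA, hB, rfl⟩ := ih h2
    exact ⟨_ :: A', B', .cons h1 hA, hB, rfl⟩

theorem boundedBySelf_of_letterFirst (hK : ringChar K ≠ 2) {a : Letter n} {T : List (Letter n)}
    (h : LetterFirst a T) {a' : Letter n} {T' : List (Letter n)} (ha : Barred a a')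
    (hT : List.Forall₂ Barred T T') : BoundedBySelf (comm K a' T') := by
  -- the four-letter commutators are treated together with the longer ones
  have long : ∀ {l₁ l₂ l₃ : Fin n} {A : List (Letter n)}, l₁ < l₂ → l₂ < l₃ →
      (∀ x ∈ A, x.IsVar ∧ q l₃ ≤ x) → A.Pairwise (· ≤ ·) →
      ∀ {a' : Letter n} {T' : List (Letter n)}, Barred (q l₃) a' →
      List.Forall₂ Barred (q l₂ :: (A ++ [q l₁])) T' → BoundedBySelf (comm K a' T') := by
    intro l₁ l₂ l₃ A h12 h23 hA hs a' T' ha hT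
    rcases hT with _ | ⟨hy, hT⟩
    obtain ⟨A', R, hA', hR, rfl⟩ := exists_of_forall₂_append hT
    rcases hR with _ | ⟨hx, _ | _⟩
    have hxy := (Below.q_q h12).of_barred hx hy
    have hya := (Below.q_q h23).of_barred hy ha
    exact (rel_of_barred_sorted hK h12 h23 ha hy hx hA (pairwise_map_base hs) hA').boundedBySelf
      (hxy.trans hya) hya hxy
  have basis : ∀ {l₁ l₂ : Fin n} {a : Letter n} {b : Basis} {A : List (Letter n)}, l₁ < l₂ →
      Below (q l₂) a → a.base = a → (∀ x ∈ A, x.IsVar ∧ q l₂ ≤ x) → A.Pairwise (· ≤ ·) →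
      (∀ S : List (Letter n), S.Pairwise (· ≤ ·) → S.map base = A.map base →
        LetterFirst a (q l₂ :: (S ++ [e b, q l₁]))) →
      ∀ {a' : Letter n} {T' : List (Letter n)}, Barred a a' →
      List.Forall₂ Barred (q l₂ :: (A ++ [e b, q l₁])) T' → BoundedBySelf (comm K a' T') := by
    intro l₁ l₂ a b A h12 h2a hab hA hs hl a' T' ha hT
    rcases hT with _ | ⟨hy, hT⟩
    obtain ⟨A', R, hA', hR, rfl⟩ := exists_of_forall₂_append hT
    rcases hR with _ | ⟨hz, _ | ⟨hx, _ | _⟩⟩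
    obtain rfl := hz.of_e
    have hxy := (Below.q_q h12).of_barred hx hy
    have hya := h2a.of_barred hy ha
    simpa using (rel_of_barred_basis hK h12 h2a hab b ha hy hx hA (pairwise_map_base hs) hA'
      hl).boundedBySelf (hxy.trans hya) hya hxy
  have nil : ∀ {S : List (Letter n)}, S.map base = ([] : List (Letter n)).map base → S = [] :=
    fun h => by simpa using h
  cases h with
  | c2_var h1 =>
    rcases hT with _ | ⟨hx, _ | _⟩
    exact boundedBySelf_comm_bar ((Below.q_q h1).of_barred (Or.inl rfl) ha) hx
  | c2_basis b l =>
    rcases hT with _ | ⟨hx, _ | _⟩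
    exact boundedBySelf_comm_bar ((Below.q_e l b).of_barred (Or.inl rfl) ha) hx
  | c3 h1 =>
    rcases hT with _ | ⟨hy, _ | ⟨hx, _ | _⟩⟩
    exact boundedBySelf_square h1 ha hy hx
  | @d4_323 l₁ l₂ l₃ h1 h2 =>
    exact long (A := [q l₃]) h1 h2 (by simp [IsVar]) (by simp) ha hT
  | @d4_324 l₁ l₂ l₃ l₄ h1 h2 h3 =>
    exact long (A := [q l₄]) h1 h2 (by simpa [IsVar] using (Below.q_q h3).2.1.le) (by simp) ha hT
  | d4_32e b h1 h2 =>
    exact basis (A := []) h1 (.q_q h2) rfl (by simp) (by simp)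
      (fun S _ h => by rw [nil h]; exact .d4_32e b h1 h2) ha hT
  | d4_e2e b' b h1 h2 h3 =>
    exact basis (A := []) h1 (.q_e _ b') rfl (by simp) (by simp)
      (fun S _ h => by rw [nil h]; exact .d4_e2e b' b h1 h2 h3) ha hT
  | @dm_var l₁ l₂ l₃ m A h1 h2 hne hA hs =>
    refine long (A := A ++ [q m]) h1 h2 ?_ ?_ ha (by simpa using hT)
    · intro x hx
      rcases List.mem_append.1 hx with hx | hx
      · exact ⟨(hA x hx).1, (hA x hx).2.1⟩
      · obtain ⟨c, hc⟩ := List.exists_mem_of_ne_nil A hne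
        rw [List.mem_singleton.1 hx]
        exact ⟨trivial, (hA c hc).2.1.trans (hA c hc).2.2.le⟩
    · rw [List.pairwise_append]
      refine ⟨hs, by simp, fun c hc d hd => ?_⟩
      rw [List.mem_singleton.1 hd]
      exact (hA c hc).2.2.le
  | dm_basis b A h1 h2 hne hA hs =>
    refine basis (A := A) h1 (.q_q h2) rfl
      (fun x hx => ⟨(hA x hx).1, (Below.q_q h2).2.1.le.trans (hA x hx).2⟩) hs
      (fun S hS h => .dm_basis b S h1 h2 ?_ (forall_of_map_base_eq h hA) hS) ha hT
    rintro rfl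
    exact hne (by simpa using h.symm)

/-! ### Replacing letters by their conjugates -/

theorem BoundedBySelf.reducesTo {f : Poly K n} (h : BoundedBySelf f) : ReducesTo (BG K n) f 0 := by
  obtain ⟨w, h1, h2⟩ := h
  exact reducesTo_zero_of_mem_relSpan h1 h2

theorem reducesTo_smul_of_BG {g : Poly K n} (hg : g ∈ BG K n) (c : K) :
    ReducesTo (BG K n) (c • g) 0 := by
  have e1 : MonoidAlgebra.single (1 : Mon n) c * g * MonoidAlgebra.single (1 : Mon n) 1 =
      c • g := by
    have h1 : (MonoidAlgebra.single (1 : Mon n) c : Poly K n) = c • 1 := by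
      rw [MonoidAlgebra.one_def, MonoidAlgebra.smul_single, smul_eq_mul, mul_one]
    rw [h1, ← MonoidAlgebra.one_def, mul_one, smul_mul_assoc, one_mul]
  refine ⟨fun v hv => by simp at hv, 1, fun _ => c, fun _ => 1, fun _ => 1, fun _ => g,
    fun _ => hg, fun _ v hv => ⟨v, ?_, Or.inl rfl⟩, ?_⟩
  · rwa [e1] at hv
  · simp only [e1, Finset.univ_unique, Finset.sum_const, Finset.card_singleton, one_smul, zero_add]

theorem IsVariant.exists_barred {a : Letter n} {p : Poly K n} (h : IsVariant a p) :
    ∃ a', Barred a a' ∧ (p = X a' ∨ p = -X a') := by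
  rcases h with rfl | rfl
  · exact ⟨a, Or.inl rfl, Or.inl rfl⟩
  · refine ⟨a.bar, Or.inr rfl, ?_⟩
    cases a
    · exact Or.inl rfl
    · exact Or.inl rfl
    · exact Or.inr rfl

theorem exists_barred_of_forall₂_isVariant {T : List (Letter n)} {T' : List (Poly K n)}
    (h : List.Forall₂ IsVariant T T') :
    ∃ T'', List.Forall₂ Barred T T'' ∧ (T'.prod = word T'' ∨ T'.prod = -word T'') := by
  induction h with
  | nil => exact ⟨[], .nil, Or.inl rfl⟩
  | cons h _ ih =>
    obtain ⟨a', ha, ha'⟩ := h.exists_barred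
    obtain ⟨T'', hT, hT'⟩ := ih
    refine ⟨a' :: T'', .cons ha hT, ?_⟩
    rw [List.prod_cons, word_cons]
    rcases ha' with h | h <;> rcases hT' with h' | h' <;> simp [h, h']

theorem bracket_neg (f : Poly K n) : bracket (-f) = -bracket f := by
  rw [bracket, bracket, conj_neg, neg_add]

/-- Up to sign, the variants of a commutator are commutators of letters with brackets of words. -/
theorem boundedBySelf_variant {a : Letter n} {T : List (Letter n)}
    (H : ∀ {a' T'}, Barred a a' → List.Forall₂ Barred T T' → BoundedBySelf (comm K a' T'))
    {p : Poly K n} {T' : List (Poly K n)} (hp : IsVariant a p)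
    (hT : List.Forall₂ IsVariant T T') :
    BoundedBySelf (p * bracket T'.prod - bracket T'.prod * p) := by
  obtain ⟨a', ha, ha'⟩ := hp.exists_barred
  obtain ⟨T'', hT'', h⟩ := exists_barred_of_forall₂_isVariant hT
  have hB := H ha hT''
  have hN := hB.neg
  rw [comm] at hB hN
  rcases ha' with rfl | rfl <;> rcases h with h | h <;>
    simp only [h, bracket_neg, neg_mul, mul_neg, neg_neg]
  · exact hB
  · convert hN using 1; abel
  · convert hN using 1; abel
  · exact hB

theorem replace_X_of_mem {S : Finset (Letter n)} {a : Letter n} (h : a.base ∈ S) :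
    replace S (X a : Poly K n) = conjLetter a := by
  simp [replace, X, MonoidAlgebra.lift_single, h]

theorem replace_X_of_notMem {S : Finset (Letter n)} {a : Letter n} (h : a.base ∉ S) :
    replace S (X a : Poly K n) = X a := by
  simp [replace, X, MonoidAlgebra.lift_single, h]

theorem isVariant_replace_X (S : Finset (Letter n)) (a : Letter n) :
    IsVariant a (replace S (X a : Poly K n)) := by
  by_cases h : a.base ∈ S
  · exact Or.inr (replace_X_of_mem h)
  · exact Or.inl (replace_X_of_notMem h)

theorem replace_conjLetter (S : Finset (Letter n)) (a : Letter n) :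
    replace S (conjLetter a : Poly K n) = conj (replace S (X a)) := by
  by_cases h : a.base ∈ S
  · rw [replace_X_of_mem h, conj_conjLetter]
    rcases a with l | l | b
    · exact replace_X_of_mem (a := qb l) h
    · exact replace_X_of_mem (a := q l) h
    · rw [conjLetter, map_neg, replace_X_of_mem h, conjLetter, neg_neg]
  · rw [replace_X_of_notMem h, conj_X]
    rcases a with l | l | b
    · exact replace_X_of_notMem (a := qb l) h
    · exact replace_X_of_notMem (a := q l) h
    · rw [conjLetter, map_neg, replace_X_of_notMem h]

theorem replace_word (S : Finset (Letter n)) (T : List (Letter n)) :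
    replace S (word T : Poly K n) = (T.map fun a => replace S (X a)).prod := by
  rw [word, map_list_prod, List.map_map]
  rfl

theorem replace_conj_word (S : Finset (Letter n)) (T : List (Letter n)) :
    replace S (conj (word T) : Poly K n) = conj (replace S (word T)) := by
  induction T with
  | nil => rw [word_nil, conj_one, map_one, conj_one]
  | cons a T ih =>
    rw [word_cons, conj_mul, map_mul, map_mul, conj_mul, ih, conj_X, replace_conjLetter]

theorem replace_bracket_word (S : Finset (Letter n)) (T : List (Letter n)) :
    replace S (bracket (word T) : Poly K n) =
      bracket (T.map fun a => replace S (X a)).prod := by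
  rw [bracket, map_add, replace_conj_word, ← replace_word, bracket]

theorem forall₂_isVariant_replace (S : Finset (Letter n)) (T : List (Letter n)) :
    List.Forall₂ IsVariant T (T.map fun a => replace S (X a : Poly K n)) := by
  induction T with
  | nil => exact .nil
  | cons a T ih => exact .cons (isVariant_replace_X S a) ih

/-- The relation defining the conjugate of a variable, with the variable conjugated, is up to
sign that relation itself modulo the commutators of `[q]` with the basis letters. -/
theorem boundedBySelf_conj_def_bar (l : Fin n) :
    BoundedBySelf (X (e .k) * X (qb l) * X (e .k) + X (e .j) * X (qb l) * X (e .j) +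
      X (e .i) * X (qb l) * X (e .i) + 2 * X (q l) + X (qb l) : Poly K n) := by
  have hX := X_mem_wordSpan (K := K) (n := n)
  have hlt := q_lt_bar l
  have hle : ∀ b : Basis, ∀ x : Letter n, x ≤ qb l → ∀ v, v = [e b, x, e b] →
      WordLE v [e .k, qb l, e .k] := by
    rintro b x hx v rfl
    have hbk : (e b : Letter n) = e .k ∨ (e b : Letter n) < e .k := by
      cases b <;> simp [lt_iff_rank, rank]
    rcases hbk with h | h
    · rw [h]
      rcases hx.lt_or_eq with hx | rfl
      · exact wordLE_of_lt [e .k] hx le_rfl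
      · exact .refl _
    · exact wordLE_of_lt [] h le_rfl
  have h3 : ∀ b x, (X (e b) * X x * X (e b) : Poly K n) ∈ wordSpan K {[e b, x, e b]} :=
    fun b x => mul_mem_wordSpan (mul_mem_wordSpan (D'' := {[e b, x]}) (hX _) (hX x)
      (by rintro _ rfl _ rfl; rfl)) (hX _) (by rintro _ rfl _ rfl; rfl)
  refine .of_sub_mem (w := [e .k, qb l, e .k])
    (D := {[e .j, qb l, e .j], [e .i, qb l, e .i], [q l], [qb l]}) ?_ ?_ (by simp)
  · have e1 : (X (e .k) * X (qb l) * X (e .k) + X (e .j) * X (qb l) * X (e .j) +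
        X (e .i) * X (qb l) * X (e .i) + 2 * X (q l) + X (qb l) : Poly K n) =
        -(X (e .k) * X (q l) * X (e .k) + X (e .j) * X (q l) * X (e .j) +
          X (e .i) * X (q l) * X (e .i) + 2 * X (qb l) + X (q l)) +
        (((X (e .k) * tr K (q l) - tr K (q l) * X (e .k)) * X (e .k) +
          tr K (q l) * (X (e .k) * X (e .k) + 1)) +
        ((X (e .j) * tr K (q l) - tr K (q l) * X (e .j)) * X (e .j) +
          tr K (q l) * (X (e .j) * X (e .j) + 1)) +
        ((X (e .i) * tr K (q l) - tr K (q l) * X (e .i)) * X (e .i) +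
          tr K (q l) * (X (e .i) * X (e .i) + 1))) := by
      rw [tr_of_isVar (x := q l) trivial, bar_q]
      noncomm_ring
    have hshort : ∀ x : Letter n, (X x : Poly K n) ∈ wordSpan K (upto [e .k, qb l, e .k]) :=
      fun x => wordSpan_mono (by rintro _ rfl; exact .of_length_lt (by simp)) (hX x)
    have hb : ∀ b : Basis, (X (e b) * tr K (q l) - tr K (q l) * X (e b)) * X (e b) +
        tr K (q l) * (X (e b) * X (e b) + 1) ∈ relSpan K (upto [e .k, qb l, e .k]) := by
      intro b
      have h := mul_tr_sub_mem_upto (K := K) (Below.q_e l b)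
      rw [max_bar_of_lt hlt] at h
      refine relSpan_upto_mono (hle b (qb l) le_rfl _ rfl) (add_mem ?_ ?_)
      · exact (mul_X_mem_upto (e b) h :)
      · exact tr_mul_mem_of_below (e_sq_add_one_mem b) (.q_e l b) (by simp)
    rw [e1]
    refine add_mem (neg_mem (mem_relSpan_of_BG (.conj_def l) ?_))
      (add_mem (add_mem (hb _) (hb _)) (hb _))
    have h3' : ∀ b, (X (e b) * X (q l) * X (e b) : Poly K n) ∈
        wordSpan K (upto [e .k, qb l, e .k]) := fun b =>
      wordSpan_mono (by rintro v hv; exact hle b (q l) hlt.le v hv) (h3 b _)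
    rw [two_mul]
    exact add_mem (add_mem (add_mem (add_mem (h3' _) (h3' _)) (h3' _))
      (add_mem (hshort _) (hshort _))) (hshort _)
  · have e2 : (X (e .k) * X (qb l) * X (e .k) + X (e .j) * X (qb l) * X (e .j) +
        X (e .i) * X (qb l) * X (e .i) + 2 * X (q l) + X (qb l) : Poly K n) -
        word [e .k, qb l, e .k] = X (e .j) * X (qb l) * X (e .j) +
        X (e .i) * X (qb l) * X (e .i) + (X (q l) + X (q l)) + X (qb l) := by
      rw [word_cons, word_pair]
      noncomm_ring
    rw [e2]
    refine add_mem (add_mem (add_mem (wordSpan_mono ?_ (h3 _ _)) (wordSpan_mono ?_ (h3 _ _)))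
      (add_mem (wordSpan_mono ?_ (hX _)) (wordSpan_mono ?_ (hX _)))) (wordSpan_mono ?_ (hX _)) <;>
    simp

theorem replace_e_mul_mul (S : Finset (Letter n)) (b : Basis) (f : Poly K n) :
    replace S (X (e b) * f * X (e b)) = X (e b) * replace S f * X (e b) := by
  rw [map_mul, map_mul]
  by_cases h : (e b : Letter n).base ∈ S
  · rw [replace_X_of_mem h, conjLetter, neg_mul, neg_mul_neg]
  · rw [replace_X_of_notMem h]

theorem reducesTo_replace (hK : ringChar K ≠ 2) (S : Finset (Letter n)) {f : Poly K n}
    (hf : f ∈ BG K n) (hft : f ∉ multTable K n) : ReducesTo (BG K n) (replace S f) 0 := by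
  cases hf with
  | table _ h => exact absurd h hft
  | conj_comm l =>
    have hg := BG.conj_comm (K := K) l
    rw [map_sub, map_mul, map_mul]
    by_cases h : q l ∈ S
    · rw [replace_X_of_mem (a := q l) h, replace_X_of_mem (a := qb l) h]
      have := reducesTo_smul_of_BG hg (-1)
      rwa [neg_one_smul, neg_sub] at this
    · rw [replace_X_of_notMem (a := q l) h, replace_X_of_notMem (a := qb l) h]
      have := reducesTo_smul_of_BG hg 1
      rwa [one_smul] at this
  | conj_def l =>
    rw [map_add, map_add, map_add, map_add, replace_e_mul_mul, replace_e_mul_mul,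
      replace_e_mul_mul, map_mul, map_ofNat]
    by_cases h : q l ∈ S
    · rw [replace_X_of_mem (a := q l) h, replace_X_of_mem (a := qb l) h]
      exact (boundedBySelf_conj_def_bar l).reducesTo
    · rw [replace_X_of_notMem (a := q l) h, replace_X_of_notMem (a := qb l) h]
      have := reducesTo_smul_of_BG (BG.conj_def (K := K) l) 1
      rwa [one_smul] at this
  | letter_first a T h =>
    rw [map_sub, map_mul, map_mul, replace_bracket_word]
    exact (boundedBySelf_variant (boundedBySelf_of_letterFirst hK h) (isVariant_replace_X S a)
      (forall₂_isVariant_replace S T)).reducesTo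
  | bracket_first a T h =>
    rw [map_sub, map_mul, map_mul, replace_bracket_word, ← neg_sub]
    exact (boundedBySelf_variant (boundedBySelf_of_bracketFirst h) (isVariant_replace_X S a)
      (forall₂_isVariant_replace S T)).neg.reducesTo

end QuatPoly

theorem mainTheorem7 (K : Type*) [Field K] (hK : ringChar K ≠ 2) (n : ℕ)
    (f : QuatPoly.Poly K n) (hf : f ∈ QuatPoly.BGbar K n) :
    QuatPoly.ReducesTo (QuatPoly.BG K n) f 0 := by
  cases hf with
  | of_BG _ h => simpa using QuatPoly.reducesTo_smul_of_BG h 1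
  | everywhere f S h ht => exact QuatPoly.reducesTo_replace hK S h ht
  | letter_first a T a' T' h ha hT =>
    exact (QuatPoly.boundedBySelf_variant
      (QuatPoly.boundedBySelf_of_letterFirst hK h) ha hT).reducesTo
  | bracket_first a T a' T' h ha hT =>
    rw [← neg_sub]
    exact (QuatPoly.boundedBySelf_variant
      (QuatPoly.boundedBySelf_of_bracketFirst h) ha hT).neg.reducesTo
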